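/- Let $0<\tau_1<1$ and, for $\tau_1<\tau<\infty$, $0<c<1$, let $\hat U(\tau,c)=-(1-c)\log\frac{\tau-c\tau_1}{1-c}$ and $U(\tau,c)=\hat U(\tau,c)+W(c,\theta)$. With $\rho=1/\tau$, put $p(\rho,c)=-U_\tau(\tau,c)$ and $q(\rho,c)=-U_c(\tau,c)$. Fluid states are pairs $(\rho,c)$ with $0<\rho<1/\tau_1$, $0<c<1$. For constants $\delta>0$ and $\mu,\lambda\in\mathbb R$, consider in dimension $d\ge 1$ the Navier–Stokes–Allen–Cahn system $$\partial_t\rho+\nabla\cdot(\rho\mathbf u)=0,$$ $$\partial_t(\rho\mathbf u)+\nabla\cdot(\rho\mathbf u\otimes\mathbf u+p\,\mathbf I)=\nabla\cdot\bigl(\mu(\nabla\mathbf u+(\nabla\mathbf u)^T)+(\lambda\nabla\cdot\mathbf u)\mathbf I-\delta\rho\nabla c\otimes\nabla c\bigr),$$ $$\partial_t(\rho c)+\nabla\cdot(\rho c\,\mathbf u)=\delta^{-1/2}\bigl(\rho q+\nabla\cdot(\delta\rho\nabla c)\bigr).$$ Suppose that $W$ is $C^4$ on $(0,1)\times\Theta$,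 $\Theta\subseteq\mathbb R$ open, and that at some $(c_*,\theta_*)\in(0,1)\times\Theta$ the function $W(\cdot,\theta)$ passes generically from convex ($\theta>\theta_*$) to double-well ($\theta<\theta_*$): $$W_{cc}=W_{ccc}=0,\qquad W_{cccc}>0,\qquad W_{cc\theta}>0\qquad\text{at }(c_*,\theta_*);$$ suppose also $W_c(c_*,\theta_*)<-\log\tau_1$ (for instance $W_c(c_*,\theta_*)=0$). Then there are $\tilde\theta<\theta_*$, an open set $N$ of fluid states, and functions $\theta\mapsto(\underline\rho_0,\underline c_0)\in N$, $\theta\mapsto(\overline\rho_0,\overline c_0)\in N$ (Maxwell states), continuous on $(\tilde\theta,\theta_*]$, with the following properties. (i) For every $\theta\in(\tilde\theta,\theta_*]$, $q(\underline\rho_0,\underline c_0)=q(\overline\rho_0,\overline c_0)=0$ and $p(\underline\rho_0,\underline c_0)=p(\overline\rho_0,\overline c_0)=:\pi_*(\theta)$. If $\theta=\theta_*$, the two states coincide and have $c=c_*$, and any two states in $N$ with $q=0$ and equal $p$ coincide. (ii) For every $\theta\in(\tilde\theta,\theta_*)$, $\underline\rho_0<\overline\rho_0$, and there are functions $R,C:\mathbb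 R\to\mathbb R$ with $C'>0$ such that, for every unit vector $e\in\mathbb R^d$, the fields $\rho=R(e\cdot x)$, $\mathbf u=0$, $c=C(e\cdot x)$ are a classical stationary (no-flux, $m=0$) solution of the system with $(R,C)(-\infty)=(\underline\rho_0,\underline c_0)$ and $(R,C)(\infty)=(\overline\rho_0,\overline c_0)$; and the reflected profile $(R(-x),C(-x))$ likewise gives a no-flux phase boundary from $(\overline\rho_0,\overline c_0)$ to $(\underline\rho_0,\underline c_0)$. (iii) Let $\hat G(p,c)=(1-c)(1+\log p)+cp\tau_1$, let $P^\pi(c,y)$ be the unique positive root $p$ of $0=(p-\pi)(c\tau_1p+(1-c))+y^2p$, and $\Gamma^{\theta,\pi}(c,y)=\hat G(P^\pi(c,y),c)+W(c,\theta)+\frac12y^2$. For every $\theta\in(\tilde\theta,\theta_*)$ and with $\pi=\pi_*(\theta)$, the points $(\underline c_0,0)$ and $(\overline c_0,0)$ are distinct nondegenerate saddles of $\Gamma^{\theta,\pi}$ at the same level; the curve $(C,\sqrt\delta\,C')$ and the corresponding curve of the reflected profile run in the level set of these saddles and join them in the two directions, and $p(R,C)=P^\pi(C,\sqrt\delta\,C')$.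 (iv) (Local uniqueness.) For every $\theta\in(\tilde\theta,\theta_*)$, any two distinct states $a,b\in N$ with $q(a)=q(b)=0$ and $p(a)=p(b)$ that are joined by a no-flux phase boundary are, up to order, the two Maxwell states. The same is true of any two states $a=(\rho_a,c_a),b=(\rho_b,c_b)\in N$ with $p(a)=p(b)=:\pi$ for which $(c_a,0)$ and $(c_b,0)$ are distinct saddles of $\Gamma^{\theta,\pi}$ at the same level; so $\pi=\pi_*(\theta)$. -/

import Mathlib

open Set Filter Topology

noncomputable section

namespace NSAC

/-- The mechanical part of the thermodynamic potential, as a function of the specific volume `τ`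
and the mass fraction `c`; `τ₁` is the specific volume of the incompressible phase. -/
def Uhat (τ₁ τ c : ℝ) : ℝ := -(1 - c) * Real.log ((τ - c * τ₁) / (1 - c))

/-- The potential at constant temperature `θ`, without its gradient part. -/
def U (τ₁ : ℝ) (W : ℝ → ℝ → ℝ) (θ τ c : ℝ) : ℝ := Uhat τ₁ τ c + W c θ

/-- The pressure `p(ρ, c) = -U_τ(τ, c)` at `τ = 1 / ρ`; a fluid state is a pair `s = (ρ, c)`. -/
def pressure (τ₁ : ℝ) (W : ℝ → ℝ → ℝ) (θ : ℝ) (s : ℝ × ℝ) : ℝ :=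
  -deriv (fun τ => U τ₁ W θ τ s.2) (1 / s.1)

/-- The transformation rate `q(ρ, c) = -U_c(τ, c)` at `τ = 1 / ρ`. -/
def rate (τ₁ : ℝ) (W : ℝ → ℝ → ℝ) (θ : ℝ) (s : ℝ × ℝ) : ℝ :=
  -deriv (fun c => U τ₁ W θ (1 / s.1) c) s.2

/-- The fluid states `(ρ, c)`, i.e. those with `τ₁ < τ = 1 / ρ < ∞` and `0 < c < 1`. -/
def stateSpace (τ₁ : ℝ) : Set (ℝ × ℝ) :=
  {s | 0 < s.1 ∧ τ₁ < 1 / s.1 ∧ 0 < s.2 ∧ s.2 < 1}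

/-- `W(·, θ)`, `θ ∈ Θ`, undergoes at `(cs, θs)` a generic transition from convex (`θ > θs`) to
convex-concave-convex (`θ < θs`), with decreasing `θ`: the strict inequalities are the
nondegeneracy conditions, under which near `(cs, θs)` the second derivative `W_cc(·, θ)` is a
strictly convex function of `c` which is positive for `θ > θs`, has the single zero `cs` for
`θ = θs`, and is negative exactly between two zeros for `θ < θs`. -/
structure GenericTransition (W : ℝ → ℝ → ℝ) (Θ : Set ℝ) (cs θs : ℝ) : Prop where
  isOpen : IsOpen Θ
  mem_temp : θs ∈ Θ
  mem_frac : cs ∈ Ioo (0 : ℝ) 1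
  smooth : ContDiffOn ℝ 4 (fun z : ℝ × ℝ => W z.1 z.2) (Ioo 0 1 ×ˢ Θ)
  cc_eq : iteratedDeriv 2 (fun c => W c θs) cs = 0
  ccc_eq : iteratedDeriv 3 (fun c => W c θs) cs = 0
  cccc_pos : 0 < iteratedDeriv 4 (fun c => W c θs) cs
  ccθ_pos : 0 < deriv (fun θ => iteratedDeriv 2 (fun c => W c θ) cs) θs

/-! ### The Navier-Stokes-Allen-Cahn system -/

/-- The partial derivative `∂ f / ∂ x_i`. -/
def pd {d : ℕ} (i : Fin d) (f : EuclideanSpace ℝ (Fin d) → ℝ) (x : EuclideanSpace ℝ (Fin d)) :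
    ℝ :=
  fderiv ℝ f x (EuclideanSpace.single i 1)

/-- Classical solutions `(ρ, u, c)`, on all of space-time `ℝ × ℝᵈ`, of the system
`∂ₜρ + ∇·(ρ u) = 0`,
`∂ₜ(ρ u) + ∇·(ρ u ⊗ u + p I) = ∇·(μ (∇u + (∇u)ᵀ) + (lam ∇·u) I - δ ρ ∇c ⊗ ∇c)`,
`∂ₜ(ρ c) + ∇·(ρ c u) = δ^(-1/2) (ρ q + ∇·(δ ρ ∇c))`. -/
structure IsSolution (τ₁ : ℝ) (W : ℝ → ℝ → ℝ) (θ : ℝ) (d : ℕ) (δ μ lam : ℝ)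
    (ρ : ℝ → EuclideanSpace ℝ (Fin d) → ℝ)
    (u : ℝ → EuclideanSpace ℝ (Fin d) → EuclideanSpace ℝ (Fin d))
    (c : ℝ → EuclideanSpace ℝ (Fin d) → ℝ) : Prop where
  smooth_ρ : ContDiff ℝ 1 (fun z : ℝ × EuclideanSpace ℝ (Fin d) => ρ z.1 z.2)
  smooth_u : ContDiff ℝ 2 (fun z : ℝ × EuclideanSpace ℝ (Fin d) => u z.1 z.2)
  smooth_c : ContDiff ℝ 2 (fun z : ℝ × EuclideanSpace ℝ (Fin d) => c z.1 z.2)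
  mem_states : ∀ t x, (ρ t x, c t x) ∈ stateSpace τ₁
  mass : ∀ t x,
    deriv (fun s => ρ s x) t + ∑ i, pd i (fun z => ρ t z * u t z i) x = 0
  momentum : ∀ t x (j : Fin d),
    deriv (fun s => ρ s x * u s x j) t
      + ∑ i, pd i (fun z => ρ t z * u t z i * u t z j
          + if i = j then pressure τ₁ W θ (ρ t z, c t z) else 0) x
    = ∑ i, pd i (fun z =>
          μ * (pd i (fun w => u t w j) z + pd j (fun w => u t w i) z)
          + (if i = j then lam * ∑ k, pd k (fun w => u t w k) z else 0)
          - δ * ρ t z * (pd i (c t) z * pd j (c t) z)) x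
  phase : ∀ t x,
    deriv (fun s => ρ s x * c s x) t + ∑ i, pd i (fun z => ρ t z * c t z * u t z i) x
    = (Real.sqrt δ)⁻¹ * (ρ t x * rate τ₁ W θ (ρ t x, c t x)
        + ∑ i, pd i (fun z => δ * ρ t z * pd i (c t) z) x)

/-- The profile `(R, 0, C)` is a no-flux (the velocity vanishes, so `m = 0`) phase boundary in
the direction `e`, with left end state `a` and right end state `b`: the stationary planar fields
`ρ = R(e·x)`, `u = 0`, `c = C(e·x)` solve the system, `(R, C)(-∞) = a` and `(R, C)(∞) = b`. -/
structure IsNoFluxPhaseBoundary (τ₁ : ℝ) (W : ℝ → ℝ → ℝ) (θ : ℝ) (d : ℕ) (δ μ lam : ℝ)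
    (e : EuclideanSpace ℝ (Fin d)) (R C : ℝ → ℝ) (a b : ℝ × ℝ) : Prop where
  solution : IsSolution τ₁ W θ d δ μ lam
    (fun _ x => R (inner ℝ e x)) (fun _ _ => 0) (fun _ x => C (inner ℝ e x))
  left_end : Tendsto (fun x => (R x, C x)) atBot (𝓝 a)
  right_end : Tendsto (fun x => (R x, C x)) atTop (𝓝 b)

/-- Condition (i) on a pair of states: zero transformation rate, equal pressure. -/
def IsEquilibriumPair (τ₁ : ℝ) (W : ℝ → ℝ → ℝ) (θ : ℝ) (a b : ℝ × ℝ) : Prop :=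
  rate τ₁ W θ a = 0 ∧ rate τ₁ W θ b = 0 ∧ pressure τ₁ W θ a = pressure τ₁ W θ b

/-! ### The function `Γ` -/

/-- The Gibbs potential `Û + p τ` associated with `Û`, as a function of `(p, c)`. -/
def Ghat (τ₁ p c : ℝ) : ℝ := (1 - c) * (1 + Real.log p) + c * p * τ₁

/-- The unique positive root `p` of `0 = (p - ϖ) (c τ₁ p + (1 - c)) + y² p`
(see `proot_spec`). -/
def proot (τ₁ ϖ c y : ℝ) : ℝ :=
  (-((1 - c) - ϖ * c * τ₁ + y ^ 2)
    + Real.sqrt (((1 - c) - ϖ * c * τ₁ + y ^ 2) ^ 2 + 4 * (c * τ₁) * (ϖ * (1 - c))))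
    / (2 * (c * τ₁))

theorem proot_spec {τ₁ ϖ c : ℝ} (hτ : 0 < τ₁) (hϖ : 0 < ϖ) (hc : 0 < c) (hc1 : c < 1) (y : ℝ) :
    0 < proot τ₁ ϖ c y ∧
    ∀ p : ℝ, 0 < p → ((p - ϖ) * (c * τ₁ * p + (1 - c)) + y ^ 2 * p = 0 ↔ p = proot τ₁ ϖ c y) := by
  have hA : 0 < c * τ₁ := mul_pos hc hτ
  have hK : 0 < ϖ * (1 - c) := mul_pos hϖ (by linarith)
  unfold proot
  set B : ℝ := (1 - c) - ϖ * c * τ₁ + y ^ 2 with hB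
  set S : ℝ := Real.sqrt (B ^ 2 + 4 * (c * τ₁) * (ϖ * (1 - c))) with hS
  have hpos : 0 < 4 * (c * τ₁) * (ϖ * (1 - c)) := by positivity
  have hS2 : S ^ 2 = B ^ 2 + 4 * (c * τ₁) * (ϖ * (1 - c)) :=
    Real.sq_sqrt (by positivity)
  have hS0 : 0 ≤ S := Real.sqrt_nonneg _
  have hBS : |B| < S := abs_lt_of_sq_lt_sq (by linarith) hS0
  obtain ⟨h1, h2⟩ := abs_lt.mp hBS
  refine ⟨div_pos (by linarith) (by linarith), fun p hp => ?_⟩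
  rw [eq_div_iff (by positivity)]
  have key : 4 * (c * τ₁) * ((p - ϖ) * (c * τ₁ * p + (1 - c)) + y ^ 2 * p)
      = (p * (2 * (c * τ₁)) + B - S) * (p * (2 * (c * τ₁)) + B + S) := by
    have : (p * (2 * (c * τ₁)) + B - S) * (p * (2 * (c * τ₁)) + B + S)
      = (p * (2 * (c * τ₁)) + B) ^ 2 - S ^ 2 := by ring
    rw [this, hS2, hB]; ring
  have hne : p * (2 * (c * τ₁)) + B + S ≠ 0 := by
    have : 0 < p * (2 * (c * τ₁)) := by positivity
    linarith
  constructor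
  · intro h
    rw [h, mul_zero] at key
    rcases mul_eq_zero.mp key.symm with h' | h'
    · linarith
    · exact absurd h' hne
  · intro h
    have h0 : p * (2 * (c * τ₁)) + B - S = 0 := by linarith
    rw [h0, zero_mul] at key
    exact (mul_eq_zero.mp key).resolve_left (by positivity)

/-- `Γ^{θ,ϖ}(c, y)`, a function on the `(c, y)`-plane. -/
def Gam (τ₁ : ℝ) (W : ℝ → ℝ → ℝ) (θ ϖ : ℝ) (z : ℝ × ℝ) : ℝ :=
  Ghat τ₁ (proot τ₁ ϖ z.1 z.2) z.1 + W z.1 θ + 1 / 2 * z.2 ^ 2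

/-- A nondegenerate saddle of a function on the plane: a critical point at which the second
derivative takes both signs. -/
def IsSaddle (F : ℝ × ℝ → ℝ) (z : ℝ × ℝ) : Prop :=
  DifferentiableAt ℝ F z ∧ fderiv ℝ F z = 0 ∧
    (∃ v, fderiv ℝ (fderiv ℝ F) z v v < 0) ∧ ∃ v, 0 < fderiv ℝ (fderiv ℝ F) z v v

/-- Two distinct saddles of `F` at the same level. -/
def AreEqualLevelSaddles (F : ℝ × ℝ → ℝ) (z w : ℝ × ℝ) : Prop :=
  z ≠ w ∧ IsSaddle F z ∧ IsSaddle F w ∧ F z = F w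

/-- The parametrized curve `γ` runs in a level set of `F`, from `z` to `w`. -/
def JoinsInLevelSet (F : ℝ × ℝ → ℝ) (γ : ℝ → ℝ × ℝ) (z w : ℝ × ℝ) : Prop :=
  (∀ x, F (γ x) = F z) ∧ Tendsto γ atBot (𝓝 z) ∧ Tendsto γ atTop (𝓝 w)

end NSAC

end

noncomputable section

namespace NSAC

/-! ### Common tangents of convex-concave-convex functions of one variable -/

/-! Use the pressure instead of the specific volume as thermodynamic variable. The Gibbs potential
`Ghat` is affine in `c` at fixed pressure, with slope `-ell τ₁ p` (`Ghat_affine`), and the rate is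
`q = ell τ₁ p - W_c` (`rate_eq`). Two equilibria of equal pressure therefore have the same slope
`W_c`, and they lie at the same level of `Γ` exactly when the line joining their points on the graph
of `W(·, θ)` is a common tangent. The slope of that tangent determines the pressure, because `ell`
is strictly increasing up to `1 / τ₁`, where its value is `-log τ₁`; this is where the bound on
`W_c` at the critical point enters.

Common tangents are a one-variable matter. Near the critical point `W_cc(·, θ)` is strictly convex
in `c`, and for `θ < θs` it is negative at `cs` and positive further out, so `W(·, θ)` is
convex-concave-convex. Such a function has exactly one pair of distinct contact points
(`exists_common_tangent`, `common_tangent_unique`); uniqueness and compactness give continuity in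
`θ` (`exists_maxwellFamily`).

For a stationary planar field the momentum equation integrates to `p + δ ρ C'² = ϖ`, and then the
derivative of `Γ` along the profile is `-C' / ρ` times the left side of the phase equation
(`hasDerivAt_energy`). This is used in both directions. Solving the level equation of `Γ` gives a
scalar equation `C' = f(C)` whose right side vanishes at most linearly at the two contact points,
hence a complete heteroclinic orbit (`exists_profile`, `exists_heteroclinic_orbit`), and `C' > 0`
returns the phase equation. Conversely, any no-flux phase boundary conserves `Γ`, so its end states
are at equal level (`level_eq_of_phaseBoundary`), and the uniqueness of the common tangent
identifies them (`eq_states`). -/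

theorem exists_slope {w f : ℝ → ℝ} {x y : ℝ} (hxy : x < y)
    (hw : ∀ c ∈ Icc x y, HasDerivAt w (f c) c) :
    ∃ t ∈ Ioo x y, w y - w x = f t * (y - x) := by
  obtain ⟨t, ht, h⟩ := exists_hasDerivAt_eq_slope w f hxy
    (fun c hc => (hw c hc).continuousAt.continuousWithinAt)
    (fun c hc => hw c (Ioo_subset_Icc_self hc))
  refine ⟨t, ht, ?_⟩
  rw [h, div_mul_cancel₀]
  linarith

theorem lt_sub_of_lt_deriv {w f : ℝ → ℝ} {x y m : ℝ} (hxy : x < y)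
    (hw : ∀ c ∈ Icc x y, HasDerivAt w (f c) c) (h : ∀ t ∈ Ioo x y, m < f t) :
    m * (y - x) < w y - w x := by
  obtain ⟨t, ht, e⟩ := exists_slope hxy hw
  rw [e]
  exact mul_lt_mul_of_pos_right (h t ht) (by linarith)

theorem sub_lt_of_deriv_lt {w f : ℝ → ℝ} {x y m : ℝ} (hxy : x < y)
    (hw : ∀ c ∈ Icc x y, HasDerivAt w (f c) c) (h : ∀ t ∈ Ioo x y, f t < m) :
    w y - w x < m * (y - x) := by
  obtain ⟨t, ht, e⟩ := exists_slope hxy hw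
  rw [e]
  exact mul_lt_mul_of_pos_right (h t ht) (by linarith)

theorem tangent_le_of_monotoneOn {w f : ℝ → ℝ} {p q x y : ℝ}
    (hw : ∀ c ∈ Icc p q, HasDerivAt w (f c) c) (hf : MonotoneOn f (Icc p q))
    (hx : x ∈ Icc p q) (hy : y ∈ Icc p q) : f x * (y - x) ≤ w y - w x := by
  rcases lt_trichotomy x y with h | h | h
  · obtain ⟨t, ht, e⟩ := exists_slope h (fun c hc => hw c ⟨hx.1.trans hc.1, hc.2.trans hy.2⟩)
    rw [e]
    exact mul_le_mul_of_nonneg_right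
      (hf hx ⟨hx.1.trans ht.1.le, ht.2.le.trans hy.2⟩ ht.1.le) (by linarith)
  · simp [h]
  · obtain ⟨t, ht, e⟩ := exists_slope h (fun c hc => hw c ⟨hy.1.trans hc.1, hc.2.trans hx.2⟩)
    have := mul_le_mul_of_nonneg_right
      (hf ⟨hy.1.trans ht.1.le, ht.2.le.trans hx.2⟩ hx ht.2.le) (by linarith : 0 ≤ x - y)
    nlinarith

/-- A strictly monotone map is an order isomorphism onto its image, and the image is an interval, so
the inverse is continuous for the order topology. No derivative has to be nonzero: the lemma is
applied up to inflection points of `w` and up to the critical point of `ell`. -/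
theorem exists_continuousOn_inverse {f : ℝ → ℝ} {x y : ℝ} (hxy : x ≤ y)
    (hf : ContinuousOn f (Icc x y)) (hm : StrictMonoOn f (Icc x y)) :
    ∃ g : ℝ → ℝ, ContinuousOn g (Icc (f x) (f y)) ∧
      ∀ m ∈ Icc (f x) (f y), g m ∈ Icc x y ∧ f (g m) = m := by
  have himg : f '' Icc x y = Icc (f x) (f y) := by
    apply Subset.antisymm
    · rintro _ ⟨t, ht, rfl⟩
      exact ⟨hm.monotoneOn (left_mem_Icc.2 hxy) ht ht.1,
        hm.monotoneOn ht (right_mem_Icc.2 hxy) ht.2⟩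
    · exact intermediate_value_Icc hxy hf
  let e := hm.orderIso f (Icc x y)
  have : OrdConnected (f '' Icc x y) := by rw [himg]; exact ordConnected_Icc
  have hc : Continuous fun m : f '' Icc x y => (e.symm m : ℝ) :=
    continuous_subtype_val.comp e.symm.continuous
  have hfe : ∀ m : f '' Icc x y, f (e.symm m) = m := fun m => by
    exact congrArg Subtype.val (e.apply_symm_apply m)
  rw [← himg]
  classical
  refine ⟨fun m => if h : m ∈ f '' Icc x y then e.symm ⟨m, h⟩ else 0, ?_, fun m h => ?_⟩
  · rw [continuousOn_iff_continuous_domRestrict]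
    refine hc.congr fun m => ?_
    rw [domRestrict_apply, dif_pos m.2]
  · beta_reduce
    rw [dif_pos h]
    exact ⟨(e.symm ⟨m, h⟩).2, hfe ⟨m, h⟩⟩

/-- The function `w` on `[l, r]`, with derivative `f` and second derivative `g`, is strictly convex
on `[l, α]` and on `[β, r]` and strictly concave in between, and its slope at `l` and `r` lies
below and above its slopes on `[α, β]`. -/
structure ConvexConcaveConvex (w f g : ℝ → ℝ) (l α β r : ℝ) : Prop where
  hlα : l < α
  hαβ : α < β
  hβr : β < r
  deriv_w : ∀ c ∈ Icc l r, HasDerivAt w (f c) c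
  deriv_f : ∀ c ∈ Icc l r, HasDerivAt f (g c) c
  pos_left : ∀ c ∈ Ico l α, 0 < g c
  neg_mid : ∀ c ∈ Ioo α β, g c < 0
  pos_right : ∀ c ∈ Ioc β r, 0 < g c
  slope_left : f l < f β
  slope_right : f α < f r

namespace ConvexConcaveConvex

variable {w f g : ℝ → ℝ} {l α β r : ℝ}

theorem strictMonoOn_left (h : ConvexConcaveConvex w f g l α β r) : StrictMonoOn f (Icc l α) := by
  have h1 := h.hαβ
  have h2 := h.hβr
  have hd : ∀ c ∈ Icc l α, HasDerivAt f (g c) c := fun c hc =>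
    h.deriv_f c ⟨hc.1, by linarith [hc.2]⟩
  refine strictMonoOn_of_deriv_pos (convex_Icc _ _)
    (fun c hc => (hd c hc).continuousAt.continuousWithinAt) fun c hc => ?_
  rw [interior_Icc] at hc
  rw [(hd c (Ioo_subset_Icc_self hc)).deriv]
  exact h.pos_left c (Ioo_subset_Ico_self hc)

theorem strictMonoOn_right (h : ConvexConcaveConvex w f g l α β r) :
    StrictMonoOn f (Icc β r) := by
  have h1 := h.hαβ
  have h2 := h.hlα
  have hd : ∀ c ∈ Icc β r, HasDerivAt f (g c) c := fun c hc =>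
    h.deriv_f c ⟨by linarith [hc.1], hc.2⟩
  refine strictMonoOn_of_deriv_pos (convex_Icc _ _)
    (fun c hc => (hd c hc).continuousAt.continuousWithinAt) fun c hc => ?_
  rw [interior_Icc] at hc
  rw [(hd c (Ioo_subset_Icc_self hc)).deriv]
  exact h.pos_right c (Ioo_subset_Ioc_self hc)

theorem strictAntiOn_mid (h : ConvexConcaveConvex w f g l α β r) : StrictAntiOn f (Icc α β) := by
  have h1 := h.hβr
  have h2 := h.hlα
  have hd : ∀ c ∈ Icc α β, HasDerivAt f (g c) c := fun c hc =>
    h.deriv_f c ⟨by linarith [hc.1], by linarith [hc.2]⟩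
  refine strictAntiOn_of_deriv_neg (convex_Icc _ _)
    (fun c hc => (hd c hc).continuousAt.continuousWithinAt) fun c hc => ?_
  rw [interior_Icc] at hc
  rw [(hd c (Ioo_subset_Icc_self hc)).deriv]
  exact h.neg_mid c hc

/-- If `x` were not in the left convex part, `f` would first fall below `f x` and climb back at most
to `f y = f x`, so the mean slope over `[x, y]` would be strictly less than `f x`. The right end is
the mirror image. -/
theorem left_lt_right_gt (h : ConvexConcaveConvex w f g l α β r) {x y : ℝ} (hx : l ≤ x)
    (hxy : x < y) (hy : y ≤ r) (hf : f x = f y) (hw : w y - w x = f x * (y - x)) :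
    x < α ∧ β < y := by
  have hI := h.strictMonoOn_left
  have hJ := h.strictMonoOn_right
  have hK := h.strictAntiOn_mid
  have h0 := h.hlα
  have h1 := h.hαβ
  have h2 := h.hβr
  have hd : ∀ c ∈ Icc x y, HasDerivAt w (f c) c := fun c hc =>
    h.deriv_w c ⟨hx.trans hc.1, hc.2.trans hy⟩
  have hx1 : x < α := by
    by_contra! hα
    have hxβ : x < β := by
      by_contra! hβ
      exact (hJ ⟨hβ, by linarith⟩ ⟨by linarith, hy⟩ hxy).ne hf
    have hyβ : β < y := by
      by_contra! hβ
      exact (hK ⟨hα, by linarith⟩ ⟨by linarith, hβ⟩ hxy).ne hf.symm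
    have := sub_lt_of_deriv_lt (m := f x) hxy hd fun t ht => by
      rcases le_total t β with h' | h'
      · exact hK ⟨hα, hxβ.le⟩ ⟨by linarith [ht.1], h'⟩ ht.1
      · rw [hf]; exact hJ ⟨h', by linarith [ht.2]⟩ ⟨hyβ.le, hy⟩ ht.2
    linarith
  refine ⟨hx1, ?_⟩
  by_contra! hβ
  have hyα : α < y := by
    by_contra! hα
    exact (hI ⟨hx, hx1.le⟩ ⟨by linarith, hα⟩ hxy).ne hf
  have := lt_sub_of_lt_deriv (m := f x) hxy hd fun t ht => by
    rcases le_total t α with h' | h'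
    · exact hI ⟨hx, hx1.le⟩ ⟨by linarith [ht.1], h'⟩ ht.1
    · rw [hf]; exact hK ⟨h', by linarith [ht.2]⟩ ⟨hyα.le, hβ⟩ ht.2
  linarith

/-- Compare two lines. The tangent at `x` lies below `w` at `x'` and meets the graph at `y`; the
common tangent of `x'`, `y'` meets the graph at `x'` and lies below it at `y`. Between `x' < y` the
former gains on the latter, so it is at least as steep. -/
theorem slope_le (h : ConvexConcaveConvex w f g l α β r) {x y x' y' : ℝ}
    (hx : x ∈ Icc l α) (hy : y ∈ Icc β r) (hw : w y - w x = f x * (y - x))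
    (hx' : x' ∈ Icc l α) (hy' : y' ∈ Icc β r) (hf' : f x' = f y')
    (hw' : w y' - w x' = f x' * (y' - x')) : f x' ≤ f x := by
  have h0 := h.hlα
  have h1 := h.hαβ
  have h2 := h.hβr
  have e1 := tangent_le_of_monotoneOn (fun c hc => h.deriv_w c ⟨hc.1, by linarith [hc.2]⟩)
    h.strictMonoOn_left.monotoneOn hx hx'
  have e2 := tangent_le_of_monotoneOn (fun c hc => h.deriv_w c ⟨by linarith [hc.1], hc.2⟩)
    h.strictMonoOn_right.monotoneOn hy' hy
  rw [← hf'] at e2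
  by_contra! hlt
  have : x' < y := by linarith [hx'.2, hy.1]
  nlinarith [mul_pos (sub_pos.2 hlt) (sub_pos.2 this)]

/-- `slope_le` in both directions equates the slopes, and `f` is injective on each outer branch. -/
theorem common_tangent_unique (h : ConvexConcaveConvex w f g l α β r) {x y x' y' : ℝ}
    (hx : l ≤ x) (hxy : x < y) (hy : y ≤ r) (hf : f x = f y) (hw : w y - w x = f x * (y - x))
    (hx' : l ≤ x') (hxy' : x' < y') (hy' : y' ≤ r) (hf' : f x' = f y')
    (hw' : w y' - w x' = f x' * (y' - x')) : x' = x ∧ y' = y := by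
  obtain ⟨a1, a2⟩ := h.left_lt_right_gt hx hxy hy hf hw
  obtain ⟨b1, b2⟩ := h.left_lt_right_gt hx' hxy' hy' hf' hw'
  have e : f x' = f x := le_antisymm
    (h.slope_le ⟨hx, a1.le⟩ ⟨a2.le, hy⟩ hw ⟨hx', b1.le⟩ ⟨b2.le, hy'⟩ hf' hw')
    (h.slope_le ⟨hx', b1.le⟩ ⟨b2.le, hy'⟩ hw' ⟨hx, a1.le⟩ ⟨a2.le, hy⟩ hf hw)
  exact ⟨h.strictMonoOn_left.injOn ⟨hx', b1.le⟩ ⟨hx, a1.le⟩ e,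
    h.strictMonoOn_right.injOn ⟨b2.le, hy'⟩ ⟨a2.le, hy⟩ (by rw [← hf', e, hf])⟩

/-- Between the contact points `f - f x` is first positive, then negative. Where `f c ≥ f x`,
integrate from `x`; otherwise integrate back from `y`. -/
theorem above_tangent (h : ConvexConcaveConvex w f g l α β r) {x y c : ℝ} (hx : l ≤ x)
    (hxy : x < y) (hy : y ≤ r) (hf : f x = f y) (hw : w y - w x = f x * (y - x))
    (hc : c ∈ Ioo x y) : 0 < w c - w x - f x * (c - x) := by
  obtain ⟨a1, a2⟩ := h.left_lt_right_gt hx hxy hy hf hw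
  obtain ⟨hc1, hc2⟩ := hc
  have hI := h.strictMonoOn_left
  have hJ := h.strictMonoOn_right
  have hK := h.strictAntiOn_mid
  have h1 := h.hαβ
  rcases le_or_gt (f x) (f c) with hm | hm
  · have hcβ : c ≤ β := by
      by_contra! hβ
      have := hJ ⟨hβ.le, by linarith⟩ ⟨a2.le, hy⟩ hc2
      linarith
    have := lt_sub_of_lt_deriv (m := f x) hc1
      (fun t ht => h.deriv_w t ⟨by linarith [ht.1], by linarith [ht.2]⟩) fun t ht => by
        rcases le_total t α with h' | h'
        · exact hI ⟨hx, a1.le⟩ ⟨by linarith [ht.1], h'⟩ ht.1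
        · exact hm.trans_lt (hK ⟨h', by linarith [ht.2]⟩ ⟨by linarith [ht.2], hcβ⟩ ht.2)
    linarith
  · have hcα : α < c := by
      by_contra! hα
      have := hI ⟨hx, a1.le⟩ ⟨by linarith, hα⟩ hc1
      linarith
    have := sub_lt_of_deriv_lt (m := f x) hc2
      (fun t ht => h.deriv_w t ⟨by linarith [ht.1], by linarith [ht.2]⟩) fun t ht => by
        rcases le_total t β with h' | h'
        · exact (hK ⟨hcα.le, by linarith [ht.1]⟩ ⟨by linarith [ht.1], h'⟩ ht.1).trans hm
        · rw [hf]; exact hJ ⟨h', by linarith [ht.2]⟩ ⟨a2.le, hy⟩ ht.2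
    linarith

/-- For a slope `m` between `f β` and `f α` let `a m`, `b m` be the points of slope `m` on the two
convex branches. The difference `w (b m) - w (a m) - m (b m - a m)` is nonnegative at `m = f β`,
where `f ≥ m` between the points, and nonpositive at `m = f α`, where `f ≤ m`. A zero is a common
tangent. -/
theorem exists_common_tangent (h : ConvexConcaveConvex w f g l α β r) :
    ∃ x y, l < x ∧ x < α ∧ β < y ∧ y < r ∧ f x = f y ∧ w y - w x = f x * (y - x) := by
  have hI := h.strictMonoOn_left
  have hJ := h.strictMonoOn_right
  have hK := h.strictAntiOn_mid
  have h0 := h.hlα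
  have h1 := h.hαβ
  have h2 := h.hβr
  have hfc : ContinuousOn f (Icc l r) := fun c hc =>
    (h.deriv_f c hc).continuousAt.continuousWithinAt
  have hwc : ContinuousOn w (Icc l r) := fun c hc =>
    (h.deriv_w c hc).continuousAt.continuousWithinAt
  obtain ⟨a, hac, ha⟩ := exists_continuousOn_inverse h0.le
    (hfc.mono (Icc_subset_Icc_right (by linarith))) hI
  obtain ⟨b, hbc, hb⟩ := exists_continuousOn_inverse h2.le
    (hfc.mono (Icc_subset_Icc_left (by linarith))) hJ
  have hαβ : f β < f α := hK (left_mem_Icc.2 h1.le) (right_mem_Icc.2 h1.le) h1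
  have hsa : Icc (f β) (f α) ⊆ Icc (f l) (f α) := Icc_subset_Icc_left h.slope_left.le
  have hsb : Icc (f β) (f α) ⊆ Icc (f β) (f r) := Icc_subset_Icc_right h.slope_right.le
  have hH : ContinuousOn (fun m => w (b m) - w (a m) - m * (b m - a m)) (Icc (f β) (f α)) := by
    have h3 := hac.mono hsa
    have h4 := hbc.mono hsb
    have h5 : ContinuousOn (fun m => w (a m)) (Icc (f β) (f α)) := hwc.comp h3 fun m hm =>
      ⟨(ha m (hsa hm)).1.1, by linarith [(ha m (hsa hm)).1.2]⟩
    have h6 : ContinuousOn (fun m => w (b m)) (Icc (f β) (f α)) := hwc.comp h4 fun m hm =>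
      ⟨by linarith [(hb m (hsb hm)).1.1], (hb m (hsb hm)).1.2⟩
    exact (h6.sub h5).sub (continuousOn_id.mul (h4.sub h3))
  have hβ := ha _ (hsa (left_mem_Icc.2 hαβ.le))
  have hbβ : b (f β) = β := hJ.injOn (hb _ (hsb (left_mem_Icc.2 hαβ.le))).1
    (left_mem_Icc.2 h2.le) (hb _ (hsb (left_mem_Icc.2 hαβ.le))).2
  have hα := hb _ (hsb (right_mem_Icc.2 hαβ.le))
  have haα : a (f α) = α := hI.injOn (ha _ (hsa (right_mem_Icc.2 hαβ.le))).1
    (right_mem_Icc.2 h0.le) (ha _ (hsa (right_mem_Icc.2 hαβ.le))).2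
  have hpos : 0 ≤ w (b (f β)) - w (a (f β)) - f β * (b (f β) - a (f β)) := by
    rw [hbβ]
    have hlt : a (f β) < β := by linarith [hβ.1.2]
    obtain ⟨t, ht, e⟩ := exists_slope hlt
      (fun c hc => h.deriv_w c ⟨hβ.1.1.trans hc.1, by linarith [hc.2]⟩)
    have hft : f β ≤ f t := by
      rcases le_total t α with h' | h'
      · have := hI.monotoneOn hβ.1 ⟨hβ.1.1.trans ht.1.le, h'⟩ ht.1.le
        linarith [hβ.2]
      · exact hK.antitoneOn ⟨h', ht.2.le⟩ (right_mem_Icc.2 h1.le) ht.2.le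
    rw [e]
    nlinarith
  have hneg : w (b (f α)) - w (a (f α)) - f α * (b (f α) - a (f α)) ≤ 0 := by
    rw [haα]
    have hlt : α < b (f α) := by linarith [hα.1.1]
    obtain ⟨t, ht, e⟩ := exists_slope hlt
      (fun c hc => h.deriv_w c ⟨by linarith [hc.1], hc.2.trans hα.1.2⟩)
    have hft : f t ≤ f α := by
      rcases le_total t β with h' | h'
      · exact hK.antitoneOn (left_mem_Icc.2 h1.le) ⟨ht.1.le, h'⟩ ht.1.le
      · have := hJ.monotoneOn ⟨h', ht.2.le.trans hα.1.2⟩ hα.1 ht.2.le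
        linarith [hα.2]
    rw [e]
    nlinarith
  obtain ⟨m, hm, e⟩ := intermediate_value_Icc' hαβ.le hH ⟨hneg, hpos⟩
  obtain ⟨ham, hfa⟩ := ha m (hsa hm)
  obtain ⟨hbm, hfb⟩ := hb m (hsb hm)
  have hfab : f (a m) = f (b m) := hfa.trans hfb.symm
  have hwab : w (b m) - w (a m) = f (a m) * (b m - a m) := by
    rw [hfa]; simp only at e; linarith
  obtain ⟨c1, c2⟩ := h.left_lt_right_gt ham.1 (by linarith [ham.2, hbm.1]) hbm.2 hfab hwab
  -- The strict inequalities `slope_left` and `slope_right` keep the contact points off `l` and `r`.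
  refine ⟨a m, b m, lt_of_le_of_ne ham.1 fun hl => ?_, c1, c2, lt_of_le_of_ne hbm.2 fun hr => ?_,
    hfab, hwab⟩
  · have := h.slope_left
    rw [← hl] at hfa
    linarith [hm.1]
  · have := h.slope_right
    rw [hr] at hfb
    linarith [hm.2]

end ConvexConcaveConvex

/-- A strictly convex second derivative, negative at an interior point and positive on both sides
of it, gives a convex-concave-convex function. -/
theorem convexConcaveConvex_of_strictConvexOn {w f g : ℝ → ℝ} {l l' c₀ r' r : ℝ}
    (hl : l < l') (hl' : l' < c₀) (hr' : c₀ < r') (hr : r' < r)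
    (hw : ∀ c ∈ Icc l r, HasDerivAt w (f c) c) (hf : ∀ c ∈ Icc l r, HasDerivAt f (g c) c)
    (hg : ContinuousOn g (Icc l r)) (hconv : StrictConvexOn ℝ (Icc l r) g)
    (hgl : 0 < g l') (hgc : g c₀ < 0) (hgr : 0 < g r')
    (hfl : ∀ c ∈ Icc l' r', f l < f c) (hfr : ∀ c ∈ Icc l' r', f c < f r) :
    ∃ α β, α < c₀ ∧ c₀ < β ∧ ConvexConcaveConvex w f g l α β r := by
  obtain ⟨α, hα, hgα⟩ := intermediate_value_Icc' hl'.le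
    (hg.mono (Icc_subset_Icc hl.le (by linarith))) ⟨hgc.le, hgl.le⟩
  obtain ⟨β, hβ, hgβ⟩ := intermediate_value_Icc hr'.le
    (hg.mono (Icc_subset_Icc (by linarith) hr.le)) ⟨hgc.le, hgr.le⟩
  have hα1 : α < c₀ := lt_of_le_of_ne hα.2 (by rintro rfl; linarith)
  have hβ1 : c₀ < β := lt_of_le_of_ne hβ.1 (by rintro rfl; linarith)
  have hαl := hα.1
  have hβr := hβ.2
  -- Strict convexity with denominators cleared. With the zeros `α`, `β` of `g` among the three
  -- points it yields the sign of `g` at the third.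
  have key : ∀ x ∈ Icc l r, ∀ y ∈ Icc l r, ∀ z, x < z → z < y →
      (y - x) * g z < (y - z) * g x + (z - x) * g y := by
    intro x hx y hy z hxz hzy
    have h := hconv.2 hx hy (by linarith : x ≠ y)
      (div_pos (sub_pos.2 hzy) (sub_pos.2 (hxz.trans hzy)))
      (div_pos (sub_pos.2 hxz) (sub_pos.2 (hxz.trans hzy)))
      (by rw [← add_div]; rw [div_eq_one_iff_eq] <;> linarith)
    have hne : y - x ≠ 0 := by linarith
    have e : ((y - z) / (y - x)) • x + ((z - x) / (y - x)) • y = z := by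
      simp only [smul_eq_mul]; field_simp; ring
    rw [e] at h
    have := mul_lt_mul_of_pos_left h (by linarith : 0 < y - x)
    have e2 : (y - x) * (((y - z) / (y - x)) • g x + ((z - x) / (y - x)) • g y)
        = (y - z) * g x + (z - x) * g y := by
      simp only [smul_eq_mul]; field_simp
    linarith
  refine ⟨α, β, hα1, hβ1, ⟨by linarith, by linarith, by linarith, hw, hf, fun c hc => ?_,
    fun c hc => ?_, fun c hc => ?_, hfl β ⟨by linarith, hβ.2⟩, hfr α ⟨hα.1, by linarith⟩⟩⟩
  · have := key c ⟨hc.1, by linarith [hc.2]⟩ β ⟨by linarith, by linarith⟩ α hc.2 (by linarith)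
    rw [hgα, hgβ] at this
    have : 0 < (β - α) * g c := by linarith
    exact (mul_pos_iff_of_pos_left (by linarith)).1 this
  · have := key α ⟨by linarith, by linarith⟩ β ⟨by linarith, by linarith⟩ c hc.1 hc.2
    rw [hgα, hgβ] at this
    by_contra! hcon
    have : 0 ≤ (β - α) * g c := mul_nonneg (by linarith) hcon
    linarith
  · have := key α ⟨by linarith, by linarith⟩ c ⟨by linarith [hc.1], hc.2⟩ β (by linarith) hc.1
    rw [hgα, hgβ] at this
    have : 0 < (β - α) * g c := by linarith
    exact (mul_pos_iff_of_pos_left (by linarith)).1 this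

/-! ### The Maxwell family of a generic transition -/

/-- The partial derivative `∂ᵏW / ∂cᵏ`, as a function of `(c, θ)`. -/
def dcW (W : ℝ → ℝ → ℝ) (k : ℕ) (z : ℝ × ℝ) : ℝ := iteratedDeriv k (fun c => W c z.2) z.1

/-- The functions `a ≤ b` of `θ ∈ (θt, θs]` form a family of points of contact of common tangents
of `W(·, θ)`, unique in `(cs - ε, cs + ε)` and collapsing to `cs` at `θs`. -/
structure IsMaxwellFamily (W : ℝ → ℝ → ℝ) (Θ : Set ℝ) (cs θs θt ε κ : ℝ) (a b : ℝ → ℝ) :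
    Prop where
  lt_crit : θt < θs
  temp_subset : Ioc θt θs ⊆ Θ
  frac_subset : Icc (cs - ε) (cs + ε) ⊆ Ioo 0 1
  slope_near : ∀ c ∈ Icc (cs - ε) (cs + ε), ∀ θ ∈ Ioc θt θs,
    |dcW W 1 (c, θ) - dcW W 1 (cs, θs)| < κ
  continuousOn_left : ContinuousOn a (Ioc θt θs)
  continuousOn_right : ContinuousOn b (Ioc θt θs)
  mem_left : ∀ θ ∈ Ioc θt θs, a θ ∈ Ioo (cs - ε) (cs + ε)
  mem_right : ∀ θ ∈ Ioc θt θs, b θ ∈ Ioo (cs - ε) (cs + ε)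
  slope_eq : ∀ θ ∈ Ioc θt θs, dcW W 1 (a θ, θ) = dcW W 1 (b θ, θ)
  left_crit : a θs = cs
  right_crit : b θs = cs
  injOn_crit : InjOn (fun c => dcW W 1 (c, θs)) (Ioo (cs - ε) (cs + ε))
  lt : ∀ θ ∈ Ioo θt θs, a θ < b θ
  tangent : ∀ θ ∈ Ioo θt θs, W (b θ) θ - W (a θ) θ = dcW W 1 (a θ, θ) * (b θ - a θ)
  convex_left : ∀ θ ∈ Ioo θt θs, 0 < dcW W 2 (a θ, θ)
  convex_right : ∀ θ ∈ Ioo θt θs, 0 < dcW W 2 (b θ, θ)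
  above : ∀ θ ∈ Ioo θt θs, ∀ c ∈ Ioo (a θ) (b θ),
    0 < W c θ - W (a θ) θ - dcW W 1 (a θ, θ) * (c - a θ)
  unique : ∀ θ ∈ Ioo θt θs, ∀ x ∈ Ioo (cs - ε) (cs + ε), ∀ y ∈ Ioo (cs - ε) (cs + ε), x < y →
    dcW W 1 (x, θ) = dcW W 1 (y, θ) → W y θ - W x θ = dcW W 1 (x, θ) * (y - x) →
    x = a θ ∧ y = b θ

/-- The partial derivative is the full derivative applied to `(1, 0)`, so joint regularity in `(c,
θ)` survives differentiation in `c` alone at the cost of one order. -/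
theorem contDiffOn_partial {F : ℝ × ℝ → ℝ} {S : Set (ℝ × ℝ)} (hS : IsOpen S) {m n : WithTop ℕ∞}
    (hF : ContDiffOn ℝ n F S) (hmn : m + 1 ≤ n) :
    ContDiffOn ℝ m (fun z : ℝ × ℝ => deriv (fun c => F (c, z.2)) z.1) S := by
  have h : ContDiffOn ℝ m (fun z => fderiv ℝ F z (1, 0)) S :=
    (hF.fderiv_of_isOpen hS hmn).clm_apply contDiffOn_const
  refine h.congr fun z hz => ?_
  have hd : HasFDerivAt F (fderiv ℝ F z) z :=
    (((hF z hz).contDiffAt (hS.mem_nhds hz)).differentiableAt (by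
      rintro rfl; simp at hmn)).hasFDerivAt
  have hl : HasDerivAt (fun c : ℝ => ((c, z.2) : ℝ × ℝ)) (1, 0) z.1 :=
    (hasDerivAt_id z.1).prodMk (hasDerivAt_const _ _)
  exact (HasFDerivAt.comp_hasDerivAt z.1 (f := fun c : ℝ => ((c, z.2) : ℝ × ℝ)) hd hl).deriv

namespace GenericTransition

variable {W : ℝ → ℝ → ℝ} {Θ : Set ℝ} {cs θs : ℝ}

theorem isOpen_domain (h : GenericTransition W Θ cs θs) : IsOpen (Ioo (0 : ℝ) 1 ×ˢ Θ) :=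
  isOpen_Ioo.prod h.isOpen

theorem contDiffOn_dcW (h : GenericTransition W Θ cs θs) :
    ∀ k m : ℕ, k + m = 4 → ContDiffOn ℝ m (dcW W k) (Ioo (0 : ℝ) 1 ×ˢ Θ)
  | 0, m, hm => by
    have : m = 4 := by omega
    subst this
    have e : dcW W 0 = fun z : ℝ × ℝ => W z.1 z.2 := by
      ext z; simp [dcW]
    rw [e]
    exact_mod_cast h.smooth
  | k + 1, m, hm => by
    have := contDiffOn_partial (m := m) h.isOpen_domain
      (h.contDiffOn_dcW k (m + 1) (by omega)) (by simp)
    refine this.congr fun z _ => ?_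
    simp only [dcW, iteratedDeriv_succ]

theorem contDiffAt_dcW (h : GenericTransition W Θ cs θs) {k m : ℕ} (hk : k + m = 4) {c θ : ℝ}
    (hc : c ∈ Ioo (0 : ℝ) 1) (hθ : θ ∈ Θ) : ContDiffAt ℝ m (dcW W k) (c, θ) :=
  (h.contDiffOn_dcW k m hk).contDiffAt (h.isOpen_domain.mem_nhds ⟨hc, hθ⟩)

theorem continuousAt_dcW (h : GenericTransition W Θ cs θs) {k : ℕ} (hk : k ≤ 4) {c θ : ℝ}
    (hc : c ∈ Ioo (0 : ℝ) 1) (hθ : θ ∈ Θ) : ContinuousAt (dcW W k) (c, θ) :=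
  (h.contDiffAt_dcW (Nat.add_sub_cancel' hk) hc hθ).continuousAt

theorem hasDerivAt_dcW (h : GenericTransition W Θ cs θs) {k : ℕ} (hk : k < 4) {c θ : ℝ}
    (hc : c ∈ Ioo (0 : ℝ) 1) (hθ : θ ∈ Θ) :
    HasDerivAt (fun x => dcW W k (x, θ)) (dcW W (k + 1) (c, θ)) c := by
  have h1 : DifferentiableAt ℝ (dcW W k) (c, θ) :=
    (h.contDiffAt_dcW (m := 4 - k) (by omega) hc hθ).differentiableAt (by
      exact_mod_cast (by omega : 4 - k ≠ 0))
  have h2 : DifferentiableAt ℝ (fun x => dcW W k (x, θ)) c :=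
    DifferentiableAt.fun_comp' (f := fun x : ℝ => ((x, θ) : ℝ × ℝ)) c h1 (by fun_prop)
  have e : dcW W (k + 1) (c, θ) = deriv (fun x => dcW W k (x, θ)) c := by
    simp only [dcW, iteratedDeriv_succ]
  rw [e]
  exact h2.hasDerivAt

theorem hasDerivAt_W (h : GenericTransition W Θ cs θs) {c θ : ℝ}
    (hc : c ∈ Ioo (0 : ℝ) 1) (hθ : θ ∈ Θ) :
    HasDerivAt (fun x => W x θ) (dcW W 1 (c, θ)) c := by
  have := h.hasDerivAt_dcW (k := 0) (by norm_num) hc hθ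
  simpa [dcW] using this

/-- Integrate upwards from `W_cccc > 0`: `W_ccc` increases through `0` at `cs`, so `W_cc` has a
strict minimum `0` there. Thus `W_c` is strictly increasing on each side of `cs`, and the two halves
are glued because its derivative vanishes at `cs`. -/
theorem crit_signs (h : GenericTransition W Θ cs θs) {l r : ℝ} (hl : l < cs) (hr : cs < r)
    (hsub : Icc l r ⊆ Ioo 0 1) (h4 : ∀ c ∈ Icc l r, 0 < dcW W 4 (c, θs)) :
    (∀ c ∈ Icc l r, c ≠ cs → 0 < dcW W 2 (c, θs)) ∧
      StrictMonoOn (fun c => dcW W 1 (c, θs)) (Icc l r) := by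
  have hd : ∀ k < 4, ∀ c ∈ Icc l r,
      HasDerivAt (fun x => dcW W k (x, θs)) (dcW W (k + 1) (c, θs)) c :=
    fun k hk c hc => h.hasDerivAt_dcW hk (hsub hc) h.mem_temp
  have hcont : ∀ k < 4, ContinuousOn (fun x => dcW W k (x, θs)) (Icc l r) :=
    fun k hk c hc => (hd k hk c hc).continuousAt.continuousWithinAt
  have hcs : cs ∈ Icc l r := ⟨hl.le, hr.le⟩
  have e2 : dcW W 2 (cs, θs) = 0 := h.cc_eq
  have e3 : dcW W 3 (cs, θs) = 0 := h.ccc_eq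
  have hL : Icc l cs ⊆ Icc l r := Icc_subset_Icc_right hr.le
  have hR : Icc cs r ⊆ Icc l r := Icc_subset_Icc_left hl.le
  have m3 : StrictMonoOn (fun x => dcW W 3 (x, θs)) (Icc l r) :=
    strictMonoOn_of_deriv_pos (convex_Icc _ _) (hcont 3 (by norm_num)) fun c hc => by
      rw [interior_Icc] at hc
      rw [(hd 3 (by norm_num) c (Ioo_subset_Icc_self hc)).deriv]
      exact h4 c (Ioo_subset_Icc_self hc)
  have m2r : StrictMonoOn (fun x => dcW W 2 (x, θs)) (Icc cs r) :=
    strictMonoOn_of_deriv_pos (convex_Icc _ _) ((hcont 2 (by norm_num)).mono hR) fun c hc => by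
      rw [interior_Icc] at hc
      have hc' := hR (Ioo_subset_Icc_self hc)
      rw [(hd 2 (by norm_num) c hc').deriv]
      have := m3 hcs hc' hc.1
      simp only [e3] at this
      exact this
  have m2l : StrictAntiOn (fun x => dcW W 2 (x, θs)) (Icc l cs) :=
    strictAntiOn_of_deriv_neg (convex_Icc _ _) ((hcont 2 (by norm_num)).mono hL) fun c hc => by
      rw [interior_Icc] at hc
      have hc' := hL (Ioo_subset_Icc_self hc)
      rw [(hd 2 (by norm_num) c hc').deriv]
      have := m3 hc' hcs hc.2
      simp only [e3] at this
      exact this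
  have h2 : ∀ c ∈ Icc l r, c ≠ cs → 0 < dcW W 2 (c, θs) := fun c hc hne => by
    rcases lt_or_gt_of_ne hne with hlt | hlt
    · have := m2l ⟨hc.1, hlt.le⟩ (right_mem_Icc.2 hl.le) hlt
      simp only [e2] at this
      exact this
    · have := m2r (left_mem_Icc.2 hr.le) ⟨hlt.le, hc.2⟩ hlt
      simp only [e2] at this
      exact this
  refine ⟨h2, ?_⟩
  rw [← Icc_union_Icc_eq_Icc hl.le hr.le]
  refine StrictMonoOn.union (c := cs) ?_ ?_ (isGreatest_Icc hl.le) (isLeast_Icc hr.le)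
  · refine strictMonoOn_of_deriv_pos (convex_Icc _ _) ((hcont 1 (by norm_num)).mono hL)
      fun c hc => ?_
    rw [interior_Icc] at hc
    rw [(hd 1 (by norm_num) c (hL (Ioo_subset_Icc_self hc))).deriv]
    exact h2 c (hL (Ioo_subset_Icc_self hc)) hc.2.ne
  · refine strictMonoOn_of_deriv_pos (convex_Icc _ _) ((hcont 1 (by norm_num)).mono hR)
      fun c hc => ?_
    rw [interior_Icc] at hc
    rw [(hd 1 (by norm_num) c (hR (Ioo_subset_Icc_self hc))).deriv]
    exact h2 c (hR (Ioo_subset_Icc_self hc)) hc.1.ne'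

/-- Points of contact of common tangents depend continuously on the temperature if they are
unique. -/
theorem continuousOn_pair (h : GenericTransition W Θ cs θs) {l r : ℝ} {T : Set ℝ}
    (hT : T ⊆ Θ) (hsub : Icc l r ⊆ Ioo 0 1) {a b : ℝ → ℝ}
    (ha : ∀ θ ∈ T, a θ ∈ Icc l cs) (hb : ∀ θ ∈ T, b θ ∈ Icc cs r) (hcs : cs ∈ Icc l r)
    (hslope : ∀ θ ∈ T, dcW W 1 (a θ, θ) = dcW W 1 (b θ, θ))
    (htan : ∀ θ ∈ T, dcW W 0 (b θ, θ) - dcW W 0 (a θ, θ) = dcW W 1 (a θ, θ) * (b θ - a θ))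
    (ha2 : ∀ θ ∈ T, 0 ≤ dcW W 2 (a θ, θ))
    (huniq : ∀ θ ∈ T, ∀ x ∈ Icc l cs, ∀ y ∈ Icc cs r, dcW W 1 (x, θ) = dcW W 1 (y, θ) →
      dcW W 0 (y, θ) - dcW W 0 (x, θ) = dcW W 1 (x, θ) * (y - x) → 0 ≤ dcW W 2 (x, θ) →
      x = a θ ∧ y = b θ) :
    ContinuousOn (fun θ => (a θ, b θ)) T := by
  intro θ hθ
  have hmem : ∀ᶠ t in 𝓝[T] θ, (a t, b t) ∈ Icc l cs ×ˢ Icc cs r :=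
    eventually_nhdsWithin_of_forall fun t ht => ⟨ha t ht, hb t ht⟩
  -- In a compact box convergence follows once every cluster point is identified. All conditions
  -- characterizing the pair are closed, so they pass to the limit along an ultrafilter.
  refine (isCompact_Icc.prod isCompact_Icc).tendsto_nhds_of_unique_mapClusterPt hmem ?_
  rintro ⟨x, y⟩ ⟨hx, hy⟩ hcl
  simp only at hx hy
  obtain ⟨U, hU, hlim⟩ := mapClusterPt_iff_ultrafilter.1 hcl
  have hUT : ∀ᶠ t in (U : Filter ℝ), t ∈ T := hU self_mem_nhdsWithin
  have hUid : Tendsto (fun t => t) (U : Filter ℝ) (𝓝 θ) := hU.trans nhdsWithin_le_nhds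
  have hUa : Tendsto a U (𝓝 x) := (continuous_fst.tendsto (x, y)).comp hlim
  have hUb : Tendsto b U (𝓝 y) := (continuous_snd.tendsto (x, y)).comp hlim
  have hxI : x ∈ Ioo (0 : ℝ) 1 := hsub ⟨hx.1, hx.2.trans hcs.2⟩
  have hyI : y ∈ Ioo (0 : ℝ) 1 := hsub ⟨hcs.1.trans hy.1, hy.2⟩
  have la : ∀ k ≤ 4, Tendsto (fun t => dcW W k (a t, t)) U (𝓝 (dcW W k (x, θ))) := fun k hk =>
    (h.continuousAt_dcW hk hxI (hT hθ)).tendsto.comp (hUa.prodMk_nhds hUid)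
  have lb : ∀ k ≤ 4, Tendsto (fun t => dcW W k (b t, t)) U (𝓝 (dcW W k (y, θ))) := fun k hk =>
    (h.continuousAt_dcW hk hyI (hT hθ)).tendsto.comp (hUb.prodMk_nhds hUid)
  have e := huniq θ hθ x hx y hy
    (tendsto_nhds_unique_of_eventuallyEq (la 1 (by norm_num)) (lb 1 (by norm_num))
      (hUT.mono hslope))
    (tendsto_nhds_unique_of_eventuallyEq ((lb 0 (by norm_num)).sub (la 0 (by norm_num)))
      ((la 1 (by norm_num)).mul (hUb.sub hUa)) (hUT.mono htan))
    (ge_of_tendsto (la 2 (by norm_num)) (hUT.mono ha2))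
  exact Prod.ext e.1 e.2

/-- `W_cc(cs, ·)` vanishes at `θs` with positive derivative, so it has the sign of `θ - θs`. -/
theorem eventually_neg (h : GenericTransition W Θ cs θs) :
    ∀ᶠ θ in 𝓝 θs, θ < θs → dcW W 2 (cs, θ) < 0 := by
  have := eventually_nhdsWithin_sign_eq_of_deriv_pos h.ccθ_pos h.cc_eq
  filter_upwards [this] with θ hθ hlt
  rw [sign_neg (sub_neg.2 hlt)] at hθ
  exact sign_eq_neg_one_iff.1 hθ

/-- First fix a box where `W_cccc > 0`, then restrict `θ`. Strict convexity of `W_cc(·, θ)` holds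
throughout the box; its positivity at `cs ± ε / 2` and the slope comparison with `cs ± ε` persist
from `θs` by continuity; negativity at `cs` comes from `eventually_neg`. This makes `W(·, θ)`
convex-concave-convex for `θ < θs`. -/
theorem exists_maxwellFamily (h : GenericTransition W Θ cs θs) {ε₀ κ : ℝ} (hε₀ : 0 < ε₀)
    (hκ : 0 < κ) :
    ∃ ε θt a b, ε ≤ ε₀ ∧ IsMaxwellFamily W Θ cs θs θt ε κ a b := by
  have hd1 : ∀ᶠ z : ℝ × ℝ in 𝓝 (cs, θs), z ∈ Ioo (0 : ℝ) 1 ×ˢ Θ :=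
    h.isOpen_domain.mem_nhds ⟨h.mem_frac, h.mem_temp⟩
  have hd2 : ∀ᶠ z : ℝ × ℝ in 𝓝 (cs, θs), |dcW W 1 z - dcW W 1 (cs, θs)| < κ :=
    (h.continuousAt_dcW (k := 1) (by norm_num) h.mem_frac h.mem_temp).eventually
      (Metric.ball_mem_nhds _ hκ)
  have hd3 : ∀ᶠ z : ℝ × ℝ in 𝓝 (cs, θs), 0 < dcW W 4 z :=
    (h.continuousAt_dcW (k := 4) (by norm_num) h.mem_frac h.mem_temp).eventually
      (lt_mem_nhds h.cccc_pos)
  obtain ⟨ε₁, hε₁, hball⟩ := Metric.eventually_nhds_iff.1 (hd1.and (hd2.and hd3))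
  set ε := min (ε₁ / 2) ε₀ with hε
  have hεpos : 0 < ε := lt_min (by linarith) hε₀
  have hεlt : ε < ε₁ := (min_le_left _ _).trans_lt (by linarith)
  have hnear : ∀ c ∈ Icc (cs - ε) (cs + ε), ∀ θ, |θ - θs| < ε₁ →
      (c, θ) ∈ Ioo (0 : ℝ) 1 ×ˢ Θ ∧ |dcW W 1 (c, θ) - dcW W 1 (cs, θs)| < κ ∧
        0 < dcW W 4 (c, θ) := fun c hc θ hθ => hball (by
    rw [Prod.dist_eq]
    refine max_lt ?_ hθ
    rw [Real.dist_eq, abs_lt]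
    constructor <;> linarith [hc.1, hc.2])
  have hθs0 : |θs - θs| < ε₁ := by simpa using hε₁
  have hsub : Icc (cs - ε) (cs + ε) ⊆ Ioo 0 1 := fun c hc => (hnear c hc θs hθs0).1.1
  obtain ⟨h2, h1⟩ := h.crit_signs (by linarith) (by linarith) hsub
    fun c hc => (hnear c hc θs hθs0).2.2
  have hcI : ∀ c ∈ Icc (cs - ε / 2) (cs + ε / 2), c ∈ Icc (cs - ε) (cs + ε) := fun c hc =>
    ⟨by linarith [hc.1], by linarith [hc.2]⟩
  have hmemI : ∀ s : ℝ, |s| ≤ ε → cs + s ∈ Icc (cs - ε) (cs + ε) := fun s hs =>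
    ⟨by linarith [(abs_le.1 hs).1], by linarith [(abs_le.1 hs).2]⟩
  have hl : cs - ε ∈ Icc (cs - ε) (cs + ε) := ⟨le_rfl, by linarith⟩
  have hr : cs + ε ∈ Icc (cs - ε) (cs + ε) := ⟨by linarith, le_rfl⟩
  -- Compactness of the `c`-interval makes this neighbourhood of `θs` uniform in `c`; the inner
  -- interval is needed since the comparison is strict.
  have ev1 : ∀ᶠ θ in 𝓝 θs, ∀ c ∈ Icc (cs - ε / 2) (cs + ε / 2),
      dcW W 1 (cs - ε, θ) < dcW W 1 (c, θ) ∧ dcW W 1 (c, θ) < dcW W 1 (cs + ε, θ) := by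
    refine isCompact_Icc.eventually_forall_of_forall_eventually fun c hc => ?_
    have cont : ∀ x ∈ Icc (cs - ε) (cs + ε), ContinuousAt (dcW W 1) (x, θs) := fun x hx =>
      h.continuousAt_dcW (by norm_num) (hsub hx) h.mem_temp
    have c1 : ContinuousAt (fun z : ℝ × ℝ => dcW W 1 (z.2, z.1)) (θs, c) :=
      ContinuousAt.comp' (f := fun z : ℝ × ℝ => (z.2, z.1)) (x := (θs, c))
        (cont c (hcI c hc)) (by fun_prop)
    have c2 : ∀ x ∈ Icc (cs - ε) (cs + ε),
        ContinuousAt (fun z : ℝ × ℝ => dcW W 1 (x, z.1)) (θs, c) := fun x hx =>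
      ContinuousAt.comp' (f := fun z : ℝ × ℝ => (x, z.1)) (x := (θs, c)) (cont x hx) (by fun_prop)
    exact ((c2 _ hl).eventually_lt c1 (h1 hl (hcI c hc) (by linarith [hc.1]))).and
      (c1.eventually_lt (c2 _ hr) (h1 (hcI c hc) hr (by linarith [hc.2])))
  have ev2 : ∀ x ∈ Icc (cs - ε) (cs + ε), x ≠ cs → ∀ᶠ θ in 𝓝 θs, 0 < dcW W 2 (x, θ) :=
    fun x hx hne => by
      have : ContinuousAt (fun θ => dcW W 2 (x, θ)) θs :=
        ContinuousAt.comp' (f := fun θ : ℝ => (x, θ))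
          (h.continuousAt_dcW (by norm_num) (hsub hx) h.mem_temp) (by fun_prop)
      exact this.eventually (lt_mem_nhds (h2 x hx hne))
  obtain ⟨η, hη, hηball⟩ := Metric.eventually_nhds_iff.1 (ev1.and ((ev2 (cs - ε / 2)
    ⟨by linarith, by linarith⟩ (by linarith)).and ((ev2 (cs + ε / 2)
    ⟨by linarith, by linarith⟩ (by linarith)).and h.eventually_neg)))
  set θt := θs - min η ε₁ with hθt
  have hmin : 0 < min η ε₁ := lt_min hη hε₁
  have hθ1 : ∀ θ ∈ Ioc θt θs, |θ - θs| < min η ε₁ := fun θ hθ => by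
    rw [abs_lt]; constructor <;> linarith [hθ.1, hθ.2]
  have hT : Ioc θt θs ⊆ Θ := fun θ hθ =>
    (hnear _ hl θ ((hθ1 θ hθ).trans_le (min_le_right _ _))).1.2
  have hC : ∀ θ ∈ Ioo θt θs, ∃ α β, α < cs ∧ cs < β ∧
      ConvexConcaveConvex (fun c => W c θ) (fun c => dcW W 1 (c, θ)) (fun c => dcW W 2 (c, θ))
        (cs - ε) α β (cs + ε) := fun θ hθ => by
    have hθ' := hθ1 θ (Ioo_subset_Ioc_self hθ)
    have hΘ := hT (Ioo_subset_Ioc_self hθ)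
    obtain ⟨g1, g2, g3, g4⟩ := hηball (hθ'.trans_le (min_le_left _ _))
    have hdg : ∀ k < 4, ∀ c ∈ Icc (cs - ε) (cs + ε),
        HasDerivAt (fun x => dcW W k (x, θ)) (dcW W (k + 1) (c, θ)) c :=
      fun k hk c hc => h.hasDerivAt_dcW hk (hsub hc) hΘ
    have hgc : ContinuousOn (fun c => dcW W 2 (c, θ)) (Icc (cs - ε) (cs + ε)) := fun c hc =>
      (hdg 2 (by norm_num) c hc).continuousAt.continuousWithinAt
    refine convexConcaveConvex_of_strictConvexOn (l' := cs - ε / 2) (r' := cs + ε / 2)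
      (by linarith) (by linarith) (by linarith) (by linarith)
      (fun c hc => h.hasDerivAt_W (hsub hc) hΘ) (hdg 1 (by norm_num)) hgc ?_ g2 (g4 hθ.2) g3
      (fun c hc => (g1 c hc).1) (fun c hc => (g1 c hc).2)
    refine strictConvexOn_of_deriv2_pos' (convex_Icc _ _) hgc fun c hc => ?_
    have e : deriv^[2] (fun c => dcW W 2 (c, θ)) c = dcW W 4 (c, θ) := by
      simp only [dcW, iteratedDeriv_succ, Function.iterate_succ, Function.comp_apply,
        Function.iterate_zero, id]
    rw [e]
    exact (hnear c hc θ (hθ'.trans_le (min_le_right _ _))).2.2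
  choose! α β hα hβ hCCC using hC
  choose! a₀ b₀ p1 p2 p3 p4 p5 p6 using fun θ (hθ : θ ∈ Ioo θt θs) =>
    (hCCC θ hθ).exists_common_tangent
  -- The tangent construction covers only `θ < θs`; at `θs` both contact points are set to `cs`.
  set a := fun θ => if θ < θs then a₀ θ else cs with ha
  set b := fun θ => if θ < θs then b₀ θ else cs with hb
  have hale : ∀ θ, θ < θs → a θ = a₀ θ := fun θ hθ => if_pos hθ
  have hble : ∀ θ, θ < θs → b θ = b₀ θ := fun θ hθ => if_pos hθ
  have has : a θs = cs := if_neg (lt_irrefl _)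
  have hbs : b θs = cs := if_neg (lt_irrefl _)
  have hcases : ∀ θ ∈ Ioc θt θs, (θ ∈ Ioo θt θs) ∨ θ = θs := fun θ hθ =>
    (lt_or_eq_of_le hθ.2).imp_left fun hlt => ⟨hθ.1, hlt⟩
  have hma : ∀ θ ∈ Ioc θt θs, a θ ∈ Ioc (cs - ε) cs := fun θ hθ => by
    rcases hcases θ hθ with hlt | rfl
    · rw [hale θ hlt.2]
      exact ⟨p1 θ hlt, by linarith [p2 θ hlt, hα θ hlt]⟩
    · rw [has]; constructor <;> linarith
  have hmb : ∀ θ ∈ Ioc θt θs, b θ ∈ Ico cs (cs + ε) := fun θ hθ => by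
    rcases hcases θ hθ with hlt | rfl
    · rw [hble θ hlt.2]
      exact ⟨by linarith [p3 θ hlt, hβ θ hlt], p4 θ hlt⟩
    · rw [hbs]; constructor <;> linarith
  have hslope : ∀ θ ∈ Ioc θt θs, dcW W 1 (a θ, θ) = dcW W 1 (b θ, θ) := fun θ hθ => by
    rcases hcases θ hθ with hlt | rfl
    · rw [hale θ hlt.2, hble θ hlt.2]; exact p5 θ hlt
    · rw [has, hbs]
  have hW0 : ∀ c θ, dcW W 0 (c, θ) = W c θ := fun c θ => by simp [dcW]
  have htan : ∀ θ ∈ Ioc θt θs,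
      dcW W 0 (b θ, θ) - dcW W 0 (a θ, θ) = dcW W 1 (a θ, θ) * (b θ - a θ) := fun θ hθ => by
    rcases hcases θ hθ with hlt | rfl
    · rw [hale θ hlt.2, hble θ hlt.2, hW0, hW0]; exact p6 θ hlt
    · rw [has, hbs]; ring
  have ha2 : ∀ θ ∈ Ioc θt θs, 0 ≤ dcW W 2 (a θ, θ) := fun θ hθ => by
    rcases hcases θ hθ with hlt | rfl
    · rw [hale θ hlt.2]; exact ((hCCC θ hlt).pos_left _ ⟨(p1 θ hlt).le, p2 θ hlt⟩).le
    · rw [has]; exact h.cc_eq.ge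
  have huniq : ∀ θ ∈ Ioo θt θs, ∀ x ∈ Icc (cs - ε) (cs + ε), ∀ y ∈ Icc (cs - ε) (cs + ε),
      x < y → dcW W 1 (x, θ) = dcW W 1 (y, θ) →
      W y θ - W x θ = dcW W 1 (x, θ) * (y - x) → x = a θ ∧ y = b θ :=
    fun θ hθ x hx y hy hxy e1 e2 => by
      have hC := hCCC θ hθ
      rw [hale θ hθ.2, hble θ hθ.2]
      exact hC.common_tangent_unique (p1 θ hθ).le
        (by linarith [p2 θ hθ, p3 θ hθ, hα θ hθ, hβ θ hθ]) (p4 θ hθ).le (p5 θ hθ) (p6 θ hθ)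
        hx.1 hxy hy.2 e1 e2
  have hcont : ContinuousOn (fun θ => (a θ, b θ)) (Ioc θt θs) := by
    refine h.continuousOn_pair (l := cs - ε) (r := cs + ε) hT hsub
      (fun θ hθ => Ioc_subset_Icc_self (hma θ hθ)) (fun θ hθ => Ico_subset_Icc_self (hmb θ hθ))
      ⟨by linarith, by linarith⟩ hslope htan ha2 fun θ hθ x hx y hy e1 e2 e3 => ?_
    have hx' : x ∈ Icc (cs - ε) (cs + ε) := ⟨hx.1, by linarith [hx.2]⟩
    have hy' : y ∈ Icc (cs - ε) (cs + ε) := ⟨by linarith [hy.1], hy.2⟩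
    rcases hcases θ hθ with hlt | rfl
    · have hneg := (hηball ((hθ1 θ hθ).trans_le (min_le_left _ _))).2.2.2 hlt.2
      -- In a limit `x < y` could degenerate to `x = y = cs`. The closed condition `0 ≤ W_cc` at `x`
      -- excludes this, since `W_cc` is negative at `cs` below `θs`.
      have hxc : x < cs := lt_of_le_of_ne hx.2 fun hxc => by
        rw [hxc] at e3; linarith
      rw [hW0, hW0] at e2
      exact huniq θ hlt x hx' y hy' (hxc.trans_le hy.1) e1 e2
    · have hxy := h1.injOn hx' hy' e1
      rw [has, hbs]
      constructor <;> linarith [hx.2, hy.1]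
  refine ⟨ε, θt, a, b, min_le_right _ _, ⟨by linarith, hT, hsub, fun c hc θ hθ =>
    (hnear c hc θ ((hθ1 θ hθ).trans_le (min_le_right _ _))).2.1, hcont.fst, hcont.snd,
    fun θ hθ => ⟨(hma θ hθ).1, by linarith [(hma θ hθ).2]⟩,
    fun θ hθ => ⟨by linarith [(hmb θ hθ).1], (hmb θ hθ).2⟩, hslope, has, hbs,
    h1.injOn.mono Ioo_subset_Icc_self, fun θ hθ => ?_, fun θ hθ => ?_, fun θ hθ => ?_,
    fun θ hθ => ?_, fun θ hθ c hc => ?_, fun θ hθ x hx y hy => huniq θ hθ x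
      (Ioo_subset_Icc_self hx) y (Ioo_subset_Icc_self hy)⟩⟩
  · rw [hale θ hθ.2, hble θ hθ.2]
    linarith [p2 θ hθ, p3 θ hθ, hα θ hθ, hβ θ hθ]
  · rw [hale θ hθ.2, hble θ hθ.2]; exact p6 θ hθ
  · rw [hale θ hθ.2]; exact (hCCC θ hθ).pos_left _ ⟨(p1 θ hθ).le, p2 θ hθ⟩
  · rw [hble θ hθ.2]; exact (hCCC θ hθ).pos_right _ ⟨p3 θ hθ, (p4 θ hθ).le⟩
  · rw [hale θ hθ.2, hble θ hθ.2] at *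
    exact (hCCC θ hθ).above_tangent (p1 θ hθ).le
      (by linarith [p2 θ hθ, p3 θ hθ, hα θ hθ, hβ θ hθ]) (p4 θ hθ).le (p5 θ hθ) (p6 θ hθ) hc

end GenericTransition

/-! ### Pressure, transformation rate and the function `Γ` -/

/-- The derivative `-Ĝ_c`, as a function of the pressure. -/
def ell (τ₁ p : ℝ) : ℝ := 1 + Real.log p - τ₁ * p

/-- The specific volume `Ĝ_p`, as a function of pressure and mass fraction. -/
def spvol (τ₁ p c : ℝ) : ℝ := c * τ₁ + (1 - c) / p

/-- The state with given pressure and mass fraction. -/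
def mkState (τ₁ p c : ℝ) : ℝ × ℝ := (1 / spvol τ₁ p c, c)

theorem spvol_pos {τ₁ p c : ℝ} (hτ : 0 < τ₁) (hp : 0 < p) (hc : c ∈ Ioo (0 : ℝ) 1) :
    0 < spvol τ₁ p c := by
  have h1 : 0 < c * τ₁ := mul_pos hc.1 hτ
  have h2 : 0 < (1 - c) / p := div_pos (by linarith [hc.2]) hp
  exact add_pos h1 h2

theorem stateSpace_pos {τ₁ : ℝ} (hτ : 0 < τ₁) {s : ℝ × ℝ} (hs : s ∈ stateSpace τ₁) :
    τ₁ * (1 - s.2) < 1 / s.1 - s.2 * τ₁ ∧ 0 < 1 / s.1 - s.2 * τ₁ := by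
  obtain ⟨_, h1, h2, h3⟩ := hs
  have : 0 < τ₁ * (1 - s.2) := mul_pos hτ (by linarith)
  constructor <;> nlinarith

theorem pressure_eq {τ₁ : ℝ} (hτ : 0 < τ₁) {s : ℝ × ℝ} (hs : s ∈ stateSpace τ₁)
    (W : ℝ → ℝ → ℝ) (θ : ℝ) :
    pressure τ₁ W θ s = (1 - s.2) / (1 / s.1 - s.2 * τ₁) := by
  have h0 := (stateSpace_pos hτ hs).2
  obtain ⟨_, h1, h2, h3⟩ := hs
  have hc : 0 < 1 - s.2 := by linarith
  have hd : HasDerivAt (fun τ => U τ₁ W θ τ s.2)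
      (-(1 - s.2) * (1 / (1 - s.2) / ((1 / s.1 - s.2 * τ₁) / (1 - s.2)))) (1 / s.1) := by
    unfold U Uhat
    exact ((((hasDerivAt_id' (1 / s.1)).sub_const (s.2 * τ₁)).div_const (1 - s.2)).log
      (div_pos h0 hc).ne').const_mul (-(1 - s.2)) |>.add_const _
  rw [pressure, hd.deriv]
  field_simp

theorem pressure_mem {τ₁ : ℝ} (hτ : 0 < τ₁) {s : ℝ × ℝ} (hs : s ∈ stateSpace τ₁)
    (W : ℝ → ℝ → ℝ) (θ : ℝ) : pressure τ₁ W θ s ∈ Ioo 0 (1 / τ₁) := by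
  obtain ⟨h1, h2⟩ := stateSpace_pos hτ hs
  rw [pressure_eq hτ hs]
  have hc : 0 < 1 - s.2 := by linarith [hs.2.2.2]
  refine ⟨div_pos hc h2, ?_⟩
  rw [div_lt_div_iff₀ h2 hτ]
  linarith

theorem one_div_eq_spvol {τ₁ : ℝ} (hτ : 0 < τ₁) {s : ℝ × ℝ} (hs : s ∈ stateSpace τ₁)
    (W : ℝ → ℝ → ℝ) (θ : ℝ) : 1 / s.1 = spvol τ₁ (pressure τ₁ W θ s) s.2 := by
  have h2 := (stateSpace_pos hτ hs).2
  have hc : 0 < 1 - s.2 := by linarith [hs.2.2.2]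
  rw [pressure_eq hτ hs, spvol, div_div_cancel₀ hc.ne']
  ring

theorem eq_mkState {τ₁ : ℝ} (hτ : 0 < τ₁) {s : ℝ × ℝ} (hs : s ∈ stateSpace τ₁)
    (W : ℝ → ℝ → ℝ) (θ : ℝ) : s = mkState τ₁ (pressure τ₁ W θ s) s.2 := by
  rw [mkState, ← one_div_eq_spvol hτ hs, one_div_one_div]

theorem mkState_mem {τ₁ p c : ℝ} (hτ : 0 < τ₁) (hp : p ∈ Ioo 0 (1 / τ₁))
    (hc : c ∈ Ioo (0 : ℝ) 1) : mkState τ₁ p c ∈ stateSpace τ₁ := by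
  have h := spvol_pos hτ hp.1 hc
  refine ⟨one_div_pos.2 h, ?_, hc.1, hc.2⟩
  simp only [mkState, one_div_one_div, spvol]
  have h1 : τ₁ * (1 - c) < (1 - c) / p := by
    rw [lt_div_iff₀ hp.1]
    have := (lt_div_iff₀ hτ).1 hp.2
    nlinarith [hc.2]
  linarith

theorem pressure_mkState {τ₁ p c : ℝ} (hτ : 0 < τ₁) (hp : p ∈ Ioo 0 (1 / τ₁))
    (hc : c ∈ Ioo (0 : ℝ) 1) (W : ℝ → ℝ → ℝ) (θ : ℝ) :
    pressure τ₁ W θ (mkState τ₁ p c) = p := by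
  rw [pressure_eq hτ (mkState_mem hτ hp hc)]
  have h1 : 1 - c ≠ 0 := by linarith [hc.2]
  simp only [mkState, one_div_one_div, spvol, add_sub_cancel_left]
  rw [div_div_cancel₀ h1]

/-- By the Legendre transform `Û_c` at fixed volume equals `Ĝ_c` at fixed pressure, and the latter
depends on the pressure alone. This turns equilibria into slopes of `W`. -/
theorem rate_eq {τ₁ : ℝ} (hτ : 0 < τ₁) {s : ℝ × ℝ} (hs : s ∈ stateSpace τ₁)
    {W : ℝ → ℝ → ℝ} {θ w : ℝ} (hW : HasDerivAt (fun c => W c θ) w s.2) :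
    rate τ₁ W θ s = ell τ₁ (pressure τ₁ W θ s) - w := by
  have h0 := (stateSpace_pos hτ hs).2
  have hp := pressure_eq hτ hs W θ
  have hc : 0 < 1 - s.2 := by linarith [hs.2.2.2]
  have hlin : HasDerivAt (fun c : ℝ => 1 - c) (-1) s.2 := (hasDerivAt_id' s.2).const_sub 1
  have hnum : HasDerivAt (fun c : ℝ => 1 / s.1 - c * τ₁) (-τ₁) s.2 := by
    simpa using ((hasDerivAt_id' s.2).mul_const τ₁).const_sub (1 / s.1)
  have hd := (hlin.neg.mul ((hnum.div hlin hc.ne').log (div_pos h0 hc).ne')).add hW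
  have e : (fun c => U τ₁ W θ (1 / s.1) c) =
      (-fun c : ℝ => 1 - c) * (fun c => Real.log (((fun c : ℝ => 1 / s.1 - c * τ₁) /
        fun c : ℝ => 1 - c) c)) + fun c => W c θ := by
    ext c
    simp [U, Uhat]
    ring
  rw [rate, e, hd.deriv, ell, hp]
  have h1 : (1 - s.2) / (1 / s.1 - s.2 * τ₁) = ((1 / s.1 - s.2 * τ₁) / (1 - s.2))⁻¹ := by
    rw [inv_div]
  rw [h1, Real.log_inv]
  simp only [Pi.div_apply, Pi.neg_apply]
  have h0' := h0.ne'
  have hc' := hc.ne'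
  generalize 1 / s.1 - s.2 * τ₁ = A at *
  generalize Real.log (A / (1 - s.2)) = L
  field_simp
  ring

theorem ell_hasDerivAt {τ₁ p : ℝ} (hp : 0 < p) : HasDerivAt (ell τ₁) (1 / p - τ₁) p := by
  have := (((hasDerivAt_id' p).log hp.ne').const_add 1).sub ((hasDerivAt_id' p).const_mul τ₁)
  simpa [ell] using! this

/-- The derivative `1 / p - τ₁` is positive below `1 / τ₁`, the range in which all pressures of
fluid states lie. Hence an equilibrium slope determines its pressure. -/
theorem ell_strictMonoOn {τ₁ : ℝ} (hτ : 0 < τ₁) : StrictMonoOn (ell τ₁) (Ioc 0 (1 / τ₁)) := by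
  refine strictMonoOn_of_deriv_pos (convex_Ioc _ _)
    (fun p hp => (ell_hasDerivAt hp.1).continuousAt.continuousWithinAt) fun p hp => ?_
  rw [interior_Ioc] at hp
  rw [(ell_hasDerivAt hp.1).deriv, sub_pos, lt_div_iff₀ hp.1]
  have := (lt_div_iff₀ hτ).1 hp.2
  linarith

theorem ell_one_div {τ₁ : ℝ} (hτ : 0 < τ₁) : ell τ₁ (1 / τ₁) = -Real.log τ₁ := by
  rw [ell, one_div, Real.log_inv, mul_inv_cancel₀ hτ.ne']
  ring

/-- Dropping `-τ₁ p < 0` leaves `m < 1 + log p`. The bound involves only the slope, so the size of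
the neighbourhood can be chosen before the temperature. -/
theorem exp_sub_one_lt_of_ell_eq {τ₁ p m : ℝ} (hτ : 0 < τ₁) (hp : 0 < p) (h : m ≤ ell τ₁ p) :
    Real.exp (m - 1) < p := by
  rw [← Real.lt_log_iff_exp_lt hp]
  have := mul_pos hτ hp
  rw [ell] at h
  linarith

/-- A continuous inverse of `ell`. -/
theorem exists_ell_inverse {τ₁ m₀ m₁ : ℝ} (hτ : 0 < τ₁) (hm : m₀ ≤ m₁)
    (h : m₁ < -Real.log τ₁) :
    ∃ P : ℝ → ℝ, ContinuousOn P (Icc m₀ m₁) ∧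
      ∀ m ∈ Icc m₀ m₁, P m ∈ Ioo 0 (1 / τ₁) ∧ ell τ₁ (P m) = m := by
  -- This is a positive left endpoint for inverting `ell`, which is undershot there: `ell` has a
  -- value below `m₀`.
  have h0 : Real.exp (m₀ - 1) < 1 / τ₁ := by
    rw [← Real.lt_log_iff_exp_lt (by positivity), one_div, Real.log_inv]
    linarith
  have hexp := Real.exp_pos (m₀ - 1)
  obtain ⟨P, hPc, hP⟩ := exists_continuousOn_inverse (f := ell τ₁) h0.le
    (fun p hp => (ell_hasDerivAt (hexp.trans_le hp.1)).continuousAt.continuousWithinAt)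
    ((ell_strictMonoOn hτ).mono fun p hp => ⟨hexp.trans_le hp.1, hp.2⟩)
  have hlow : ell τ₁ (Real.exp (m₀ - 1)) ≤ m₀ := by
    rw [ell, Real.log_exp]
    nlinarith [mul_pos hτ hexp]
  have hsub : Icc m₀ m₁ ⊆ Icc (ell τ₁ (Real.exp (m₀ - 1))) (ell τ₁ (1 / τ₁)) :=
    Icc_subset_Icc hlow (by rw [ell_one_div hτ]; exact h.le)
  refine ⟨P, hPc.mono hsub, fun m hm' => ?_⟩
  obtain ⟨h1, h2⟩ := hP m (hsub hm')
  refine ⟨⟨hexp.trans_le h1.1, lt_of_le_of_ne h1.2 fun e => ?_⟩, h2⟩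
  rw [e, ell_one_div hτ] at h2
  linarith [hm'.2]

/-- The Gibbs relation `dĜ = τ dp - ell dc` along a curve. -/
theorem hasDerivAt_Ghat {τ₁ p' c' x : ℝ} {p c : ℝ → ℝ} (hp : HasDerivAt p p' x)
    (hc : HasDerivAt c c' x) (h0 : 0 < p x) :
    HasDerivAt (fun t => Ghat τ₁ (p t) (c t))
      (spvol τ₁ (p x) (c x) * p' - ell τ₁ (p x) * c') x := by
  have h1 := ((hc.const_sub 1).mul ((hp.log h0.ne').const_add 1)).add
    ((hc.mul hp).mul_const τ₁)
  unfold Ghat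
  convert! h1 using 1
  rw [spvol, ell]
  field_simp
  ring

theorem proot_zero {τ₁ ϖ c : ℝ} (hτ : 0 < τ₁) (hϖ : 0 < ϖ) (hc : c ∈ Ioo (0 : ℝ) 1) :
    proot τ₁ ϖ c 0 = ϖ := by
  refine (((proot_spec hτ hϖ hc.1 hc.2 0).2 ϖ hϖ).1 ?_).symm
  ring

theorem Gam_zero {τ₁ ϖ c : ℝ} (hτ : 0 < τ₁) (hϖ : 0 < ϖ) (hc : c ∈ Ioo (0 : ℝ) 1)
    (W : ℝ → ℝ → ℝ) (θ : ℝ) : Gam τ₁ W θ ϖ (c, 0) = Ghat τ₁ ϖ c + W c θ := by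
  simp [Gam, proot_zero hτ hϖ hc]

theorem contDiffAt_proot {τ₁ ϖ : ℝ} (hτ : 0 < τ₁) (hϖ : 0 < ϖ) {z : ℝ × ℝ}
    (hc : z.1 ∈ Ioo (0 : ℝ) 1) {n : WithTop ℕ∞} :
    ContDiffAt ℝ n (fun z : ℝ × ℝ => proot τ₁ ϖ z.1 z.2) z := by
  have h1 : 0 < z.1 * τ₁ := mul_pos hc.1 hτ
  have h2 : 0 < ϖ * (1 - z.1) := mul_pos hϖ (by linarith [hc.2])
  have h3 : 0 < 4 * (z.1 * τ₁) * (ϖ * (1 - z.1)) := by positivity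
  unfold proot
  refine ContDiffAt.div (ContDiffAt.add (by fun_prop) (ContDiffAt.sqrt (by fun_prop) ?_))
    (by fun_prop) (by positivity)
  positivity

theorem contDiffAt_Gam {τ₁ ϖ θ : ℝ} {W : ℝ → ℝ → ℝ} (hτ : 0 < τ₁) (hϖ : 0 < ϖ) {z : ℝ × ℝ}
    (hc : z.1 ∈ Ioo (0 : ℝ) 1) {n : WithTop ℕ∞} (hW : ContDiffAt ℝ n (fun c => W c θ) z.1) :
    ContDiffAt ℝ n (Gam τ₁ W θ ϖ) z := by
  have hp := contDiffAt_proot hτ hϖ hc (n := n)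
  have h0 := (proot_spec hτ hϖ hc.1 hc.2 z.2).1
  have hlog : ContDiffAt ℝ n (fun z : ℝ × ℝ => Real.log (proot τ₁ ϖ z.1 z.2)) z :=
    hp.log h0.ne'
  have hW' : ContDiffAt ℝ n (fun z : ℝ × ℝ => W z.1 θ) z :=
    ContDiffAt.comp (g := fun c => W c θ) (f := Prod.fst) z hW contDiffAt_fst
  unfold Gam Ghat
  fun_prop

theorem hasDerivAt_line (z v : ℝ × ℝ) : HasDerivAt (fun t : ℝ => z + t • v) v 0 := by
  simpa using ((hasDerivAt_id' (0 : ℝ)).smul_const v).const_add z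

/-- Reduces a diagonal second derivative to a one-variable derivative along a line, so the Hessian
of `Γ` can be read off from its gradient on the two coordinate directions. -/
theorem fderiv_fderiv_apply {F : ℝ × ℝ → ℝ} {z v : ℝ × ℝ} (hF : ContDiffAt ℝ 2 F z) {s : ℝ}
    (h : HasDerivAt (fun t : ℝ => fderiv ℝ F (z + t • v) v) s 0) :
    fderiv ℝ (fderiv ℝ F) z v v = s := by
  have h1 : DifferentiableAt ℝ (fderiv ℝ F) z :=
    (hF.fderiv_right (m := 1) (by norm_num)).differentiableAt (by norm_num)
  have h2 : HasFDerivAt (fderiv ℝ F) (fderiv ℝ (fderiv ℝ F) z) (z + (0 : ℝ) • v) := by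
    simpa using h1.hasFDerivAt
  have h3 : HasDerivAt (fun t : ℝ => fderiv ℝ F (z + t • v)) (fderiv ℝ (fderiv ℝ F) z v) 0 :=
    h2.comp_hasDerivAt (0 : ℝ) (hasDerivAt_line z v)
  have h4 : HasDerivAt (fun t : ℝ => fderiv ℝ F (z + t • v) v)
      (fderiv ℝ (fderiv ℝ F) z v v) 0 := by
    simpa using h3.clm_apply (hasDerivAt_const (0 : ℝ) v)
  exact h4.unique h

theorem fderiv_apply_line {F : ℝ × ℝ → ℝ} {z v : ℝ × ℝ} (hF : DifferentiableAt ℝ F z) {s : ℝ}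
    (h : HasDerivAt (fun t : ℝ => F (z + t • v)) s 0) : fderiv ℝ F z v = s := by
  have h2 : HasFDerivAt F (fderiv ℝ F z) (z + (0 : ℝ) • v) := by simpa using hF.hasFDerivAt
  exact (h2.comp_hasDerivAt (0 : ℝ) (hasDerivAt_line z v)).unique h

section Saddle

variable {τ₁ ϖ θ : ℝ} {W : ℝ → ℝ → ℝ}

theorem fderiv_Gam_fst (hτ : 0 < τ₁) (hϖ : 0 < ϖ) {c w : ℝ} (hc : c ∈ Ioo (0 : ℝ) 1)
    (hF : DifferentiableAt ℝ (Gam τ₁ W θ ϖ) (c, 0)) (hw : HasDerivAt (fun c => W c θ) w c) :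
    fderiv ℝ (Gam τ₁ W θ ϖ) (c, 0) (1, 0) = w - ell τ₁ ϖ := by
  refine fderiv_apply_line hF ?_
  have hlin : HasDerivAt (fun t : ℝ => c + t) 1 0 := (hasDerivAt_id' (0 : ℝ)).const_add c
  have hw' : HasDerivAt (fun c => W c θ) w (c + 0) := by simpa using hw
  have h1 := (hasDerivAt_Ghat (τ₁ := τ₁) (hasDerivAt_const (0 : ℝ) ϖ) hlin hϖ).add
    (hw'.comp (0 : ℝ) hlin)
  have h2 : ∀ᶠ t in 𝓝 (0 : ℝ), c + t ∈ Ioo (0 : ℝ) 1 :=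
    hlin.continuousAt.eventually (isOpen_Ioo.mem_nhds (by simpa using hc))
  refine (h1.congr_of_eventuallyEq ?_).congr_deriv (by ring)
  filter_upwards [h2] with t ht
  simpa using Gam_zero hτ hϖ ht W θ

/-- The left side is `Γ_y`. Implicit differentiation of the quadratic equation for the pressure
exhibits a factor `y`, whose cofactor at `y = 0` is `-1`. -/
theorem proot_mul_deriv (hτ : 0 < τ₁) (hϖ : 0 < ϖ) {c p' y : ℝ} (hc : c ∈ Ioo (0 : ℝ) 1)
    (hp : HasDerivAt (proot τ₁ ϖ c) p' y) :
    spvol τ₁ (proot τ₁ ϖ c y) c * p' + y =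
      y * (1 - 2 * (c * τ₁ * proot τ₁ ϖ c y + (1 - c)) ^ 2 /
        ((c * τ₁ * proot τ₁ ϖ c y + (1 - c)) ^ 2 + y ^ 2 * (1 - c))) := by
  have hroot : ∀ t, (proot τ₁ ϖ c t - ϖ) * (c * τ₁ * proot τ₁ ϖ c t + (1 - c))
      + t ^ 2 * proot τ₁ ϖ c t = 0 := fun t =>
    ((proot_spec hτ hϖ hc.1 hc.2 t).2 _ (proot_spec hτ hϖ hc.1 hc.2 t).1).2 rfl
  have h0 := (proot_spec hτ hϖ hc.1 hc.2 y).1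
  have hd := (((hp.sub_const ϖ).mul ((hp.const_mul (c * τ₁)).add_const (1 - c))).add
    ((hasDerivAt_pow 2 y).mul hp)).unique
      ((hasDerivAt_const y (0 : ℝ)).congr_of_eventuallyEq (Eventually.of_forall fun t => hroot t))
  have hr := hroot y
  have h1 : 0 < c * τ₁ := mul_pos hc.1 hτ
  have h2 : 0 < 1 - c := by linarith [hc.2]
  simp only [Nat.cast_ofNat, Nat.add_one_sub_one, pow_one] at hd
  set p := proot τ₁ ϖ c y
  set A := c * τ₁ * p + (1 - c) with hA
  have hApos : 0 < A := by positivity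
  have hden : 0 < A ^ 2 + y ^ 2 * (1 - c) := by positivity
  have hsp : spvol τ₁ p c = A / p := by
    rw [spvol, hA]; field_simp
  -- Multiply the differentiated equation by `A`, replace `(p - ϖ) A` by `-y² p`, and use `A - c τ₁
  -- p = 1 - c`.
  have key : p' * (A ^ 2 + y ^ 2 * (1 - c)) = -(2 * y * p * A) := by
    have e2 : (1 - c) = A - c * τ₁ * p := by rw [hA]; ring
    rw [e2]
    linear_combination A * hd - c * τ₁ * p' * hr
  rw [hsp, eq_div_of_mul_eq hden.ne' key]
  clear_value A
  field_simp
  ring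

theorem fderiv_Gam_snd (hτ : 0 < τ₁) (hϖ : 0 < ϖ) {c y : ℝ} (hc : c ∈ Ioo (0 : ℝ) 1)
    (hF : DifferentiableAt ℝ (Gam τ₁ W θ ϖ) (c, y)) :
    fderiv ℝ (Gam τ₁ W θ ϖ) (c, y) (0, 1) =
      y * (1 - 2 * (c * τ₁ * proot τ₁ ϖ c y + (1 - c)) ^ 2 /
        ((c * τ₁ * proot τ₁ ϖ c y + (1 - c)) ^ 2 + y ^ 2 * (1 - c))) := by
  have hpd : DifferentiableAt ℝ (fun t : ℝ => proot τ₁ ϖ c t) y :=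
    DifferentiableAt.fun_comp' (f := fun t : ℝ => ((c, t) : ℝ × ℝ)) y
      ((contDiffAt_proot hτ hϖ (z := (c, y)) hc (n := 1)).differentiableAt (by norm_num))
      (by fun_prop)
  rw [← proot_mul_deriv hτ hϖ hc hpd.hasDerivAt]
  refine fderiv_apply_line hF ?_
  have h1 := ((hasDerivAt_Ghat (τ₁ := τ₁) hpd.hasDerivAt (hasDerivAt_const y c)
    (proot_spec hτ hϖ hc.1 hc.2 y).1).add_const (W c θ)).add
      ((hasDerivAt_pow 2 y).const_mul (1 / 2 : ℝ))
  have h2 : HasDerivAt (fun t : ℝ => Gam τ₁ W θ ϖ (c, t))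
      (spvol τ₁ (proot τ₁ ϖ c y) c * deriv (fun t : ℝ => proot τ₁ ϖ c t) y + y) y := by
    refine h1.congr_deriv ?_
    simp
  have h3 : HasDerivAt (fun t : ℝ => y + t) 1 0 := (hasDerivAt_id' (0 : ℝ)).const_add y
  have h4 : HasDerivAt (fun t : ℝ => Gam τ₁ W θ ϖ (c, t))
      (spvol τ₁ (proot τ₁ ϖ c y) c * deriv (fun t : ℝ => proot τ₁ ϖ c t) y + y) (y + 0) := by
    simpa using h2
  simpa [Function.comp_def] using h4.comp (0 : ℝ) h3

/-- On `y = 0` the pressure is constantly `ϖ` and `Ghat` is affine in `c`, so `Γ_cc = W_cc > 0`; by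
`fderiv_Gam_snd`, `Γ_yy = -1`. -/
theorem isSaddle_Gam (hτ : 0 < τ₁) (hϖ : 0 < ϖ) {w : ℝ → ℝ} {c w' : ℝ}
    (hc : c ∈ Ioo (0 : ℝ) 1) (hW : ContDiffOn ℝ 2 (fun c => W c θ) (Ioo 0 1))
    (hw : ∀ x ∈ Ioo (0 : ℝ) 1, HasDerivAt (fun c => W c θ) (w x) x) (hw' : HasDerivAt w w' c)
    (hcrit : w c = ell τ₁ ϖ) (hpos : 0 < w') : IsSaddle (Gam τ₁ W θ ϖ) (c, 0) := by
  have hCD : ∀ z : ℝ × ℝ, z.1 ∈ Ioo (0 : ℝ) 1 → ContDiffAt ℝ 2 (Gam τ₁ W θ ϖ) z := fun z hz =>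
    contDiffAt_Gam hτ hϖ hz (hW.contDiffAt (isOpen_Ioo.mem_nhds hz))
  have hdiff : ∀ z : ℝ × ℝ, z.1 ∈ Ioo (0 : ℝ) 1 → DifferentiableAt ℝ (Gam τ₁ W θ ϖ) z :=
    fun z hz => (hCD z hz).differentiableAt (by norm_num)
  have h1 : fderiv ℝ (Gam τ₁ W θ ϖ) (c, 0) (1, 0) = 0 := by
    rw [fderiv_Gam_fst hτ hϖ hc (hdiff _ hc) (hw c hc), hcrit, sub_self]
  have h2 : fderiv ℝ (Gam τ₁ W θ ϖ) (c, 0) (0, 1) = 0 := by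
    rw [fderiv_Gam_snd hτ hϖ hc (hdiff _ hc), zero_mul]
  refine ⟨hdiff _ hc, ?_, ⟨(0, 1), ?_⟩, ⟨(1, 0), ?_⟩⟩
  · ext
    · simpa using h1
    · simpa using h2
  · have hA : 0 < c * τ₁ * ϖ + (1 - c) := by
      have := mul_pos (mul_pos hc.1 hτ) hϖ
      linarith [hc.2]
    have hp : DifferentiableAt ℝ (fun t : ℝ => proot τ₁ ϖ c t) 0 :=
      DifferentiableAt.fun_comp' (f := fun t : ℝ => ((c, t) : ℝ × ℝ)) 0
        ((contDiffAt_proot hτ hϖ (z := (c, 0)) hc (n := 1)).differentiableAt (by norm_num))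
        (by fun_prop)
    have hk : DifferentiableAt ℝ (fun y : ℝ =>
        1 - 2 * (c * τ₁ * proot τ₁ ϖ c y + (1 - c)) ^ 2 /
          ((c * τ₁ * proot τ₁ ϖ c y + (1 - c)) ^ 2 + y ^ 2 * (1 - c))) 0 := by
      refine DifferentiableAt.const_sub (DifferentiableAt.div (by fun_prop) (by fun_prop) ?_) 1
      rw [proot_zero hτ hϖ hc]
      have := pow_pos hA 2
      exact ne_of_gt (by linarith)
    have hd := (hasDerivAt_id' (0 : ℝ)).mul hk.hasDerivAt
    rw [fderiv_fderiv_apply (s := -1) (hCD (c, 0) hc) ?_]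
    · norm_num
    · have e : (fun t : ℝ => fderiv ℝ (Gam τ₁ W θ ϖ) ((c, 0) + t • (0, 1)) (0, 1)) =
          (fun y : ℝ => y) * fun y : ℝ =>
            1 - 2 * (c * τ₁ * proot τ₁ ϖ c y + (1 - c)) ^ 2 /
              ((c * τ₁ * proot τ₁ ϖ c y + (1 - c)) ^ 2 + y ^ 2 * (1 - c)) := by
        ext t
        have := fderiv_Gam_snd (y := t) hτ hϖ hc (hdiff (c, t) hc)
        simpa using this
      rw [e]
      refine hd.congr_deriv ?_
      rw [proot_zero hτ hϖ hc]
      field_simp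
      ring
  · rw [fderiv_fderiv_apply (s := w') (hCD (c, 0) hc) ?_]
    · exact hpos
    · have hlin : HasDerivAt (fun t : ℝ => c + t) 1 0 := (hasDerivAt_id' (0 : ℝ)).const_add c
      have hw0 : HasDerivAt w w' (c + 0) := by simpa using hw'
      have hev : ∀ᶠ t in 𝓝 (0 : ℝ), c + t ∈ Ioo (0 : ℝ) 1 :=
        hlin.continuousAt.eventually (isOpen_Ioo.mem_nhds (by simpa using hc))
      have hd := (hw0.comp (0 : ℝ) hlin).sub_const (ell τ₁ ϖ)
      refine (hd.congr_of_eventuallyEq ?_).congr_deriv (by ring)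
      filter_upwards [hev] with t ht
      simpa using fderiv_Gam_fst hτ hϖ ht (hdiff (c + t, 0) ht) (hw _ ht)

theorem slope_eq_of_isSaddle (hτ : 0 < τ₁) (hϖ : 0 < ϖ) {c w : ℝ} (hc : c ∈ Ioo (0 : ℝ) 1)
    (hw : HasDerivAt (fun c => W c θ) w c) (h : IsSaddle (Gam τ₁ W θ ϖ) (c, 0)) :
    w = ell τ₁ ϖ := by
  have := fderiv_Gam_fst hτ hϖ hc h.1 hw
  rw [h.2.1] at this
  simp at this
  linarith

end Saddle

/-! ### Heteroclinic orbits of scalar equations -/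

/-- Separation of variables: `X` is the time at which the orbit passes `c`, and the orbit is its
inverse function. -/
theorem exists_time_map {a b : ℝ} (hab : a < b) {f : ℝ → ℝ} (hf : ContinuousOn f (Ioo a b))
    (hpos : ∀ c ∈ Ioo a b, 0 < f c) :
    ∃ X : ℝ → ℝ, ∀ c ∈ Ioo a b, HasDerivAt X (f c)⁻¹ c := by
  have hm : (a + b) / 2 ∈ Ioo a b := ⟨by linarith, by linarith⟩
  have hc : ContinuousOn (fun c => (f c)⁻¹) (Ioo a b) := hf.inv₀ fun c hc => (hpos c hc).ne'
  refine ⟨fun c => ∫ t in (a + b) / 2..c, (f t)⁻¹, fun c hc' => ?_⟩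
  refine intervalIntegral.integral_hasDerivAt_right ?_
    (hc.stronglyMeasurableAtFilter isOpen_Ioo c hc') (hc.continuousAt (isOpen_Ioo.mem_nhds hc'))
  exact (hc.mono (ordConnected_Ioo.uIcc_subset hm hc')).intervalIntegrable

/-- A positive velocity on `(a, b)` that vanishes at least linearly at both ends has a complete
orbit from `a` to `b`. -/
theorem exists_heteroclinic_orbit {a b K : ℝ} (hab : a < b) {f : ℝ → ℝ}
    (hf : ContinuousOn f (Ioo a b)) (hpos : ∀ c ∈ Ioo a b, 0 < f c)
    (hKa : ∀ c ∈ Ioo a b, f c ≤ K * (c - a)) (hKb : ∀ c ∈ Ioo a b, f c ≤ K * (b - c)) :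
    ∃ C : ℝ → ℝ, (∀ x, C x ∈ Ioo a b) ∧ (∀ x, HasDerivAt C (f (C x)) x) ∧
      Tendsto C atBot (𝓝 a) ∧ Tendsto C atTop (𝓝 b) := by
  obtain ⟨X, hX⟩ := exists_time_map hab hf hpos
  set m := (a + b) / 2 with hm_def
  have hm : m ∈ Ioo a b := ⟨by linarith, by linarith⟩
  have hK : 0 < K := by
    by_contra! h
    have h1 := hKa m hm
    have h2 := hpos m hm
    have : K * (m - a) ≤ 0 := mul_nonpos_of_nonpos_of_nonneg h (by linarith [hm.1])
    linarith
  have hXc : ContinuousOn X (Ioo a b) := fun c hc => (hX c hc).continuousAt.continuousWithinAt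
  have hXm : StrictMonoOn X (Ioo a b) := by
    refine strictMonoOn_of_deriv_pos (convex_Ioo _ _) hXc fun c hc => ?_
    rw [interior_Ioo] at hc
    rw [(hX c hc).deriv]
    exact inv_pos.2 (hpos c hc)
  -- The linear bound on `f` at `b` makes the travel time diverge at least logarithmically there;
  -- `hleft` does the same at `a`. Hence the orbit exists for all times.
  have hright : MonotoneOn (fun c => X c + K⁻¹ * Real.log (b - c)) (Ioo a b) := by
    have hd : ∀ c ∈ Ioo a b, HasDerivAt (fun c => X c + K⁻¹ * Real.log (b - c))
        ((f c)⁻¹ + K⁻¹ * (-1 / (b - c))) c := fun c hc =>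
      (hX c hc).add ((((hasDerivAt_id' c).const_sub b).log (by linarith [hc.2])).const_mul K⁻¹)
    refine monotoneOn_of_deriv_nonneg (convex_Ioo _ _)
      (fun c hc => (hd c hc).continuousAt.continuousWithinAt)
      (fun c hc => ?_) fun c hc => ?_
    · rw [interior_Ioo] at hc
      exact (hd c hc).differentiableAt.differentiableWithinAt
    · rw [interior_Ioo] at hc
      rw [(hd c hc).deriv]
      have h1 : (K * (b - c))⁻¹ ≤ (f c)⁻¹ := inv_anti₀ (hpos c hc) (hKb c hc)
      have h2 : K⁻¹ * (-1 / (b - c)) = -(K * (b - c))⁻¹ := by rw [mul_inv]; ring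
      linarith
  have hleft : MonotoneOn (fun c => X c - K⁻¹ * Real.log (c - a)) (Ioo a b) := by
    have hd : ∀ c ∈ Ioo a b, HasDerivAt (fun c => X c - K⁻¹ * Real.log (c - a))
        ((f c)⁻¹ - K⁻¹ * (1 / (c - a))) c := fun c hc =>
      (hX c hc).sub ((((hasDerivAt_id' c).sub_const a).log (by linarith [hc.1])).const_mul K⁻¹)
    refine monotoneOn_of_deriv_nonneg (convex_Ioo _ _)
      (fun c hc => (hd c hc).continuousAt.continuousWithinAt)
      (fun c hc => ?_) fun c hc => ?_
    · rw [interior_Ioo] at hc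
      exact (hd c hc).differentiableAt.differentiableWithinAt
    · rw [interior_Ioo] at hc
      rw [(hd c hc).deriv]
      have h1 : (K * (c - a))⁻¹ ≤ (f c)⁻¹ := inv_anti₀ (hpos c hc) (hKa c hc)
      have h2 : K⁻¹ * (1 / (c - a)) = (K * (c - a))⁻¹ := by rw [mul_inv]; ring
      linarith
  have hsurj : ∀ t, ∃ c ∈ Ioo a b, X c = t := fun t => by
    set s := |t - X m| with hs
    have hs0 : 0 ≤ s := abs_nonneg _
    have hE : 0 < Real.exp (-(K * s)) := Real.exp_pos _
    have hE1 : Real.exp (-(K * s)) ≤ 1 := Real.exp_le_one_iff.2 (by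
      have := mul_nonneg hK.le hs0; linarith)
    have hma : 0 < m - a := by linarith [hm.1]
    have hbm : 0 < b - m := by linarith [hm.2]
    -- The exponentials are chosen so that the logarithmic bounds give `X c1 ≤ X m - s` and `X m + s
    -- ≤ X c2`, which traps `t`.
    have hc1 : a + (m - a) * Real.exp (-(K * s)) ∈ Ioc a m :=
      ⟨by have := mul_pos hma hE; linarith, by nlinarith⟩
    have hc2 : b - (b - m) * Real.exp (-(K * s)) ∈ Ico m b :=
      ⟨by nlinarith, by have := mul_pos hbm hE; linarith⟩
    set c1 := a + (m - a) * Real.exp (-(K * s)) with hc1_def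
    set c2 := b - (b - m) * Real.exp (-(K * s)) with hc2_def
    have hI1 : c1 ∈ Ioo a b := ⟨hc1.1, by linarith [hc1.2, hm.2]⟩
    have hI2 : c2 ∈ Ioo a b := ⟨by linarith [hc2.1, hm.1], hc2.2⟩
    have e1 : Real.log (c1 - a) = Real.log (m - a) - K * s := by
      rw [hc1_def, add_sub_cancel_left, Real.log_mul hma.ne' hE.ne', Real.log_exp]; ring
    have e2 : Real.log (b - c2) = Real.log (b - m) - K * s := by
      rw [hc2_def, sub_sub_cancel, Real.log_mul hbm.ne' hE.ne', Real.log_exp]; ring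
    have k1 := hleft hI1 hm hc1.2
    have k2 := hright hm hI2 hc2.1
    simp only [e1] at k1
    simp only [e2] at k2
    have e3 : K⁻¹ * (Real.log (m - a) - K * s) = K⁻¹ * Real.log (m - a) - s := by
      field_simp
    have e4 : K⁻¹ * (Real.log (b - m) - K * s) = K⁻¹ * Real.log (b - m) - s := by
      field_simp
    have h3 := neg_abs_le (t - X m)
    have h4 := le_abs_self (t - X m)
    have hsub : Icc c1 c2 ⊆ Ioo a b := fun c hc => ⟨hI1.1.trans_le hc.1, hc.2.trans_lt hI2.2⟩
    obtain ⟨c, hc, e⟩ := intermediate_value_Icc (hc1.2.trans hc2.1) (hXc.mono hsub)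
      (show t ∈ Icc (X c1) (X c2) from ⟨by linarith, by linarith⟩)
    exact ⟨c, hsub hc, e⟩
  have hXs : StrictMono fun c : Ioo a b => X c := fun c d hcd => hXm c.2 d.2 hcd
  have hXsurj : Function.Surjective fun c : Ioo a b => X c := fun t => by
    obtain ⟨c, hc, e⟩ := hsurj t
    exact ⟨⟨c, hc⟩, e⟩
  let e := hXs.orderIsoOfSurjective _ hXsurj
  have heX : ∀ t, X (e.symm t) = t := fun t => e.apply_symm_apply t
  have hcont : Continuous fun t => (e.symm t : ℝ) := continuous_subtype_val.comp e.symm.continuous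
  have hlt : ∀ c ∈ Ioo a b, ∀ t, X c < t → c < e.symm t := fun c hc t ht => by
    rw [← heX t] at ht
    exact (hXm.lt_iff_lt hc (e.symm t).2).1 ht
  have hgt : ∀ c ∈ Ioo a b, ∀ t, t < X c → e.symm t < c := fun c hc t ht => by
    rw [← heX t] at ht
    exact (hXm.lt_iff_lt (e.symm t).2 hc).1 ht
  refine ⟨fun t => e.symm t, fun t => (e.symm t).2, fun t => ?_, ?_, ?_⟩
  · have := HasDerivAt.of_local_left_inverse (hcont.continuousAt (x := t))
      (hX _ (e.symm t).2) (inv_ne_zero (hpos _ (e.symm t).2).ne') (Eventually.of_forall heX)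
    simpa using this
  · refine tendsto_order.2 ⟨fun c hc => Eventually.of_forall fun t => hc.trans (e.symm t).2.1,
      fun c hc => ?_⟩
    have hmem : min c m ∈ Ioo a b := ⟨lt_min hc hm.1, (min_le_right _ _).trans_lt hm.2⟩
    filter_upwards [eventually_lt_atBot (X (min c m))] with t ht
    exact (hgt _ hmem t ht).trans_le (min_le_left _ _)
  · refine tendsto_order.2 ⟨fun c hc => ?_,
      fun c hc => Eventually.of_forall fun t => (e.symm t).2.2.trans hc⟩
    have hmem : max c m ∈ Ioo a b := ⟨hm.1.trans_le (le_max_right _ _), max_lt hc hm.2⟩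
    filter_upwards [eventually_gt_atTop (X (max c m))] with t ht
    exact (le_max_left _ _).trans_lt (hlt _ hmem t ht)

/-! ### The level set of `Γ`, with the pressure written as `ϖ / r` -/

/-- `Γ(c, 0) - Γ(c, y)` without its `W`-part, if the pressure at `(c, y)` is `ϖ / r`. -/
def levelGap (τ₁ ϖ c r : ℝ) : ℝ :=
  (1 - c) * (Real.log r - (r - 1) / 2) + c * τ₁ * ϖ / 2 * (1 - 1 / r)

/-- On `[1, 2]` one has `log r ≥ 1 - 1 / r ≥ (r - 1) / 2`, so the first term is nonnegative and the
second has the asserted size. The bound serves twice: at `r = 2` for solvability, and in general to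
control `r - 1` by the gap. -/
theorem le_levelGap {τ₁ ϖ c r : ℝ} (hτ : 0 < τ₁) (hϖ : 0 < ϖ) (hc : c ∈ Ioo (0 : ℝ) 1)
    (hr : r ∈ Icc (1 : ℝ) 2) : c * τ₁ * ϖ / 4 * (r - 1) ≤ levelGap τ₁ ϖ c r := by
  have hr0 : 0 < r := by linarith [hr.1]
  have h1 := Real.one_sub_inv_le_log_of_pos hr0
  have h2 : (r - 1) / 2 ≤ 1 - r⁻¹ := by
    have : 1 - r⁻¹ = (r - 1) / r := by field_simp
    rw [this]
    exact div_le_div_of_nonneg_left (by linarith [hr.1]) hr0 hr.2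
  have h3 : 0 ≤ (1 - c) * (Real.log r - (r - 1) / 2) :=
    mul_nonneg (by linarith [hc.2]) (by linarith)
  have h4 : 0 < c * τ₁ * ϖ := mul_pos (mul_pos hc.1 hτ) hϖ
  rw [levelGap, one_div]
  nlinarith

theorem hasDerivAt_levelGap {τ₁ ϖ c r : ℝ} (hr : 0 < r) :
    HasDerivAt (levelGap τ₁ ϖ c)
      ((1 - c) * (1 / r - 1 / 2) + c * τ₁ * ϖ / 2 * (1 / r ^ 2)) r := by
  have h := (((hasDerivAt_id' r).log hr.ne').sub
    (((hasDerivAt_id' r).sub_const 1).div_const 2)).const_mul (1 - c) |>.add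
      (((hasDerivAt_inv hr.ne').const_sub 1).const_mul (c * τ₁ * ϖ / 2))
  refine (h.congr_of_eventuallyEq (Eventually.of_forall fun t => ?_)).congr_deriv ?_
  · simp [levelGap]
  · simp

/-- The restriction `r ≤ 2` is what makes the coefficient `1 / r - 1 / 2` of `1 - c` nonnegative. -/
theorem levelGap_deriv_pos {τ₁ ϖ c r : ℝ} (hτ : 0 < τ₁) (hϖ : 0 < ϖ) (hc : c ∈ Ioo (0 : ℝ) 1)
    (hr : r ∈ Icc (1 : ℝ) 2) :
    0 < (1 - c) * (1 / r - 1 / 2) + c * τ₁ * ϖ / 2 * (1 / r ^ 2) := by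
  have hr0 : 0 < r := by linarith [hr.1]
  have h1 : (1 : ℝ) / 2 ≤ 1 / r := one_div_le_one_div_of_le hr0 hr.2
  have h2 : 0 ≤ (1 - c) * (1 / r - 1 / 2) := mul_nonneg (by linarith [hc.2]) (by linarith)
  have h4 : 0 < c * τ₁ * ϖ := mul_pos (mul_pos hc.1 hτ) hϖ
  have : 0 < c * τ₁ * ϖ / 2 * (1 / r ^ 2) := by positivity
  linarith

theorem levelGap_strictMonoOn {τ₁ ϖ c : ℝ} (hτ : 0 < τ₁) (hϖ : 0 < ϖ)
    (hc : c ∈ Ioo (0 : ℝ) 1) : StrictMonoOn (levelGap τ₁ ϖ c) (Icc 1 2) := by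
  have hd : ∀ r ∈ Icc (1 : ℝ) 2, HasDerivAt (levelGap τ₁ ϖ c)
      ((1 - c) * (1 / r - 1 / 2) + c * τ₁ * ϖ / 2 * (1 / r ^ 2)) r := fun r hr =>
    hasDerivAt_levelGap (by linarith [hr.1])
  refine strictMonoOn_of_deriv_pos (convex_Icc _ _)
    (fun r hr => (hd r hr).continuousAt.continuousWithinAt) fun r hr => ?_
  rw [interior_Icc] at hr
  rw [(hd r (Ioo_subset_Icc_self hr)).deriv]
  exact levelGap_deriv_pos hτ hϖ hc (Ioo_subset_Icc_self hr)

theorem exists_levelGap_eq {τ₁ ϖ c v : ℝ} (hτ : 0 < τ₁) (hϖ : 0 < ϖ) (hc : c ∈ Ioo (0 : ℝ) 1)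
    (hv : 0 < v) (hv' : v < c * τ₁ * ϖ / 4) : ∃ r ∈ Ioo (1 : ℝ) 2, levelGap τ₁ ϖ c r = v := by
  refine intermediate_value_Ioo (by norm_num) (fun r hr =>
    (hasDerivAt_levelGap (by linarith [hr.1])).continuousAt.continuousWithinAt) ⟨?_, ?_⟩
  · simpa [levelGap] using hv
  · have := le_levelGap hτ hϖ hc (r := 2) ⟨by norm_num, le_rfl⟩
    linarith

/-- Continuity of `ρ` is not assumed: `ρ` is a pointwise choice of root, and uniqueness of the root
in `S` identifies it with the implicit function near `c`. -/
theorem contDiffAt_of_implicit {F : ℝ × ℝ → ℝ} {ρ : ℝ → ℝ} {c k : ℝ} {S : Set ℝ}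
    (hF : ContDiffAt ℝ 1 F (c, ρ c)) (hk : HasDerivAt (fun r => F (c, r)) k (ρ c)) (hk0 : k ≠ 0)
    (hS : S ∈ 𝓝 (ρ c))
    (huniq : ∀ᶠ x in 𝓝 c, ∀ r ∈ S, F (x, r) = F (c, ρ c) → ρ x = r) : ContDiffAt ℝ 1 ρ c := by
  have hinv : (fderiv ℝ F (c, ρ c) ∘L .inr ℝ ℝ ℝ).IsInvertible := by
    refine ⟨ContinuousLinearEquiv.unitsEquivAut ℝ (Units.mk0 k hk0), ?_⟩
    have hd : HasFDerivAt F (fderiv ℝ F (c, ρ c)) (c, ρ c) :=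
      (hF.differentiableAt (by norm_num)).hasFDerivAt
    have hl : HasDerivAt (fun r : ℝ => ((c, r) : ℝ × ℝ)) (0, 1) (ρ c) :=
      (hasDerivAt_const _ _).prodMk (hasDerivAt_id _)
    have := (HasFDerivAt.comp_hasDerivAt (ρ c) (f := fun r : ℝ => ((c, r) : ℝ × ℝ)) hd hl).unique hk
    ext
    simp [this]
  have h1 := hF.contDiffAt_implicitFunction (by norm_num) hinv
  have h0 := hF.implicitFunction_apply_self (by norm_num) hinv
  refine h1.congr_of_eventuallyEq ?_
  have h2 := hF.eventually_apply_implicitFunction (by norm_num) hinv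
  have h3 : ∀ᶠ x in 𝓝 c, hF.implicitFunction (by norm_num) hinv x ∈ S := by
    refine h1.continuousAt.eventually ?_
    simp only at h0
    rw [h0]
    exact hS
  filter_upwards [huniq, h2, h3] with x hx hx2 hx3
  exact hx _ hx3 hx2

/-- A profile with mass fraction `C` and pressure `p` on the level set of `Γ`, joining `a` to `b`
at total pressure `ϖ`. -/
structure IsProfile (τ₁ δ ϖ a b : ℝ) (w p C : ℝ → ℝ) : Prop where
  smooth_p : ContDiff ℝ 1 p
  smooth_C : ContDiff ℝ 2 C
  mem_p : ∀ x, p x ∈ Ioo 0 ϖ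
  mem_C : ∀ x, C x ∈ Ioo a b
  deriv_pos : ∀ x, 0 < deriv C x
  balance : ∀ x, p x + δ * deriv C x ^ 2 / spvol τ₁ (p x) (C x) = ϖ
  energy : ∀ x, Ghat τ₁ (p x) (C x) + w (C x) + δ * deriv C x ^ 2 / 2 = Ghat τ₁ ϖ a + w a
  C_bot : Tendsto C atBot (𝓝 a)
  C_top : Tendsto C atTop (𝓝 b)
  p_bot : Tendsto p atBot (𝓝 ϖ)
  p_top : Tendsto p atTop (𝓝 ϖ)
  deriv_bot : Tendsto (deriv C) atBot (𝓝 0)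
  deriv_top : Tendsto (deriv C) atTop (𝓝 0)

/-- The gap between `w` and its tangent vanishes at both contact points, and its derivative is
bounded there by a multiple of the distance; the mean value theorem makes the gap quadratic. -/
theorem gap_le_sq {a b m K : ℝ} {w w1 : ℝ → ℝ}
    (hw : ∀ c ∈ Icc a b, HasDerivAt w (w1 c) c)
    (hLa : ∀ c ∈ Icc a b, |w1 c - m| ≤ K * (c - a))
    (hLb : ∀ c ∈ Icc a b, |w1 c - m| ≤ K * (b - c))
    (htan : w b - w a = m * (b - a)) {c : ℝ} (hc : c ∈ Ioo a b) :
    w c - w a - m * (c - a) ≤ K * (c - a) ^ 2 ∧ w c - w a - m * (c - a) ≤ K * (b - c) ^ 2 := by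
  have hK : 0 ≤ K := by
    have h1 := (abs_nonneg _).trans (hLa c (Ioo_subset_Icc_self hc))
    exact nonneg_of_mul_nonneg_left h1 (by linarith [hc.1])
  constructor
  · obtain ⟨t, ht, e⟩ := exists_slope hc.1 fun s hs => hw s ⟨hs.1, by linarith [hs.2, hc.2]⟩
    have h1 := (le_abs_self _).trans (hLa t ⟨ht.1.le, by linarith [ht.2, hc.2]⟩)
    have h2 : K * (t - a) ≤ K * (c - a) := mul_le_mul_of_nonneg_left (by linarith [ht.2]) hK
    nlinarith [mul_le_mul_of_nonneg_right (h1.trans h2) (by linarith [hc.1] : 0 ≤ c - a)]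
  · obtain ⟨t, ht, e⟩ := exists_slope hc.2 fun s hs => hw s ⟨by linarith [hs.1, hc.1], hs.2⟩
    have h1 := (neg_le_abs _).trans (hLb t ⟨by linarith [ht.1, hc.1], ht.2.le⟩)
    have h2 : K * (b - t) ≤ K * (b - c) := mul_le_mul_of_nonneg_left (by linarith [ht.1]) hK
    nlinarith [mul_le_mul_of_nonneg_right (h1.trans h2) (by linarith [hc.2] : 0 ≤ b - c)]

/-- The square of the velocity variable on the level set, if the pressure is `ϖ / r`. -/
def speedSq (τ₁ ϖ c r : ℝ) : ℝ := (r - 1) * (c * τ₁ * ϖ / r + (1 - c))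

/-- With the pressure `ϖ / r`, momentum balance forces `y² = speedSq`, and the level equation of `Γ`
becomes `levelGap = w c - w a - ell τ₁ ϖ * (c - a)`: one scalar equation for `r` at each `c`. -/
theorem levelGap_energy {τ₁ ϖ c r : ℝ} (hϖ : 0 < ϖ) (hr : 0 < r) :
    Ghat τ₁ (ϖ / r) c + speedSq τ₁ ϖ c r / 2 = Ghat τ₁ ϖ c - levelGap τ₁ ϖ c r := by
  rw [Ghat, Ghat, speedSq, levelGap, Real.log_div hϖ.ne' hr.ne']
  field_simp
  ring

theorem speedSq_balance {τ₁ ϖ c r : ℝ} (hτ : 0 < τ₁) (hϖ : 0 < ϖ) (hc : c ∈ Ioo (0 : ℝ) 1)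
    (hr : 0 < r) : ϖ / r + speedSq τ₁ ϖ c r / spvol τ₁ (ϖ / r) c = ϖ := by
  have h1 := spvol_pos hτ (div_pos hϖ hr) hc
  have e : speedSq τ₁ ϖ c r = (r - 1) * (ϖ / r) * spvol τ₁ (ϖ / r) c := by
    rw [speedSq, spvol]; field_simp
  rw [e, mul_div_assoc, div_self h1.ne']
  field_simp
  ring

theorem speedSq_pos {τ₁ ϖ c r : ℝ} (hτ : 0 < τ₁) (hϖ : 0 < ϖ) (hc : c ∈ Ioo (0 : ℝ) 1)
    (hr : 1 < r) : 0 < speedSq τ₁ ϖ c r := by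
  have h1 : 0 < c * τ₁ * ϖ / r :=
    div_pos (mul_pos (mul_pos hc.1 hτ) hϖ) (by linarith)
  exact mul_pos (by linarith) (by linarith [hc.2])

theorem speedSq_le {τ₁ ϖ c r : ℝ} (hτ : 0 < τ₁) (hϖ : ϖ ∈ Ioo 0 (1 / τ₁))
    (hc : c ∈ Ioo (0 : ℝ) 1) (hr : 1 ≤ r) : speedSq τ₁ ϖ c r ≤ r - 1 := by
  have h1 : τ₁ * ϖ < 1 := by
    have := (lt_div_iff₀ hτ).1 hϖ.2
    linarith
  have h3 : c * τ₁ * ϖ / r ≤ c * τ₁ * ϖ :=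
    div_le_self (mul_pos (mul_pos hc.1 hτ) hϖ.1).le hr
  have h4 : c * τ₁ * ϖ + (1 - c) ≤ 1 := by nlinarith [hc.1]
  rw [speedSq]
  nlinarith

theorem Ghat_affine (τ₁ ϖ a c : ℝ) :
    Ghat τ₁ ϖ c = Ghat τ₁ ϖ a - ell τ₁ ϖ * (c - a) := by
  rw [Ghat, Ghat, ell]; ring

/-- Solve the level equation for `r(c)` and let `f` be the resulting speed `C'`. The gap is
quadratic at both ends, so `r - 1` is at most quadratic and `f`, a square root, at most linear: the
hypothesis of `exists_heteroclinic_orbit`. -/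
theorem exists_profile {τ₁ δ ϖ a b K : ℝ} {w w1 : ℝ → ℝ} (hτ : 0 < τ₁) (hδ : 0 < δ)
    (hϖ : ϖ ∈ Ioo 0 (1 / τ₁)) (hab : a < b) (hsub : Icc a b ⊆ Ioo 0 1)
    (hwC : ContDiffOn ℝ 1 w (Ioo a b)) (hw : ∀ c ∈ Icc a b, HasDerivAt w (w1 c) c)
    (hLa : ∀ c ∈ Icc a b, |w1 c - ell τ₁ ϖ| ≤ K * (c - a))
    (hLb : ∀ c ∈ Icc a b, |w1 c - ell τ₁ ϖ| ≤ K * (b - c))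
    (htan : w b - w a = ell τ₁ ϖ * (b - a))
    (habove : ∀ c ∈ Ioo a b, 0 < w c - w a - ell τ₁ ϖ * (c - a))
    (hsmall : ∀ c ∈ Ioo a b, w c - w a - ell τ₁ ϖ * (c - a) < c * τ₁ * ϖ / 4) :
    ∃ p C : ℝ → ℝ, IsProfile τ₁ δ ϖ a b w p C := by
  have hI : ∀ c ∈ Ioo a b, c ∈ Ioo (0 : ℝ) 1 := fun c hc => hsub (Ioo_subset_Icc_self hc)
  have ha0 : 0 < a := (hsub (left_mem_Icc.2 hab.le)).1
  choose! r hr hrV using fun c (hc : c ∈ Ioo a b) =>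
    exists_levelGap_eq hτ hϖ.1 (hI c hc) (habove c hc) (hsmall c hc)
  have hr1 : ∀ c ∈ Ioo a b, 1 < r c := fun c hc => (hr c hc).1
  have hr0 : ∀ c ∈ Ioo a b, 0 < r c := fun c hc => by linarith [hr1 c hc]
  have hrC : ContDiffOn ℝ 1 r (Ioo a b) := fun c hc => by
    refine ContDiffAt.contDiffWithinAt ?_
    have hr0' := (hr0 c hc).ne'
    have hwc : ContDiffAt ℝ 1 w c := hwC.contDiffAt (isOpen_Ioo.mem_nhds hc)
    refine contDiffAt_of_implicit
      (F := fun z => levelGap τ₁ ϖ z.1 z.2 - (w z.1 - w a - ell τ₁ ϖ * (z.1 - a)))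
      (S := Ioo 1 2) ?_ ((hasDerivAt_levelGap (hr0 c hc)).sub_const (w c - w a - ell τ₁ ϖ * (c - a)))
      (levelGap_deriv_pos hτ hϖ.1 (hI c hc) (Ioo_subset_Icc_self (hr c hc))).ne'
      (isOpen_Ioo.mem_nhds (hr c hc)) ?_
    · have hlog : ContDiffAt ℝ 1 (fun z : ℝ × ℝ => Real.log z.2) (c, r c) :=
        contDiffAt_snd.log hr0'
      have hdiv : ContDiffAt ℝ 1 (fun z : ℝ × ℝ => 1 / z.2) (c, r c) :=
        contDiffAt_const.div contDiffAt_snd hr0'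
      have hw' : ContDiffAt ℝ 1 (fun z : ℝ × ℝ => w z.1) (c, r c) :=
        ContDiffAt.comp (g := w) (f := Prod.fst) (c, r c) hwc contDiffAt_fst
      unfold levelGap
      fun_prop
    · filter_upwards [isOpen_Ioo.mem_nhds hc] with x hx s hs e
      simp only [hrV c hc, sub_self] at e
      refine (levelGap_strictMonoOn hτ hϖ.1 (hI x hx)).injOn (Ioo_subset_Icc_self (hr x hx))
        (Ioo_subset_Icc_self hs) ?_
      rw [hrV x hx]
      linarith
  set f : ℝ → ℝ := fun c => √(speedSq τ₁ ϖ c (r c)) / √δ with hf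
  have hspos : ∀ c ∈ Ioo a b, 0 < speedSq τ₁ ϖ c (r c) := fun c hc =>
    speedSq_pos hτ hϖ.1 (hI c hc) (hr1 c hc)
  have hsδ : 0 < √δ := Real.sqrt_pos.2 hδ
  have hfC : ContDiffOn ℝ 1 f (Ioo a b) := by
    have h1 : ContDiffOn ℝ 1 (fun c => speedSq τ₁ ϖ c (r c)) (Ioo a b) := by
      have : ContDiffOn ℝ 1 (fun c => c * τ₁ * ϖ / r c) (Ioo a b) :=
        ContDiffOn.div (by fun_prop) hrC fun c hc => (hr0 c hc).ne'
      unfold speedSq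
      fun_prop
    exact (h1.sqrt fun c hc => (hspos c hc).ne').div_const _
  have hfpos : ∀ c ∈ Ioo a b, 0 < f c := fun c hc =>
    div_pos (Real.sqrt_pos.2 (hspos c hc)) hsδ
  have hτϖ : 0 < τ₁ * ϖ := mul_pos hτ hϖ.1
  -- Quotient of the quadratic constant `K` of the gap by the constant of `le_levelGap`, with `c`
  -- replaced by its lower bound `a`.
  set M : ℝ := 4 * K / (a * τ₁ * ϖ) with hM
  have haτ : 0 < a * τ₁ * ϖ := by rw [mul_assoc]; exact mul_pos ha0 hτϖ
  have hrle : ∀ c ∈ Ioo a b, r c - 1 ≤ M * (c - a) ^ 2 ∧ r c - 1 ≤ M * (b - c) ^ 2 :=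
    fun c hc => by
      obtain ⟨g1, g2⟩ := gap_le_sq hw hLa hLb htan hc
      have h1 := le_levelGap hτ hϖ.1 (hI c hc) (Ioo_subset_Icc_self (hr c hc))
      rw [hrV c hc] at h1
      have h2 : a * τ₁ * ϖ / 4 * (r c - 1) ≤ c * τ₁ * ϖ / 4 * (r c - 1) := by
        refine mul_le_mul_of_nonneg_right ?_ (by linarith [hr1 c hc])
        have := mul_le_mul_of_nonneg_right hc.1.le hτϖ.le
        linarith
      have h3 : ∀ s, a * τ₁ * ϖ / 4 * (r c - 1) ≤ K * s → r c - 1 ≤ M * s := fun s hs => by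
        rw [hM, div_mul_eq_mul_div, le_div_iff₀ haτ]
        linarith
      exact ⟨h3 _ (h2.trans (h1.trans g1)), h3 _ (h2.trans (h1.trans g2))⟩
  have hfle : ∀ c ∈ Ioo a b, ∀ s, 0 ≤ s → r c - 1 ≤ M * s ^ 2 → f c ≤ √M / √δ * s :=
    fun c hc s hs h => by
      rw [hf]
      simp only
      rw [div_mul_eq_mul_div]
      refine div_le_div_of_nonneg_right ?_ hsδ.le
      have h1 := (speedSq_le hτ hϖ (hI c hc) (hr1 c hc).le).trans h
      calc √(speedSq τ₁ ϖ c (r c)) ≤ √(M * s ^ 2) := Real.sqrt_le_sqrt h1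
        _ = √M * s := by rw [Real.sqrt_mul' _ (sq_nonneg s), Real.sqrt_sq hs]
  have hKa : ∀ c ∈ Ioo a b, f c ≤ √M / √δ * (c - a) := fun c hc =>
    hfle c hc _ (by linarith [hc.1]) (hrle c hc).1
  have hKb : ∀ c ∈ Ioo a b, f c ≤ √M / √δ * (b - c) := fun c hc =>
    hfle c hc _ (by linarith [hc.2]) (hrle c hc).2
  obtain ⟨C, hC, hCd, hCbot, hCtop⟩ :=
    exists_heteroclinic_orbit hab hfC.continuousOn hfpos hKa hKb
  have hderiv : deriv C = fun x => f (C x) := funext fun x => (hCd x).deriv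
  have hC0 : Continuous C := continuous_iff_continuousAt.2 fun x => (hCd x).continuousAt
  have hC1 : ContDiff ℝ 1 C := by
    rw [contDiff_one_iff_deriv, hderiv]
    exact ⟨fun x => (hCd x).differentiableAt, hfC.continuousOn.comp_continuous hC0 hC⟩
  -- Bootstrap: `C' = f(C)` with `f` and `C` both `C¹`.
  have hC2 : ContDiff ℝ 2 C := by
    rw [show (2 : WithTop ℕ∞) = 1 + 1 by norm_num, contDiff_succ_iff_deriv, hderiv]
    exact ⟨fun x => (hCd x).differentiableAt, by simp, hfC.comp_contDiff hC1 hC⟩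
  have hrC1 : ContDiff ℝ 1 fun x => r (C x) := hrC.comp_contDiff hC1 hC
  have hsq : ∀ x, δ * deriv C x ^ 2 = speedSq τ₁ ϖ (C x) (r (C x)) := fun x => by
    rw [hderiv]
    simp only [hf]
    rw [div_pow, Real.sq_sqrt (hspos _ (hC x)).le, Real.sq_sqrt hδ.le]
    field_simp
  have hrlim : ∀ (l : Filter ℝ) (e : ℝ), Tendsto C l (𝓝 e) →
      (∀ c ∈ Ioo a b, r c - 1 ≤ M * (c - e) ^ 2) → Tendsto (fun x => r (C x)) l (𝓝 1) :=
    fun l e hl hle => by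
      have h1 : Tendsto (fun x => 1 + M * (C x - e) ^ 2) l (𝓝 (1 + M * (e - e) ^ 2)) :=
        (((hl.sub_const e).pow 2).const_mul M).const_add 1
      have h2 : 1 + M * (e - e) ^ 2 = 1 := by ring
      rw [h2] at h1
      exact tendsto_of_tendsto_of_tendsto_of_le_of_le tendsto_const_nhds h1
        (fun x => (hr1 _ (hC x)).le) (fun x => by have := hle _ (hC x); linarith)
  have hplim : ∀ l : Filter ℝ, Tendsto (fun x => r (C x)) l (𝓝 1) →
      Tendsto (fun x => ϖ / r (C x)) l (𝓝 ϖ) := fun l hl => by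
    simpa [Pi.div_def] using! (tendsto_const_nhds (x := ϖ)).div hl one_ne_zero
  have hdlim : ∀ (l : Filter ℝ) (e : ℝ), Tendsto C l (𝓝 e) →
      (∀ c ∈ Ioo a b, f c ≤ √M / √δ * |c - e|) → Tendsto (deriv C) l (𝓝 0) :=
    fun l e hl hle => by
      have h1 : Tendsto (fun x => √M / √δ * |C x - e|) l (𝓝 (√M / √δ * |e - e|)) :=
        ((hl.sub_const e).abs).const_mul _
      have h2 : √M / √δ * |e - e| = 0 := by simp
      rw [h2] at h1
      rw [hderiv]
      exact tendsto_of_tendsto_of_tendsto_of_le_of_le tendsto_const_nhds h1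
        (fun x => (hfpos _ (hC x)).le) (fun x => hle _ (hC x))
  refine ⟨fun x => ϖ / r (C x), C, ⟨contDiff_const.div hrC1 fun x => (hr0 _ (hC x)).ne', hC2,
    fun x => ⟨div_pos hϖ.1 (hr0 _ (hC x)), div_lt_self hϖ.1 (hr1 _ (hC x))⟩, hC, fun x => ?_,
    fun x => ?_, fun x => ?_, hCbot, hCtop, hplim _ (hrlim _ a hCbot fun c hc => (hrle c hc).1),
    hplim _ (hrlim _ b hCtop fun c hc => ?_), hdlim _ a hCbot fun c hc => ?_,
    hdlim _ b hCtop fun c hc => ?_⟩⟩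
  · rw [hderiv]; exact hfpos _ (hC x)
  · rw [hsq]; exact speedSq_balance hτ hϖ.1 (hI _ (hC x)) (hr0 _ (hC x))
  · have e1 := levelGap_energy (τ₁ := τ₁) (c := C x) hϖ.1 (hr0 _ (hC x))
    rw [hrV _ (hC x), Ghat_affine τ₁ ϖ a (C x)] at e1
    rw [hsq]
    linarith
  · have := (hrle c hc).2
    rw [← neg_sub b c, neg_sq]
    exact this
  · rw [abs_of_pos (by linarith [hc.1])]; exact hKa c hc
  · rw [abs_of_neg (by linarith [hc.2]), neg_sub]; exact hKb c hc

/-! ### Planar stationary fields -/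

section Planar

variable {d : ℕ} {e : EuclideanSpace ℝ (Fin d)}

theorem pd_planar {H : ℝ → ℝ} {x : EuclideanSpace ℝ (Fin d)}
    (hH : DifferentiableAt ℝ H (inner ℝ e x)) (i : Fin d) :
    pd i (fun z => H (inner ℝ e z)) x = e i * deriv H (inner ℝ e x) := by
  have h1 : HasFDerivAt (fun z : EuclideanSpace ℝ (Fin d) => (inner ℝ e z : ℝ))
      (innerSL ℝ e) x := (innerSL ℝ e).hasFDerivAt
  have h2 := HasDerivAt.comp_hasFDerivAt x (hH.hasDerivAt) h1
  have h3 : fderiv ℝ (fun z => H (inner ℝ e z)) x =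
      deriv H (inner ℝ e x) • (innerSL ℝ e) := h2.fderiv
  rw [pd, h3]
  simp [EuclideanSpace.inner_single_right, mul_comm]

theorem pd_zero (i : Fin d) (x : EuclideanSpace ℝ (Fin d)) : pd i (fun _ => (0 : ℝ)) x = 0 := by
  simp [pd]

theorem sum_sq_eq_one (he : ‖e‖ = 1) : ∑ i, e i * e i = 1 := by
  have := EuclideanSpace.real_norm_sq_eq e
  rw [he] at this
  simp only [sq] at this
  linarith

theorem planar_pressure {P R : ℝ → ℝ} {x : EuclideanSpace ℝ (Fin d)}
    (hP : DifferentiableAt ℝ P (inner ℝ e x)) (j : Fin d) :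
    ∑ i, pd i (fun z => R (inner ℝ e z) * (0 : EuclideanSpace ℝ (Fin d)) i *
        (0 : EuclideanSpace ℝ (Fin d)) j + if i = j then P (inner ℝ e z) else 0) x
      = e j * deriv P (inner ℝ e x) := by
  rw [Finset.sum_eq_single j]
  · simp [pd_planar hP]
  · intro i _ hij
    simp [hij, pd_zero]
  · simp

/-- Viscous terms vanish with the velocity. The capillary tensor is a function of `e·x` times `e ⊗
e`, and its divergence points along `e` because `∑ e_i² = 1`. -/
theorem planar_stress {R C : ℝ → ℝ} (hR : Differentiable ℝ R) (hC : Differentiable ℝ C)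
    (hC' : Differentiable ℝ (deriv C)) (he : ‖e‖ = 1) (δ μ lam : ℝ)
    (x : EuclideanSpace ℝ (Fin d)) (j : Fin d) :
    ∑ i, pd i (fun z =>
        μ * (pd i (fun _ => (0 : EuclideanSpace ℝ (Fin d)) j) z
          + pd j (fun _ => (0 : EuclideanSpace ℝ (Fin d)) i) z)
        + (if i = j then lam * ∑ k, pd k (fun _ => (0 : EuclideanSpace ℝ (Fin d)) k) z else 0)
        - δ * R (inner ℝ e z) * (pd i (fun z => C (inner ℝ e z)) z
          * pd j (fun z => C (inner ℝ e z)) z)) x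
      = -(e j * deriv (fun s => δ * R s * deriv C s ^ 2) (inner ℝ e x)) := by
  have h : ∀ i, pd i (fun z =>
        μ * (pd i (fun _ => (0 : EuclideanSpace ℝ (Fin d)) j) z
          + pd j (fun _ => (0 : EuclideanSpace ℝ (Fin d)) i) z)
        + (if i = j then lam * ∑ k, pd k (fun _ => (0 : EuclideanSpace ℝ (Fin d)) k) z else 0)
        - δ * R (inner ℝ e z) * (pd i (fun z => C (inner ℝ e z)) z
          * pd j (fun z => C (inner ℝ e z)) z)) x
      = (e i * e i) * -(e j * deriv (fun s => δ * R s * deriv C s ^ 2) (inner ℝ e x)) := by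
    intro i
    have h1 : (fun z =>
        μ * (pd i (fun _ => (0 : EuclideanSpace ℝ (Fin d)) j) z
          + pd j (fun _ => (0 : EuclideanSpace ℝ (Fin d)) i) z)
        + (if i = j then lam * ∑ k, pd k (fun _ => (0 : EuclideanSpace ℝ (Fin d)) k) z else 0)
        - δ * R (inner ℝ e z) * (pd i (fun z => C (inner ℝ e z)) z
          * pd j (fun z => C (inner ℝ e z)) z)) =
        fun z => (fun s => -(e i * e j) * (δ * R s * deriv C s ^ 2)) (inner ℝ e z) := by
      ext z
      rw [pd_planar (hC _), pd_planar (hC _)]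
      simp only [PiLp.zero_apply, pd_zero, add_zero, mul_zero, Finset.sum_const_zero, ite_self]
      ring
    have h2 : Differentiable ℝ fun s => δ * R s * deriv C s ^ 2 := by fun_prop
    rw [h1, pd_planar ((h2 _).const_mul _), deriv_const_mul _ (h2 _)]
    ring
  rw [Finset.sum_congr rfl fun i _ => h i, ← Finset.sum_mul, sum_sq_eq_one he, one_mul]

theorem planar_diffusion {R C : ℝ → ℝ} (hR : Differentiable ℝ R) (hC : Differentiable ℝ C)
    (hC' : Differentiable ℝ (deriv C)) (he : ‖e‖ = 1) (δ : ℝ)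
    (x : EuclideanSpace ℝ (Fin d)) :
    ∑ i, pd i (fun z => δ * R (inner ℝ e z) * pd i (fun z => C (inner ℝ e z)) z) x
      = deriv (fun s => δ * R s * deriv C s) (inner ℝ e x) := by
  have h : ∀ i, pd i (fun z => δ * R (inner ℝ e z) * pd i (fun z => C (inner ℝ e z)) z) x
      = (e i * e i) * deriv (fun s => δ * R s * deriv C s) (inner ℝ e x) := by
    intro i
    have h1 : (fun z => δ * R (inner ℝ e z) * pd i (fun z => C (inner ℝ e z)) z) =
        fun z => (fun s => e i * (δ * R s * deriv C s)) (inner ℝ e z) := by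
      ext z
      rw [pd_planar (hC _)]
      ring
    have h2 : Differentiable ℝ fun s => δ * R s * deriv C s := by fun_prop
    rw [h1, pd_planar ((h2 _).const_mul _), deriv_const_mul _ (h2 _)]
    ring
  rw [Finset.sum_congr rfl fun i _ => h i, ← Finset.sum_mul, sum_sq_eq_one he, one_mul]

theorem isSolution_planar {τ₁ θ δ μ lam : ℝ} {W : ℝ → ℝ → ℝ} {R C : ℝ → ℝ} (he : ‖e‖ = 1)
    (hR : ContDiff ℝ 1 R) (hC : ContDiff ℝ 2 C) (hmem : ∀ s, (R s, C s) ∈ stateSpace τ₁)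
    (hP : Differentiable ℝ fun s => pressure τ₁ W θ (R s, C s))
    (hbal : ∀ s, pressure τ₁ W θ (R s, C s) + δ * R s * deriv C s ^ 2
      = pressure τ₁ W θ (R 0, C 0) + δ * R 0 * deriv C 0 ^ 2)
    (hphase : ∀ s, R s * rate τ₁ W θ (R s, C s) + deriv (fun s => δ * R s * deriv C s) s = 0) :
    IsSolution τ₁ W θ d δ μ lam
      (fun _ x => R (inner ℝ e x)) (fun _ _ => 0) (fun _ x => C (inner ℝ e x)) := by
  have hin : ContDiff ℝ 2 (fun z : ℝ × EuclideanSpace ℝ (Fin d) => (inner ℝ e z.2 : ℝ)) :=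
    (innerSL ℝ e).contDiff.comp contDiff_snd
  have hRd : Differentiable ℝ R := hR.differentiable (by norm_num)
  have hCd : Differentiable ℝ C := hC.differentiable (by norm_num)
  have hCd' : Differentiable ℝ (deriv C) :=
    hC.differentiable_deriv_two
  refine ⟨hR.comp (hin.of_le (by norm_num)), contDiff_const, hC.comp hin,
    fun _ x => hmem _, fun t x => ?_, fun t x j => ?_, fun t x => ?_⟩
  · simp [pd_zero]
  · refine Eq.trans (congrArg₂ (· + ·) ?_ (planar_pressure (R := R) (hP _) j))
      (Eq.trans ?_ (planar_stress hRd hCd hCd' he δ μ lam x j).symm) (b := 0 + _)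
    · simp
    · have h2 : Differentiable ℝ fun s => δ * R s * deriv C s ^ 2 := by fun_prop
      have h3 := deriv_fun_add (hP (inner ℝ e x)) (h2 (inner ℝ e x))
      rw [funext hbal, deriv_const] at h3
      linear_combination -(e j) * h3
  · have h1 := planar_diffusion hRd hCd hCd' he δ x
    have h2 := hphase (inner ℝ e x)
    rw [← h1] at h2
    rw [h2, mul_zero]
    simp [pd_zero]

/-- Restriction to the line `s • e` recovers the profile equations and the regularity of `R` and
`C`; a nonzero component of `e` suffices for the momentum equation. -/
theorem ode_of_isSolution {τ₁ θ δ μ lam : ℝ} {W : ℝ → ℝ → ℝ} {R C : ℝ → ℝ} (hδ : 0 < δ)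
    (he : ‖e‖ = 1) (hτ : 0 < τ₁)
    (h : IsSolution τ₁ W θ d δ μ lam
      (fun _ x => R (inner ℝ e x)) (fun _ _ => 0) (fun _ x => C (inner ℝ e x))) :
    ContDiff ℝ 1 R ∧ ContDiff ℝ 2 C ∧ (∀ s, (R s, C s) ∈ stateSpace τ₁) ∧
      (Differentiable ℝ fun s => pressure τ₁ W θ (R s, C s)) ∧
      (∀ s, deriv (fun s => pressure τ₁ W θ (R s, C s)) s
        + deriv (fun s => δ * R s * deriv C s ^ 2) s = 0) ∧
      ∀ s, R s * rate τ₁ W θ (R s, C s) + deriv (fun s => δ * R s * deriv C s) s = 0 := by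
  have hline : ∀ s : ℝ, inner ℝ e (s • e) = s := fun s => by
    rw [inner_smul_right, real_inner_self_eq_norm_sq, he]; ring
  have hl : ContDiff ℝ 2 (fun s : ℝ => ((0 : ℝ), s • e)) := by fun_prop
  have hR : ContDiff ℝ 1 R := by
    simpa only [Function.comp_def, hline] using h.smooth_ρ.comp (hl.of_le (by norm_num))
  have hC : ContDiff ℝ 2 C := by
    simpa only [Function.comp_def, hline] using h.smooth_c.comp hl
  have hmem : ∀ s, (R s, C s) ∈ stateSpace τ₁ := fun s => by
    simpa only [hline] using h.mem_states 0 (s • e)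
  have hRd : Differentiable ℝ R := hR.differentiable (by norm_num)
  have hCd : Differentiable ℝ C := hC.differentiable (by norm_num)
  have hCd' : Differentiable ℝ (deriv C) :=
    hC.differentiable_deriv_two
  have hP : Differentiable ℝ fun s => pressure τ₁ W θ (R s, C s) := by
    have e1 : (fun s => pressure τ₁ W θ (R s, C s)) =
        fun s => (1 - C s) / (1 / R s - C s * τ₁) := funext fun s => pressure_eq hτ (hmem s) W θ
    rw [e1]
    have h1 : Differentiable ℝ fun s => 1 / R s :=
      (differentiable_const _).fun_div hRd fun s => (hmem s).1.ne'
    exact Differentiable.fun_div (by fun_prop) (by fun_prop)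
      fun s => (stateSpace_pos hτ (hmem s)).2.ne'
  refine ⟨hR, hC, hmem, hP, fun s => ?_, fun s => ?_⟩
  · have h0 : ∃ j, e j ≠ 0 := by
      by_contra! h0
      have := sum_sq_eq_one he
      simp [h0] at this
    obtain ⟨j, hj⟩ := h0
    have h1 := h.momentum 0 (s • e) j
    rw [planar_stress hRd hCd hCd' he δ μ lam] at h1
    have h2 := planar_pressure (R := R) (x := s • e) (hP (inner ℝ e (s • e))) j
    rw [hline] at h1 h2
    have h3 := (congrArg₂ (· + ·) (by simp : deriv (fun _ : ℝ => R s *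
      (0 : EuclideanSpace ℝ (Fin d)) j) 0 = 0) h2).symm.trans h1
    simp only [zero_add] at h3
    have h4 : e j * (deriv (fun s => pressure τ₁ W θ (R s, C s)) s
        + deriv (fun s => δ * R s * deriv C s ^ 2) s) = 0 := by linear_combination h3
    exact (mul_eq_zero.1 h4).resolve_left hj
  · have h1 := h.phase 0 (s • e)
    rw [planar_diffusion hRd hCd hCd' he δ, hline] at h1
    have h2 : (√δ)⁻¹ ≠ 0 := inv_ne_zero (Real.sqrt_pos.2 hδ).ne'
    have h3 : 0 = (√δ)⁻¹ * (R s * rate τ₁ W θ (R s, C s)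
        + deriv (fun s => δ * R s * deriv C s) s) := by
      rw [← h1]
      simp [pd_zero]
    exact (mul_eq_zero.1 h3.symm).resolve_left h2

end Planar

/-! ### The energy of a profile -/

/-- Momentum balance eliminates `P'`, after which `C' / R` factors out and the phase equation
remains. Thus the phase equation implies conservation of energy, and the converse holds where `C' ≠
0`. -/
theorem hasDerivAt_energy {τ₁ δ x P' R' D' w' : ℝ} {P R C w : ℝ → ℝ} (hP : HasDerivAt P P' x)
    (hR : HasDerivAt R R' x) (hC : DifferentiableAt ℝ C x) (hD : HasDerivAt (deriv C) D' x)
    (hw : HasDerivAt w w' (C x)) (hP0 : 0 < P x) (hR0 : 0 < R x)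
    (hRP : 1 / R x = spvol τ₁ (P x) (C x))
    (hbal : P' + deriv (fun s => δ * R s * deriv C s ^ 2) x = 0) :
    HasDerivAt (fun s => Ghat τ₁ (P s) (C s) + w (C s) + δ * deriv C s ^ 2 / 2)
      (-(deriv C x / R x) * (R x * (ell τ₁ (P x) - w')
        + deriv (fun s => δ * R s * deriv C s) x)) x := by
  have h1 := ((hasDerivAt_Ghat (τ₁ := τ₁) hP hC.hasDerivAt hP0).add
    (hw.comp x hC.hasDerivAt)).add (((hD.pow 2).const_mul δ).div_const 2)
  have h2 := ((hR.const_mul δ).mul (hD.pow 2)).deriv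
  have h3 := ((hR.const_mul δ).mul hD).deriv
  have e2 : deriv (fun s => δ * R s * deriv C s ^ 2) x = _ := h2
  have e3 : deriv (fun s => δ * R s * deriv C s) x = _ := h3
  rw [e2] at hbal
  rw [e3]
  refine (h1.congr_deriv ?_)
  rw [← hRP]
  simp only [Nat.cast_ofNat, Nat.add_one_sub_one, pow_one, Pi.pow_apply] at hbal ⊢
  field_simp
  field_simp at hbal
  linear_combination hbal

/-- By the mean value theorem on `[n, n + 1]`, `C'` takes the values `C (n + 1) - C n`, which tend
to `0`. The square appears because momentum balance controls only `C'²`. -/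
theorem eq_zero_of_tendsto_deriv_sq {C : ℝ → ℝ} (hC : Differentiable ℝ C) {c L : ℝ}
    (h : Tendsto C atTop (𝓝 c)) (hL : Tendsto (fun x => deriv C x ^ 2) atTop (𝓝 L)) : L = 0 := by
  have hex : ∀ n : ℕ, ∃ t ∈ Ioo (n : ℝ) (n + 1), C (n + 1) - C n = deriv C t * ((n + 1) - n) :=
    fun n => exists_slope (by linarith) fun s _ => (hC s).hasDerivAt
  choose t ht hts using hex
  have hn : Tendsto (fun n : ℕ => (n : ℝ)) atTop atTop := tendsto_natCast_atTop_atTop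
  have htop : Tendsto t atTop atTop := tendsto_atTop_mono (fun n => (ht n).1.le) hn
  have h1 : Tendsto (fun n : ℕ => C (n + 1) - C n) atTop (𝓝 (c - c)) :=
    (h.comp (tendsto_atTop_add_const_right _ 1 hn)).sub (h.comp hn)
  have h2 : Tendsto (fun n => deriv C (t n) ^ 2) atTop (𝓝 ((c - c) ^ 2)) := by
    refine (h1.pow 2).congr fun n => ?_
    rw [hts n]
    ring
  have := tendsto_nhds_unique (hL.comp htop) h2
  simpa using this

theorem eq_zero_of_tendsto_deriv_sq_atBot {C : ℝ → ℝ} (hC : Differentiable ℝ C) {c L : ℝ}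
    (h : Tendsto C atBot (𝓝 c)) (hL : Tendsto (fun x => deriv C x ^ 2) atBot (𝓝 L)) : L = 0 := by
  refine eq_zero_of_tendsto_deriv_sq (C := fun x => C (-x)) (hC.comp differentiable_neg)
    (h.comp tendsto_neg_atTop_atBot) ?_
  simp only [deriv_comp_neg, neg_sq]
  exact hL.comp tendsto_neg_atTop_atBot

/-- Momentum balance expresses `C'²` through `(R, C)`, so it has a limit, which `hzero` makes `0`.
Convergence of the derivative is not part of the notion of phase boundary and has to be derived. -/
theorem tendsto_energy {τ₁ δ θ k : ℝ} {W : ℝ → ℝ → ℝ} {R C : ℝ → ℝ} {l : Filter ℝ} {a : ℝ × ℝ}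
    (hδ : 0 < δ) (hτ : 0 < τ₁) (ha : a ∈ stateSpace τ₁)
    (hmem : ∀ s, (R s, C s) ∈ stateSpace τ₁) (hlim : Tendsto (fun s => (R s, C s)) l (𝓝 a))
    (hW : ContinuousAt (fun c => W c θ) a.2)
    (hk : ∀ s, pressure τ₁ W θ (R s, C s) + δ * R s * deriv C s ^ 2 = k)
    (hzero : ∀ L, Tendsto (fun x => deriv C x ^ 2) l (𝓝 L) → L = 0) :
    Tendsto (fun s => Ghat τ₁ (pressure τ₁ W θ (R s, C s)) (C s) + W (C s) θ
        + δ * deriv C s ^ 2 / 2) l (𝓝 (Ghat τ₁ (pressure τ₁ W θ a) a.2 + W a.2 θ)) := by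
  have hR : Tendsto R l (𝓝 a.1) := (continuous_fst.tendsto a).comp hlim
  have hC : Tendsto C l (𝓝 a.2) := (continuous_snd.tendsto a).comp hlim
  have ha1 : a.1 ≠ 0 := ha.1.ne'
  have hP : Tendsto (fun s => pressure τ₁ W θ (R s, C s)) l (𝓝 (pressure τ₁ W θ a)) := by
    simp only [fun s => pressure_eq hτ (hmem s) W θ, pressure_eq hτ ha W θ]
    exact (hC.const_sub 1).div ((tendsto_const_nhds.div hR ha1).sub (hC.mul_const τ₁))
      (stateSpace_pos hτ ha).2.ne'
  have hD : Tendsto (fun x => deriv C x ^ 2) l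
      (𝓝 ((k - pressure τ₁ W θ a) / (δ * a.1))) := by
    have := (hP.const_sub k).div (hR.const_mul δ) (mul_ne_zero hδ.ne' ha1)
    refine this.congr fun s => ?_
    have h1 : δ * R s ≠ 0 := mul_ne_zero hδ.ne' (hmem s).1.ne'
    simp only [Pi.div_apply]
    rw [← hk s, add_sub_cancel_left, mul_div_cancel_left₀ _ h1]
  rw [hzero _ hD] at hD
  have hlog := hP.log (pressure_mem hτ ha W θ).1.ne'
  have hfin := (((hC.const_sub 1).mul (hlog.const_add 1)).add ((hC.mul hP).mul_const τ₁)).add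
    (hW.tendsto.comp hC) |>.add ((hD.const_mul δ).div_const 2)
  simp only [mul_zero, zero_div, add_zero] at hfin
  exact hfin

/-- States joined by a no-flux phase boundary lie at the same level of `Γ`. -/
theorem level_eq_of_phaseBoundary {τ₁ θ δ μ lam : ℝ} {W : ℝ → ℝ → ℝ} {d : ℕ}
    {e : EuclideanSpace ℝ (Fin d)} {R C : ℝ → ℝ} {a b : ℝ × ℝ} (hδ : 0 < δ) (hτ : 0 < τ₁)
    (he : ‖e‖ = 1) {w : ℝ → ℝ} (hw : ∀ c ∈ Ioo (0 : ℝ) 1, HasDerivAt (fun c => W c θ) (w c) c)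
    (ha : a ∈ stateSpace τ₁) (hb : b ∈ stateSpace τ₁)
    (h : IsNoFluxPhaseBoundary τ₁ W θ d δ μ lam e R C a b) :
    Ghat τ₁ (pressure τ₁ W θ a) a.2 + W a.2 θ = Ghat τ₁ (pressure τ₁ W θ b) b.2 + W b.2 θ := by
  obtain ⟨hR, hC, hmem, hP, hbal, hphase⟩ := ode_of_isSolution hδ he hτ h.solution
  have hRd : Differentiable ℝ R := hR.differentiable (by norm_num)
  have hCd : Differentiable ℝ C := hC.differentiable (by norm_num)
  have hCd' : Differentiable ℝ (deriv C) :=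
    hC.differentiable_deriv_two
  have h2 : Differentiable ℝ fun s => δ * R s * deriv C s ^ 2 := by fun_prop
  have hk : ∀ s, pressure τ₁ W θ (R s, C s) + δ * R s * deriv C s ^ 2
      = pressure τ₁ W θ (R 0, C 0) + δ * R 0 * deriv C 0 ^ 2 := fun s =>
    is_const_of_deriv_eq_zero (hP.add h2) (fun s => by
      rw [deriv_add (hP s) (h2 s)]; exact hbal s) s 0
  have hE : ∀ s, HasDerivAt (fun s => Ghat τ₁ (pressure τ₁ W θ (R s, C s)) (C s) + W (C s) θ
      + δ * deriv C s ^ 2 / 2) 0 s := fun s => by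
    have hcI : C s ∈ Ioo (0 : ℝ) 1 := (hmem s).2.2
    have := hasDerivAt_energy (τ₁ := τ₁) (δ := δ) (w := fun c => W c θ) (hP s).hasDerivAt
      (hRd s).hasDerivAt (hCd s) (hCd' s).hasDerivAt (hw _ hcI) (pressure_mem hτ (hmem s) W θ).1
      (hmem s).1 (one_div_eq_spvol hτ (hmem s) W θ) (hbal s)
    refine this.congr_deriv ?_
    have hph := hphase s
    rw [rate_eq hτ (hmem s) (hw _ hcI)] at hph
    rw [hph, mul_zero]
  have hconst : ∀ s, Ghat τ₁ (pressure τ₁ W θ (R s, C s)) (C s) + W (C s) θ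
      + δ * deriv C s ^ 2 / 2 = Ghat τ₁ (pressure τ₁ W θ (R 0, C 0)) (C 0) + W (C 0) θ
      + δ * deriv C 0 ^ 2 / 2 := fun s =>
    is_const_of_deriv_eq_zero (fun s => (hE s).differentiableAt) (fun s => (hE s).deriv) s 0
  have la := tendsto_energy hδ hτ ha hmem h.left_end (hw _ ha.2.2).continuousAt hk fun L hL =>
    eq_zero_of_tendsto_deriv_sq_atBot hCd ((continuous_snd.tendsto a).comp h.left_end) hL
  have lb := tendsto_energy hδ hτ hb hmem h.right_end (hw _ hb.2.2).continuousAt hk fun L hL =>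
    eq_zero_of_tendsto_deriv_sq hCd ((continuous_snd.tendsto b).comp h.right_end) hL
  simp only [hconst] at la lb
  exact (tendsto_nhds_unique la tendsto_const_nhds).trans
    (tendsto_nhds_unique tendsto_const_nhds lb)

/-! ### Phase boundaries from profiles -/

namespace IsProfile

variable {τ₁ δ ϖ θ a b : ℝ} {W : ℝ → ℝ → ℝ} {p C : ℝ → ℝ}

theorem proot_eq (h : IsProfile τ₁ δ ϖ a b (fun c => W c θ) p C) (hτ : 0 < τ₁) (hδ : 0 < δ)
    (hϖ : 0 < ϖ) (hsub : Icc a b ⊆ Ioo 0 1) (x : ℝ) :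
    p x = proot τ₁ ϖ (C x) (√δ * deriv C x) := by
  have hc := hsub (Ioo_subset_Icc_self (h.mem_C x))
  have hp := (h.mem_p x).1
  refine ((proot_spec hτ hϖ hc.1 hc.2 _).2 _ hp).1 ?_
  have hs := spvol_pos hτ hp hc
  have hb := h.balance x
  have e : C x * τ₁ * p x + (1 - C x) = p x * spvol τ₁ (p x) (C x) := by
    rw [spvol]; field_simp
  have e2 : δ * deriv C x ^ 2 = (ϖ - p x) * spvol τ₁ (p x) (C x) := by
    rw [← div_eq_iff hs.ne']
    linarith
  rw [mul_pow, Real.sq_sqrt hδ.le, e, e2]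
  ring

theorem Gam_eq (h : IsProfile τ₁ δ ϖ a b (fun c => W c θ) p C) (hτ : 0 < τ₁) (hδ : 0 < δ)
    (hϖ : 0 < ϖ) (hsub : Icc a b ⊆ Ioo 0 1) (x : ℝ) :
    Gam τ₁ W θ ϖ (C x, √δ * deriv C x) = Ghat τ₁ ϖ a + W a θ := by
  rw [Gam, ← h.proot_eq hτ hδ hϖ hsub x, ← h.energy x, mul_pow, Real.sq_sqrt hδ.le]
  ring

theorem Gam_level_right (h : IsProfile τ₁ δ ϖ a b (fun c => W c θ) p C)
    (hW : ContinuousAt (fun c => W c θ) b) (hϖ : 0 < ϖ) :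
    Ghat τ₁ ϖ b + W b θ = Ghat τ₁ ϖ a + W a θ := by
  have h1 := (((h.C_top.const_sub 1).mul ((h.p_top.log hϖ.ne').const_add 1)).add
    ((h.C_top.mul h.p_top).mul_const τ₁)).add (hW.tendsto.comp h.C_top) |>.add
      (((h.deriv_top.pow 2).const_mul δ).div_const 2)
  have h2 : Tendsto (fun x => Ghat τ₁ (p x) (C x) + W (C x) θ + δ * deriv C x ^ 2 / 2) atTop
      (𝓝 (Ghat τ₁ ϖ b + W b θ + δ * 0 ^ 2 / 2)) := h1
  rw [funext h.energy] at h2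
  have := tendsto_nhds_unique h2 tendsto_const_nhds
  linarith

theorem joins (h : IsProfile τ₁ δ ϖ a b (fun c => W c θ) p C) (hτ : 0 < τ₁) (hδ : 0 < δ)
    (hϖ : 0 < ϖ) (hab : a ≤ b) (hsub : Icc a b ⊆ Ioo 0 1) :
    JoinsInLevelSet (Gam τ₁ W θ ϖ) (fun x => (C x, √δ * deriv C x)) (a, 0) (b, 0) := by
  refine ⟨fun x => ?_, ?_, ?_⟩
  · rw [h.Gam_eq hτ hδ hϖ hsub, Gam_zero hτ hϖ (hsub (left_mem_Icc.2 hab))]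
  · exact h.C_bot.prodMk_nhds (by simpa using h.deriv_bot.const_mul √δ)
  · exact h.C_top.prodMk_nhds (by simpa using h.deriv_top.const_mul √δ)

theorem joins_reflected (h : IsProfile τ₁ δ ϖ a b (fun c => W c θ) p C) (hτ : 0 < τ₁)
    (hδ : 0 < δ) (hϖ : 0 < ϖ) (hab : a ≤ b) (hsub : Icc a b ⊆ Ioo 0 1)
    (hW : ContinuousAt (fun c => W c θ) b) :
    JoinsInLevelSet (Gam τ₁ W θ ϖ) (fun x => (C (-x), √δ * deriv (fun s => C (-s)) x))
      (b, 0) (a, 0) := by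
  have hj := h.joins hτ hδ hϖ hab hsub
  simp only [deriv_comp_neg]
  have hd : ∀ l l', Tendsto Neg.neg l l' → Tendsto (deriv C) l' (𝓝 0) →
      Tendsto (fun x => √δ * -deriv C (-x)) l (𝓝 0) := fun l l' hl hd => by
    simpa using ((hd.comp hl).neg.const_mul √δ)
  refine ⟨fun x => ?_, ?_, ?_⟩
  · have e1 := h.Gam_eq hτ hδ hϖ hsub (-x)
    rw [Gam_zero hτ hϖ (hsub (right_mem_Icc.2 hab)), h.Gam_level_right hW hϖ, ← e1]
    -- `Γ` is even in `y`, so reflection preserves its level sets.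
    simp only [Gam, proot, mul_neg, neg_sq]
  · exact (h.C_top.comp tendsto_neg_atBot_atTop).prodMk_nhds
      (hd _ _ tendsto_neg_atBot_atTop h.deriv_top)
  · exact (h.C_bot.comp tendsto_neg_atTop_atBot).prodMk_nhds
      (hd _ _ tendsto_neg_atTop_atBot h.deriv_bot)

/-- The energy is constant and `C' > 0`, so `hasDerivAt_energy` can be divided by `C' / R` to give
the phase equation. -/
theorem isSolution (h : IsProfile τ₁ δ ϖ a b (fun c => W c θ) p C) (hτ : 0 < τ₁)
    (hϖ : ϖ ∈ Ioo 0 (1 / τ₁)) (hsub : Icc a b ⊆ Ioo 0 1) {w : ℝ → ℝ}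
    (hw : ∀ c ∈ Ioo (0 : ℝ) 1, HasDerivAt (fun c => W c θ) (w c) c) {d : ℕ}
    {e : EuclideanSpace ℝ (Fin d)} (he : ‖e‖ = 1) (μ lam : ℝ) :
    IsSolution τ₁ W θ d δ μ lam (fun _ x => (mkState τ₁ (p (inner ℝ e x)) (C (inner ℝ e x))).1)
      (fun _ _ => 0) (fun _ x => C (inner ℝ e x)) := by
  have hI : ∀ x, C x ∈ Ioo (0 : ℝ) 1 := fun x => hsub (Ioo_subset_Icc_self (h.mem_C x))
  have hpI : ∀ x, p x ∈ Ioo 0 (1 / τ₁) := fun x =>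
    ⟨(h.mem_p x).1, (h.mem_p x).2.trans hϖ.2⟩
  have hC1 : ContDiff ℝ 1 C := h.smooth_C.of_le (by norm_num)
  have hp1 := h.smooth_p
  have hR : ContDiff ℝ 1 fun x => (mkState τ₁ (p x) (C x)).1 := by
    have hq : ContDiff ℝ 1 fun x => (1 - C x) / p x :=
      ContDiff.div (by fun_prop) hp1 fun x => (hpI x).1.ne'
    unfold mkState
    refine contDiff_const.div ?_ fun x => (spvol_pos hτ (hpI x).1 (hI x)).ne'
    unfold spvol
    fun_prop
  have hmem : ∀ x, ((mkState τ₁ (p x) (C x)).1, C x) ∈ stateSpace τ₁ := fun x =>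
    mkState_mem hτ (hpI x) (hI x)
  have hpr : ∀ x, pressure τ₁ W θ ((mkState τ₁ (p x) (C x)).1, C x) = p x := fun x =>
    pressure_mkState hτ (hpI x) (hI x) W θ
  have hpd : Differentiable ℝ p := hp1.differentiable (by norm_num)
  have hRd := hR.differentiable (by norm_num)
  have hCd : Differentiable ℝ C := hC1.differentiable (by norm_num)
  have hCd' : Differentiable ℝ (deriv C) := h.smooth_C.differentiable_deriv_two
  have hbal : ∀ x, p x + δ * (mkState τ₁ (p x) (C x)).1 * deriv C x ^ 2 = ϖ := fun x => by
    rw [← h.balance x, mkState]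
    ring
  refine isSolution_planar (R := fun x => (mkState τ₁ (p x) (C x)).1) he hR h.smooth_C hmem
    ?_ (fun s => ?_) fun s => ?_
  · simpa only [hpr] using hpd
  · rw [hpr, hpr, hbal, hbal]
  · have h2 : Differentiable ℝ fun s => δ * (mkState τ₁ (p s) (C s)).1 * deriv C s ^ 2 := by
      fun_prop
    have hb' : deriv p s
        + deriv (fun s => δ * (mkState τ₁ (p s) (C s)).1 * deriv C s ^ 2) s = 0 := by
      rw [← deriv_fun_add (hpd s) (h2 s), funext hbal, deriv_const]
    have hE := hasDerivAt_energy (τ₁ := τ₁) (δ := δ) (w := fun c => W c θ) (hpd s).hasDerivAt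
      (hRd s).hasDerivAt (hCd s) (hCd' s).hasDerivAt (hw _ (hI s)) (hpI s).1 (hmem s).1
      (one_div_one_div _) hb'
    rw [funext h.energy] at hE
    have hz := hE.unique (hasDerivAt_const s _)
    rw [rate_eq hτ (hmem s) (hw _ (hI s)), hpr]
    exact (mul_eq_zero.1 hz).resolve_left
      (neg_ne_zero.2 (div_pos (h.deriv_pos s) (hmem s).1).ne')

/-- The filter is arbitrary so that the lemma covers both the limits of profiles and the continuity
of the Maxwell states in `θ`. -/
theorem tendsto_mkState {l : Filter ℝ} {c : ℝ} (hτ : 0 < τ₁) (hϖ : 0 < ϖ)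
    (hc : c ∈ Ioo (0 : ℝ) 1) (hp : Tendsto p l (𝓝 ϖ)) (hC : Tendsto C l (𝓝 c)) :
    Tendsto (fun x => mkState τ₁ (p x) (C x)) l (𝓝 (mkState τ₁ ϖ c)) := by
  have h1 : Tendsto (fun x => spvol τ₁ (p x) (C x)) l (𝓝 (spvol τ₁ ϖ c)) :=
    (hC.mul_const τ₁).add ((hC.const_sub 1).div hp hϖ.ne')
  exact (tendsto_const_nhds.div h1 (spvol_pos hτ hϖ hc).ne').prodMk_nhds hC

theorem isNoFluxPhaseBoundary (h : IsProfile τ₁ δ ϖ a b (fun c => W c θ) p C) (hτ : 0 < τ₁)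
    (hϖ : ϖ ∈ Ioo 0 (1 / τ₁)) (hab : a ≤ b) (hsub : Icc a b ⊆ Ioo 0 1) {w : ℝ → ℝ}
    (hw : ∀ c ∈ Ioo (0 : ℝ) 1, HasDerivAt (fun c => W c θ) (w c) c) {d : ℕ}
    {e : EuclideanSpace ℝ (Fin d)} (he : ‖e‖ = 1) (μ lam : ℝ) :
    IsNoFluxPhaseBoundary τ₁ W θ d δ μ lam e (fun x => (mkState τ₁ (p x) (C x)).1) C
        (mkState τ₁ ϖ a) (mkState τ₁ ϖ b) ∧
      IsNoFluxPhaseBoundary τ₁ W θ d δ μ lam e (fun x => (mkState τ₁ (p (-x)) (C (-x))).1)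
        (fun x => C (-x)) (mkState τ₁ ϖ b) (mkState τ₁ ϖ a) := by
  have ha := hsub (left_mem_Icc.2 hab)
  have hb := hsub (right_mem_Icc.2 hab)
  have hbot := tendsto_mkState hτ hϖ.1 ha h.p_bot h.C_bot
  have htop := tendsto_mkState hτ hϖ.1 hb h.p_top h.C_top
  refine ⟨⟨h.isSolution hτ hϖ hsub hw he μ lam, hbot, htop⟩, ⟨?_, ?_, ?_⟩⟩
  · have := h.isSolution hτ hϖ hsub hw (e := -e) (by rwa [norm_neg]) μ lam
    simpa only [inner_neg_left] using this
  · exact htop.comp tendsto_neg_atBot_atTop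
  · exact hbot.comp tendsto_neg_atTop_atBot

end IsProfile

/-! ### Maxwell states as fluid states -/

theorem isOpen_stateSpace (τ₁ : ℝ) : IsOpen (stateSpace τ₁) := by
  have e : stateSpace τ₁ = {s : ℝ × ℝ | 0 < s.1} ∩ {s | τ₁ * s.1 < 1} ∩
      ({s | 0 < s.2} ∩ {s | s.2 < 1}) := by
    ext s
    simp only [stateSpace, mem_inter_iff, mem_ofPred_eq]
    constructor
    · rintro ⟨h1, h2, h3, h4⟩
      exact ⟨⟨h1, (lt_div_iff₀ h1).1 h2⟩, h3, h4⟩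
    · rintro ⟨⟨h1, h2⟩, h3, h4⟩
      exact ⟨h1, (lt_div_iff₀ h1).2 h2, h3, h4⟩
  rw [e]
  exact ((isOpen_lt (by fun_prop) (by fun_prop)).inter (isOpen_lt (by fun_prop) (by fun_prop))).inter
    ((isOpen_lt (by fun_prop) (by fun_prop)).inter (isOpen_lt (by fun_prop) (by fun_prop)))

/-- At fixed pressure the specific volume is affine in `c` with slope `τ₁ - 1 / p < 0`, so density
increases with `c`. -/
theorem mkState_fst_lt {τ₁ p a b : ℝ} (hτ : 0 < τ₁) (hp : p ∈ Ioo 0 (1 / τ₁))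
    (hb : b ∈ Ioo (0 : ℝ) 1) (hab : a < b) : (mkState τ₁ p a).1 < (mkState τ₁ p b).1 := by
  refine one_div_lt_one_div_of_lt (spvol_pos hτ hp.1 hb) ?_
  have h1 : τ₁ < 1 / p := by
    rw [lt_div_iff₀ hp.1]
    have := (lt_div_iff₀ hτ).1 hp.2
    linarith
  rw [spvol, spvol, div_eq_mul_one_div (1 - b), div_eq_mul_one_div (1 - a)]
  nlinarith

namespace IsMaxwellFamily

variable {W : ℝ → ℝ → ℝ} {Θ : Set ℝ} {cs θs θt ε κ : ℝ} {a b : ℝ → ℝ}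

/-- Two states with equal pressure that are critical points of `Γ` at the same level are the
Maxwell states. -/
theorem eq_states (hM : IsMaxwellFamily W Θ cs θs θt ε κ a b) {τ₁ θ ϖ : ℝ} (hτ : 0 < τ₁)
    (hθ : θ ∈ Ioo θt θs) (hϖ : ϖ ∈ Ioo 0 (1 / τ₁)) (hell : ell τ₁ ϖ = dcW W 1 (a θ, θ))
    {s t : ℝ × ℝ} (hs : s ∈ stateSpace τ₁) (ht : t ∈ stateSpace τ₁)
    (hs2 : s.2 ∈ Ioo (cs - ε) (cs + ε)) (ht2 : t.2 ∈ Ioo (cs - ε) (cs + ε)) (hne : s.2 ≠ t.2)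
    (hp : pressure τ₁ W θ s = pressure τ₁ W θ t)
    (hcs : dcW W 1 (s.2, θ) = ell τ₁ (pressure τ₁ W θ s))
    (hct : dcW W 1 (t.2, θ) = ell τ₁ (pressure τ₁ W θ s))
    (hlevel : Ghat τ₁ (pressure τ₁ W θ s) s.2 + W s.2 θ
      = Ghat τ₁ (pressure τ₁ W θ s) t.2 + W t.2 θ) :
    (s = mkState τ₁ ϖ (a θ) ∧ t = mkState τ₁ ϖ (b θ)) ∨
      (s = mkState τ₁ ϖ (b θ) ∧ t = mkState τ₁ ϖ (a θ)) := by
  have hinj : ∀ {m}, m = ell τ₁ (pressure τ₁ W θ s) → m = ell τ₁ ϖ →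
      pressure τ₁ W θ s = ϖ := fun h1 h2 =>
    (ell_strictMonoOn hτ).injOn (Ioo_subset_Ioc_self (pressure_mem hτ hs W θ))
      (Ioo_subset_Ioc_self hϖ) (h1.symm.trans h2)
  have hes := eq_mkState hτ hs W θ
  have het := eq_mkState hτ ht W θ
  rw [← hp] at het
  rw [Ghat_affine τ₁ _ t.2 s.2] at hlevel
  rcases lt_or_gt_of_ne hne with hlt | hlt
  · obtain ⟨e1, e2⟩ := hM.unique θ hθ s.2 hs2 t.2 ht2 hlt (hcs.trans hct.symm)
      (by rw [hcs]; linarith)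
    have h3 : pressure τ₁ W θ s = ϖ := hinj hcs (by rw [e1, hell])
    rw [h3, e1] at hes
    rw [h3, e2] at het
    exact Or.inl ⟨hes, het⟩
  · obtain ⟨e1, e2⟩ := hM.unique θ hθ t.2 ht2 s.2 hs2 hlt (hct.trans hcs.symm)
      (by rw [hct]; linarith)
    have h3 : pressure τ₁ W θ s = ϖ := hinj hct (by rw [e1, hell])
    rw [h3, e2] at hes
    rw [h3, e1] at het
    exact Or.inr ⟨hes, het⟩

/-- A bound on `W_cc` over the compact interval supplies the Lipschitz constant of the slope. The
interval is shorter than `2ε` and slopes on it differ by at most `2κ ≤ 2`, so the gap is below `4ε`;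
hence the form of `hε`. -/
theorem exists_profile (hM : IsMaxwellFamily W Θ cs θs θt ε κ a b)
    (hW : GenericTransition W Θ cs θs) {τ₁ δ θ ϖ : ℝ} (hτ : 0 < τ₁) (hδ : 0 < δ)
    (hθ : θ ∈ Ioo θt θs) (hϖ : ϖ ∈ Ioo 0 (1 / τ₁)) (hell : ell τ₁ ϖ = dcW W 1 (a θ, θ))
    (hκ : κ ≤ 1) (hε : 4 * ε ≤ (cs - ε) * τ₁ * ϖ / 4) :
    ∃ p C : ℝ → ℝ, IsProfile τ₁ δ ϖ (a θ) (b θ) (fun c => W c θ) p C := by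
  have hθ' := Ioo_subset_Ioc_self hθ
  have hΘ := hM.temp_subset hθ'
  have hab := hM.lt θ hθ
  have hma := hM.mem_left θ hθ'
  have hmb := hM.mem_right θ hθ'
  have hsubI : Icc (a θ) (b θ) ⊆ Icc (cs - ε) (cs + ε) := Icc_subset_Icc hma.1.le hmb.2.le
  have hsub : Icc (a θ) (b θ) ⊆ Ioo 0 1 := hsubI.trans hM.frac_subset
  have hd : ∀ c ∈ Icc (a θ) (b θ), HasDerivAt (fun c => W c θ) (dcW W 1 (c, θ)) c :=
    fun c hc => hW.hasDerivAt_W (hsub hc) hΘ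
  have hd1 : ∀ c ∈ Icc (a θ) (b θ), HasDerivAt (fun c => dcW W 1 (c, θ)) (dcW W 2 (c, θ)) c :=
    fun c hc => hW.hasDerivAt_dcW (by norm_num) (hsub hc) hΘ
  have hd2 : ContinuousOn (fun c => dcW W 2 (c, θ)) (Icc (a θ) (b θ)) := fun c hc =>
    (hW.hasDerivAt_dcW (k := 2) (by norm_num) (hsub hc) hΘ).continuousAt.continuousWithinAt
  obtain ⟨K, hK⟩ := isCompact_Icc.exists_bound_of_continuousOn hd2
  have hL : ∀ x ∈ Icc (a θ) (b θ), ∀ y ∈ Icc (a θ) (b θ),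
      |dcW W 1 (y, θ) - dcW W 1 (x, θ)| ≤ K * |y - x| := fun x hx y hy =>
    (convex_Icc (a θ) (b θ)).norm_image_sub_le_of_norm_hasDerivWithin_le
      (fun c hc => (hd1 c hc).hasDerivWithinAt) hK hx hy
  have hl := left_mem_Icc.2 hab.le
  have hr := right_mem_Icc.2 hab.le
  refine NSAC.exists_profile (w1 := fun c => dcW W 1 (c, θ)) (K := K) hτ hδ hϖ hab hsub
    (fun c hc => ?_) hd (fun c hc => ?_) (fun c hc => ?_) ?_ (fun c hc => ?_) (fun c hc => ?_)
  · have h1 := hW.contDiffAt_dcW (k := 0) (m := 4) (by norm_num)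
      (hsub (Ioo_subset_Icc_self hc)) hΘ
    have h2 : ContDiffAt ℝ 1 (fun c : ℝ => dcW W 0 (c, θ)) c :=
      (h1.of_le (by norm_num)).comp (f := fun c : ℝ => (c, θ)) c (by fun_prop)
    simpa [dcW] using h2.contDiffWithinAt
  · rw [hell]
    have := hL _ hl c hc
    rwa [abs_of_nonneg (sub_nonneg.2 hc.1)] at this
  · rw [hell, hM.slope_eq θ hθ']
    have := hL _ hr c hc
    rwa [abs_of_nonpos (sub_nonpos.2 hc.2), neg_sub] at this
  · rw [hell]; exact hM.tangent θ hθ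
  · rw [hell]; exact hM.above θ hθ c hc
  · obtain ⟨t, ht, e⟩ := exists_slope hc.1 fun x hx => hd x ⟨hx.1, hx.2.trans hc.2.le⟩
    have h1 := abs_lt.1 (hM.slope_near t (hsubI ⟨ht.1.le, ht.2.le.trans hc.2.le⟩) θ hθ')
    have h2 := abs_lt.1 (hM.slope_near _ (hsubI hl) θ hθ')
    have h3 : dcW W 1 (t, θ) - ell τ₁ ϖ ≤ 2 := by rw [hell]; linarith
    have h4 : (dcW W 1 (t, θ) - ell τ₁ ϖ) * (c - a θ) ≤ 2 * (c - a θ) :=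
      mul_le_mul_of_nonneg_right h3 (by linarith [hc.1])
    have h5 : (cs - ε) * τ₁ * ϖ / 4 ≤ c * τ₁ * ϖ / 4 := by
      have h6 := mul_pos hτ hϖ.1
      have h7 := mul_le_mul_of_nonneg_right (hma.1.trans hc.1).le h6.le
      linarith
    linarith [hc.1, hc.2, hma.1, hmb.2]

end IsMaxwellFamily

end NSAC

end

/-! ### The theorem: choice of constants and assembly -/

theorem theorem1
    (τ₁ : ℝ) (hτ₀ : 0 < τ₁) (hτ₁ : τ₁ < 1)
    (W : ℝ → ℝ → ℝ) (Θ : Set ℝ) (cs θs : ℝ)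
    (hW : NSAC.GenericTransition W Θ cs θs)
    (hslope : deriv (fun c => W c θs) cs < -Real.log τ₁)
    (d : ℕ) (hd : 1 ≤ d) (δ : ℝ) (hδ : 0 < δ) (μ lam : ℝ) :
    ∃ θt : ℝ, θt < θs ∧ Ioc θt θs ⊆ Θ ∧
    ∃ N : Set (ℝ × ℝ), IsOpen N ∧ N ⊆ NSAC.stateSpace τ₁ ∧
    ∃ lo hi : ℝ → ℝ × ℝ,
      ContinuousOn lo (Ioc θt θs) ∧ ContinuousOn hi (Ioc θt θs) ∧
      (∀ θ ∈ Ioc θt θs,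
        lo θ ∈ N ∧ hi θ ∈ N ∧ NSAC.IsEquilibriumPair τ₁ W θ (lo θ) (hi θ)) ∧
      -- the critical temperature
      lo θs = hi θs ∧ (lo θs).2 = cs ∧
      (∀ a ∈ N, ∀ b ∈ N, NSAC.IsEquilibriumPair τ₁ W θs a b → a = b) ∧
      -- temperatures below the critical one
      (∀ θ ∈ Ioo θt θs,
        (lo θ).1 < (hi θ).1 ∧
        -- the two end states, as equal-level saddles
        NSAC.AreEqualLevelSaddles (NSAC.Gam τ₁ W θ (NSAC.pressure τ₁ W θ (lo θ)))
          ((lo θ).2, 0) ((hi θ).2, 0) ∧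
        -- the two profiles, as heteroclinic orbits between these saddles
        (∃ R C : ℝ → ℝ,
          (∀ e : EuclideanSpace ℝ (Fin d), ‖e‖ = 1 →
            NSAC.IsNoFluxPhaseBoundary τ₁ W θ d δ μ lam e R C (lo θ) (hi θ) ∧
            NSAC.IsNoFluxPhaseBoundary τ₁ W θ d δ μ lam e
              (fun x => R (-x)) (fun x => C (-x)) (hi θ) (lo θ)) ∧
          (∀ x, 0 < deriv C x) ∧
          (∀ x, NSAC.pressure τ₁ W θ (R x, C x)
            = NSAC.proot τ₁ (NSAC.pressure τ₁ W θ (lo θ)) (C x) (Real.sqrt δ * deriv C x)) ∧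
          NSAC.JoinsInLevelSet (NSAC.Gam τ₁ W θ (NSAC.pressure τ₁ W θ (lo θ)))
            (fun x => (C x, Real.sqrt δ * deriv C x)) ((lo θ).2, 0) ((hi θ).2, 0) ∧
          NSAC.JoinsInLevelSet (NSAC.Gam τ₁ W θ (NSAC.pressure τ₁ W θ (lo θ)))
            (fun x => (C (-x), Real.sqrt δ * deriv (fun s => C (-s)) x))
            ((hi θ).2, 0) ((lo θ).2, 0)) ∧
        -- local uniqueness of the pair, among the pairs that are joined by a profile
        (∀ a ∈ N, ∀ b ∈ N, a ≠ b → NSAC.IsEquilibriumPair τ₁ W θ a b →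
          ∀ (e : EuclideanSpace ℝ (Fin d)) (R C : ℝ → ℝ), ‖e‖ = 1 →
            NSAC.IsNoFluxPhaseBoundary τ₁ W θ d δ μ lam e R C a b →
            (a = lo θ ∧ b = hi θ) ∨ (a = hi θ ∧ b = lo θ)) ∧
        -- local uniqueness of the pressure and of the pair, among the equal-level saddles
        (∀ a ∈ N, ∀ b ∈ N, NSAC.pressure τ₁ W θ a = NSAC.pressure τ₁ W θ b →
          NSAC.AreEqualLevelSaddles (NSAC.Gam τ₁ W θ (NSAC.pressure τ₁ W θ a))
            (a.2, 0) (b.2, 0) →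
          (a = lo θ ∧ b = hi θ) ∨ (a = hi θ ∧ b = lo θ))) := by
  have hWd : ∀ θ ∈ Θ, ∀ c ∈ Ioo (0 : ℝ) 1,
      HasDerivAt (fun c => W c θ) (NSAC.dcW W 1 (c, θ)) c := fun θ hθ c hc =>
    hW.hasDerivAt_W hc hθ
  have hW2 : ∀ θ ∈ Θ, ContDiffOn ℝ 2 (fun c => W c θ) (Ioo 0 1) := fun θ hθ c hc => by
    have h1 := hW.contDiffAt_dcW (k := 0) (m := 4) (by norm_num) hc hθ
    have h2 : ContDiffAt ℝ 2 (fun c : ℝ => NSAC.dcW W 0 (c, θ)) c :=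
      (h1.of_le (by norm_num)).comp (f := fun c : ℝ => (c, θ)) c (by fun_prop)
    simpa [NSAC.dcW] using h2.contDiffWithinAt
  set ws : ℝ := NSAC.dcW W 1 (cs, θs) with hws
  have hslope' : ws < -Real.log τ₁ := by
    rw [hws, (hWd θs hW.mem_temp cs hW.mem_frac).deriv.symm]
    exact hslope
  have hcs := hW.mem_frac
  -- `κ` bounds the oscillation of the slope: all slopes that occur stay below `-log τ₁`, so each is
  -- the value of `ell` at a pressure in `(0, 1 / τ₁)`.
  obtain ⟨κ, hκ0, hκ1, hκ⟩ : ∃ κ, 0 < κ ∧ κ ≤ 1 ∧ ws + κ < -Real.log τ₁ :=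
    ⟨min 1 ((-Real.log τ₁ - ws) / 2), lt_min one_pos (by linarith), min_le_left _ _, by
      have := min_le_right 1 ((-Real.log τ₁ - ws) / 2)
      linarith⟩
  have hexp : 0 < Real.exp (ws - κ - 1) := Real.exp_pos _
  -- With `ε ≤ cs / 2` and `ϖ > exp (ws - κ - 1)`, the denominator `32` is what yields `4ε ≤ (cs -
  -- ε) τ₁ ϖ / 4`.
  have hq : 0 < cs * τ₁ * Real.exp (ws - κ - 1) / 32 := by
    have := mul_pos (mul_pos hcs.1 hτ₀) hexp
    linarith
  obtain ⟨ε, θt, a, b, hε, hM⟩ := hW.exists_maxwellFamily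
    (lt_min (half_pos hcs.1) hq) hκ0
  obtain ⟨P, hPc, hP⟩ := NSAC.exists_ell_inverse hτ₀ (by linarith : ws - κ ≤ ws + κ) hκ
  have hm : ∀ θ ∈ Ioc θt θs, NSAC.dcW W 1 (a θ, θ) ∈ Icc (ws - κ) (ws + κ) := fun θ hθ => by
    have := abs_lt.1 (hM.slope_near _ (Ioo_subset_Icc_self (hM.mem_left θ hθ)) θ hθ)
    constructor <;> linarith
  set ϖ : ℝ → ℝ := fun θ => P (NSAC.dcW W 1 (a θ, θ)) with hϖ_def
  have hϖ : ∀ θ ∈ Ioc θt θs, ϖ θ ∈ Ioo 0 (1 / τ₁) := fun θ hθ => (hP _ (hm θ hθ)).1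
  have hell : ∀ θ ∈ Ioc θt θs, NSAC.ell τ₁ (ϖ θ) = NSAC.dcW W 1 (a θ, θ) := fun θ hθ =>
    (hP _ (hm θ hθ)).2
  have hIa : ∀ θ ∈ Ioc θt θs, a θ ∈ Ioo (0 : ℝ) 1 := fun θ hθ =>
    hM.frac_subset (Ioo_subset_Icc_self (hM.mem_left θ hθ))
  have hIb : ∀ θ ∈ Ioc θt θs, b θ ∈ Ioo (0 : ℝ) 1 := fun θ hθ =>
    hM.frac_subset (Ioo_subset_Icc_self (hM.mem_right θ hθ))
  have hϖc : ContinuousOn ϖ (Ioc θt θs) := by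
    refine hPc.comp (f := fun θ => NSAC.dcW W 1 (a θ, θ)) (fun θ hθ => ?_) hm
    exact (hW.continuousAt_dcW (k := 1) (by norm_num) (hIa θ hθ) (hM.temp_subset hθ)).tendsto.comp
      ((hM.continuousOn_left θ hθ).prodMk_nhds (tendsto_id.mono_left nhdsWithin_le_nhds))
  have hcont : ∀ c : ℝ → ℝ, ContinuousOn c (Ioc θt θs) → (∀ θ ∈ Ioc θt θs, c θ ∈ Ioo (0 : ℝ) 1) →
      ContinuousOn (fun θ => NSAC.mkState τ₁ (ϖ θ) (c θ)) (Ioc θt θs) := fun c hc hI θ hθ =>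
    NSAC.IsProfile.tendsto_mkState hτ₀ (hϖ θ hθ).1 (hI θ hθ) (hϖc θ hθ) (hc θ hθ)
  have hpa : ∀ θ ∈ Ioc θt θs, NSAC.pressure τ₁ W θ (NSAC.mkState τ₁ (ϖ θ) (a θ)) = ϖ θ :=
    fun θ hθ => NSAC.pressure_mkState hτ₀ (hϖ θ hθ) (hIa θ hθ) W θ
  have hpb : ∀ θ ∈ Ioc θt θs, NSAC.pressure τ₁ W θ (NSAC.mkState τ₁ (ϖ θ) (b θ)) = ϖ θ :=
    fun θ hθ => NSAC.pressure_mkState hτ₀ (hϖ θ hθ) (hIb θ hθ) W θ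
  have hsa : ∀ θ ∈ Ioc θt θs, NSAC.mkState τ₁ (ϖ θ) (a θ) ∈ NSAC.stateSpace τ₁ :=
    fun θ hθ => NSAC.mkState_mem hτ₀ (hϖ θ hθ) (hIa θ hθ)
  have hsb : ∀ θ ∈ Ioc θt θs, NSAC.mkState τ₁ (ϖ θ) (b θ) ∈ NSAC.stateSpace τ₁ :=
    fun θ hθ => NSAC.mkState_mem hτ₀ (hϖ θ hθ) (hIb θ hθ)
  have hstate : ∀ θ, ∀ s ∈ NSAC.stateSpace τ₁, ∀ t ∈ NSAC.stateSpace τ₁,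
      NSAC.pressure τ₁ W θ s = NSAC.pressure τ₁ W θ t → s.2 = t.2 → s = t :=
    fun θ s hs t ht e1 e2 => by
      rw [NSAC.eq_mkState hτ₀ hs W θ, NSAC.eq_mkState hτ₀ ht W θ, e1, e2]
  have hcrit : ∀ θ ∈ Θ, ∀ s ∈ NSAC.stateSpace τ₁, NSAC.rate τ₁ W θ s = 0 →
      NSAC.dcW W 1 (s.2, θ) = NSAC.ell τ₁ (NSAC.pressure τ₁ W θ s) := fun θ hθ s hs e => by
    rw [NSAC.rate_eq hτ₀ hs (hWd θ hθ s.2 hs.2.2)] at e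
    linarith
  refine ⟨θt, hM.lt_crit, hM.temp_subset,
    -- Only the mass fraction is localized; densities and pressures range over all fluid states.
    NSAC.stateSpace τ₁ ∩ {s | s.2 ∈ Ioo (cs - ε) (cs + ε)},
    (NSAC.isOpen_stateSpace τ₁).inter (isOpen_Ioo.preimage continuous_snd), inter_subset_left,
    fun θ => NSAC.mkState τ₁ (ϖ θ) (a θ), fun θ => NSAC.mkState τ₁ (ϖ θ) (b θ),
    hcont a hM.continuousOn_left hIa, hcont b hM.continuousOn_right hIb, fun θ hθ => ?_, ?_,
    hM.left_crit, ?_, fun θ hθ => ?_⟩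
  · refine ⟨⟨hsa θ hθ, hM.mem_left θ hθ⟩, ⟨hsb θ hθ, hM.mem_right θ hθ⟩, ?_, ?_, ?_⟩
    · rw [NSAC.rate_eq hτ₀ (hsa θ hθ) (hWd θ (hM.temp_subset hθ) _ (hIa θ hθ)), hpa θ hθ,
        hell θ hθ]
      exact sub_self _
    · rw [NSAC.rate_eq hτ₀ (hsb θ hθ) (hWd θ (hM.temp_subset hθ) _ (hIb θ hθ)), hpb θ hθ,
        hell θ hθ, hM.slope_eq θ hθ]
      exact sub_self _
    · rw [hpa θ hθ, hpb θ hθ]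
  · simp only [hM.left_crit, hM.right_crit]
  · rintro s ⟨hs, hs2⟩ t ⟨ht, ht2⟩ ⟨e1, e2, e3⟩
    refine hstate θs s hs t ht e3 (hM.injOn_crit hs2 ht2 ?_)
    simp only
    rw [hcrit θs hW.mem_temp s hs e1, hcrit θs hW.mem_temp t ht e2, e3]
  · have hθ' := Ioo_subset_Ioc_self hθ
    have hΘ := hM.temp_subset hθ'
    have hab := hM.lt θ hθ
    have hϖθ := hϖ θ hθ'
    have hsub : Icc (a θ) (b θ) ⊆ Ioo 0 1 :=
      (Icc_subset_Icc (hM.mem_left θ hθ').1.le (hM.mem_right θ hθ').2.le).trans hM.frac_subset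
    have hsmall : 4 * ε ≤ (cs - ε) * τ₁ * ϖ θ / 4 := by
      have h1 := hε.trans (min_le_left _ _)
      have h2 := hε.trans (min_le_right _ _)
      have h3 : Real.exp (ws - κ - 1) < ϖ θ := NSAC.exp_sub_one_lt_of_ell_eq hτ₀ hϖθ.1 (by
        rw [hell θ hθ']; exact (hm θ hθ').1)
      have h4 : cs / 2 * τ₁ * Real.exp (ws - κ - 1) ≤ (cs - ε) * τ₁ * ϖ θ := by
        have h5 := hcs.1
        have h6 : cs / 2 ≤ cs - ε := by linarith
        have h7 : 0 < cs - ε := by linarith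
        gcongr
      linarith
    obtain ⟨p, C, hpC⟩ := hM.exists_profile hW hτ₀ hδ hθ hϖθ (hell θ hθ') hκ1 hsmall
    have hlevel := hpC.Gam_level_right (hWd θ hΘ _ (hIb θ hθ')).continuousAt hϖθ.1
    have hsaddle : ∀ c ∈ Ioo (0 : ℝ) 1, NSAC.dcW W 1 (c, θ) = NSAC.ell τ₁ (ϖ θ) →
        0 < NSAC.dcW W 2 (c, θ) → NSAC.IsSaddle (NSAC.Gam τ₁ W θ (ϖ θ)) (c, 0) :=
      fun c hc e1 e2 => NSAC.isSaddle_Gam hτ₀ hϖθ.1 hc (hW2 θ hΘ) (hWd θ hΘ)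
        (hW.hasDerivAt_dcW (by norm_num) hc hΘ) e1 e2
    simp only [hpa θ hθ']
    refine ⟨NSAC.mkState_fst_lt hτ₀ hϖθ (hIb θ hθ') hab, ⟨?_, ?_, ?_, ?_⟩,
      ⟨fun x => (NSAC.mkState τ₁ (p x) (C x)).1, C, fun e he =>
        hpC.isNoFluxPhaseBoundary hτ₀ hϖθ hab.le hsub (hWd θ hΘ) he μ lam, hpC.deriv_pos,
        fun x => ?_, hpC.joins hτ₀ hδ hϖθ.1 hab.le hsub,
        hpC.joins_reflected hτ₀ hδ hϖθ.1 hab.le hsub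
          (hWd θ hΘ _ (hIb θ hθ')).continuousAt⟩, ?_, ?_⟩
    · exact fun e => hab.ne (congrArg Prod.fst e)
    · exact hsaddle _ (hIa θ hθ') (hell θ hθ').symm (hM.convex_left θ hθ)
    · exact hsaddle _ (hIb θ hθ') ((hM.slope_eq θ hθ').symm.trans (hell θ hθ').symm) (hM.convex_right θ hθ)
    · simp only [NSAC.mkState]
      rw [NSAC.Gam_zero hτ₀ hϖθ.1 (hIa θ hθ'), NSAC.Gam_zero hτ₀ hϖθ.1 (hIb θ hθ'), hlevel]
    · rw [← hpC.proot_eq hτ₀ hδ hϖθ.1 hsub x]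
      exact NSAC.pressure_mkState hτ₀ ⟨(hpC.mem_p x).1, (hpC.mem_p x).2.trans hϖθ.2⟩
        (hsub (Ioo_subset_Icc_self (hpC.mem_C x))) W θ
    · rintro s ⟨hs, hs2⟩ t ⟨ht, ht2⟩ hne ⟨e1, e2, e3⟩ e R C he hRC
      -- Equal level is the missing tangency condition: equilibrium and equal pressure give only
      -- equal slopes.
      have hl := NSAC.level_eq_of_phaseBoundary hδ hτ₀ he (hWd θ hΘ) hs ht hRC
      rw [← e3] at hl
      exact hM.eq_states hτ₀ hθ hϖθ (hell θ hθ') hs ht hs2 ht2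
        (fun h => hne (hstate θ s hs t ht e3 h)) e3 (hcrit θ hΘ s hs e1)
        (by rw [hcrit θ hΘ t ht e2, e3]) hl
    · rintro s ⟨hs, hs2⟩ t ⟨ht, ht2⟩ e3 ⟨hne, s1, s2, hl⟩
      have hπ := (NSAC.pressure_mem hτ₀ hs W θ).1
      rw [NSAC.Gam_zero hτ₀ hπ hs.2.2, NSAC.Gam_zero hτ₀ hπ ht.2.2] at hl
      exact hM.eq_states hτ₀ hθ hϖθ (hell θ hθ') hs ht hs2 ht2 (fun h => hne (by rw [h])) e3
        (NSAC.slope_eq_of_isSaddle hτ₀ hπ hs.2.2 (hWd θ hΘ _ hs.2.2) s1)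
        (NSAC.slope_eq_of_isSaddle hτ₀ hπ ht.2.2 (hWd θ hΘ _ ht.2.2) s2) hl
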